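/- Let $n\ge 2$, $d\ge 2$. Let $X$ be either the unit sphere $\mathbb S^n\subset\mathbb R^{n+1}$ or the hyperbolic space $\mathbb H^n=\{x\in\mathbb R^{n+1} : -x_0^2+x_1^2+\dots+x_n^2=-1,\ x_0>0\}$, and let $p$ be a real homogeneous polynomial of degree $d$ in $n+1$ variables. For $c\in\mathbb R$, the hyperbolicity domain of the level set $\{p=c\}\cap X$ is the set of points $x\in X$ with $p(x)\neq c$ such that every geodesic through $x$ (an intersection of $X$ with a two-dimensional linear subspace containing $x$) meets $\{p=c\}$ in exactly $2d$ distinct points if $X=\mathbb S^n$ (for $c=0$: in $d$ distinct pairs of antipodal points), respectively in exactly $d$ distinct points if $X=\mathbb H^n$. Assume that the algebraic hypersurface $M=\{p=0\}\cap X$ is hyperbolic, i.e. its hyperbolicity domain is non-empty. Let $\epsilon_1<\epsilon_2$ and consider the standard layer $S=\{x\in X : \epsilon_1\le p(x)\le\epsilon_2\}$, thin enough in the sense that the hyperbolicity domain of the layer, defined as the intersection of the hyperbolicity domains of $\{p=\epsilon_1\}\cap X$ and $\{p=\epsilon_2\}\cap X$, is non-empty. Fix a point $x_0$ in the hyperbolicity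 domain of the layer and charge $S$ with density $\sigma=\pm\rho$, where $\rho\in\mathbb R$ is constant and the sign is constant on each connected component $K$ of $S$: it is $+$ if $K\cap\{p=\epsilon_1\}$ lies closer to $x_0$ than $K\cap\{p=\epsilon_2\}$, and $-$ otherwise. A unit charge at $y$ acts at $x$ with a force directed along the shortest geodesic joining $x$ and $y$, of magnitude $1/\sin^{n-1}r$ in $\mathbb S^n$ and $1/\sinh^{n-1}r$ in $\mathbb H^n$, where $r$ is the geodesic distance between $x$ and $y$. Then the charged layer creates zero electrostatic field in its hyperbolicity domain: for every point $x$ of the hyperbolicity domain of the layer, the integral over $S$ (with respect to the Riemannian volume of $X$) of the force exerted at $x$ by the charge $\sigma$ converges absolutely and is equal to $0$. -/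

import Mathlib

open MeasureTheory

noncomputable section

namespace ConstCurv

/-- The two geometries: the unit sphere `Sⁿ` and hyperbolic space `Hⁿ`. -/
inductive Geometry
  | spherical
  | hyperbolic

/-- The ambient vector space `ℝⁿ⁺¹`, with coordinates `x₀, …, xₙ`. -/
abbrev Ambient (n : ℕ) : Type := EuclideanSpace ℝ (Fin (n + 1))

/-- The ambient scalar product: `x₀y₀ + x₁y₁ + ⋯ + xₙyₙ` in the spherical case and the Minkowski
product `-x₀y₀ + x₁y₁ + ⋯ + xₙyₙ` in the hyperbolic case. -/
def pairing {n : ℕ} (g : Geometry) (x y : Ambient n) : ℝ :=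
  match g with
  | .spherical => inner ℝ x y
  | .hyperbolic => -(x 0 * y 0) + ∑ i : Fin n, x i.succ * y i.succ

/-- `Sⁿ` as the unit sphere of `ℝⁿ⁺¹`, and `Hⁿ` as the upper sheet of the hyperboloid
`⟨x, x⟩ = -1` in Minkowski space. -/
def space (g : Geometry) (n : ℕ) : Set (Ambient n) :=
  match g with
  | .spherical => Metric.sphere 0 1
  | .hyperbolic => {x | pairing .hyperbolic x x = -1 ∧ 0 < x 0}

/-- The geodesic distance: `cos r = ⟨x, y⟩` on `Sⁿ` and `cosh r = -⟨x, y⟩` on `Hⁿ`. -/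
def gdist {n : ℕ} (g : Geometry) (x y : Ambient n) : ℝ :=
  match g with
  | .spherical => Real.arccos (pairing .spherical x y)
  | .hyperbolic => Real.arcosh (-pairing .hyperbolic x y)

/-- The generalized sine `sin r` or `sinh r`. -/
def sn (g : Geometry) (r : ℝ) : ℝ :=
  match g with
  | .spherical => Real.sin r
  | .hyperbolic => Real.sinh r

/-- The generalized cosine `cos r` or `cosh r`. -/
def cs (g : Geometry) (r : ℝ) : ℝ :=
  match g with
  | .spherical => Real.cos r
  | .hyperbolic => Real.cosh r

/-- The unit tangent vector at `x` of the shortest geodesic from `x` to `y`: the vector `v` with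
`y = cs r • x + sn r • v`, where `r` is the distance from `x` to `y` (meaningful for `y ≠ x`
and, on the sphere, `y ≠ -x`). -/
def direction {n : ℕ} (g : Geometry) (x y : Ambient n) : Ambient n :=
  (sn g (gdist g x y))⁻¹ • (y - cs g (gdist g x y) • x)

/-- The force exerted at `x` by a unit point mass (charge) at `y`: it is directed along the
shortest geodesic joining the points, and its magnitude is `1 / sn(r)ⁿ⁻¹`. -/
def force {n : ℕ} (g : Geometry) (x y : Ambient n) : Ambient n :=
  (sn g (gdist g x y) ^ (n - 1))⁻¹ • direction g x y

/-- The Riemannian volume of `Sⁿ` or `Hⁿ`, as a measure on the ambient space.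

In the spherical case this is Mathlib's surface measure of the unit sphere: the measure of `A` is
`n + 1` times the Lebesgue measure of the cone `{r y | y ∈ A, 0 < r < 1}`.
In the hyperbolic case it is given by the same rule: in the Minkowski polar coordinates `z = r y`,
with `r > 0` and `y ∈ Hⁿ`, Lebesgue measure is `rⁿ dr dvol(y)`, so that `vol A` is `n + 1` times
the Lebesgue measure of `{r y | y ∈ A, 0 < r < 1}`. In the coordinates `y₁, …, yₙ` this is the
measure `dy₁ ⋯ dyₙ / y₀`. -/
def vol (g : Geometry) (n : ℕ) : Measure (Ambient n) :=
  match g with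
  | .spherical => (volume : Measure (Ambient n)).toSphere.map Subtype.val
  | .hyperbolic =>
      (n + 1) • ((volume : Measure (Ambient n)).restrict
        {z | 0 < z 0 ∧ -1 < pairing .hyperbolic z z ∧ pairing .hyperbolic z z < 0}).map
          (fun z => (Real.sqrt (-pairing .hyperbolic z z))⁻¹ • z)

/-- The level set `{p = c}` in `Sⁿ` or `Hⁿ`. For `c = 0` and `p` homogeneous this is the algebraic
surface defined by `p`. -/
def levelSet {n : ℕ} (g : Geometry) (p : MvPolynomial (Fin (n + 1)) ℝ) (c : ℝ) :
    Set (Ambient n) :=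
  {y ∈ space g n | MvPolynomial.eval y p = c}

/-- The number of points in which every geodesic through a point of the hyperbolicity domain meets
a surface of degree `d`: the `2d` points of `d` antipodal pairs on `Sⁿ`, and `d` points on `Hⁿ`. -/
def fullCount (g : Geometry) (d : ℕ) : ℕ :=
  match g with
  | .spherical => 2 * d
  | .hyperbolic => d

/-- The hyperbolicity domain of the level set `{p = c}` of a homogeneous polynomial `p` of
degree `d`: the points `x` off the level set such that every geodesic through `x` (the
intersection of the space with a two-dimensional linear subspace containing `x`) meets the level
set in the full number of distinct points. For `c = 0` on the sphere the level set is centrally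
symmetric, so this says that every great circle through `x` meets it in `d` distinct pairs of
antipodal points. -/
def hyperbolicityDomain {n : ℕ} (g : Geometry) (d : ℕ) (p : MvPolynomial (Fin (n + 1)) ℝ)
    (c : ℝ) : Set (Ambient n) :=
  {x ∈ space g n | MvPolynomial.eval x p ≠ c ∧
    ∀ L : Submodule ℝ (Ambient n), Module.finrank ℝ L = 2 → x ∈ L →
      (levelSet g p c ∩ (L : Set (Ambient n))).encard = (fullCount g d : ℕ∞)}

/-- The layer between two level sets. -/
def layer {n : ℕ} (g : Geometry) (p : MvPolynomial (Fin (n + 1)) ℝ) (ε₁ ε₂ : ℝ) :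
    Set (Ambient n) :=
  {y ∈ space g n | ε₁ ≤ MvPolynomial.eval y p ∧ MvPolynomial.eval y p ≤ ε₂}

/-- The hyperbolicity domain of the layer: the points with respect to which both bounding level
sets are hyperbolic. -/
def layerDomain {n : ℕ} (g : Geometry) (d : ℕ) (p : MvPolynomial (Fin (n + 1)) ℝ)
    (ε₁ ε₂ : ℝ) : Set (Ambient n) :=
  hyperbolicityDomain g d p ε₁ ∩ hyperbolicityDomain g d p ε₂

/-- The set `A` lies closer to `x` than the set `B`: some point of `A` is closer to `x` than all
points of `B`. For nonempty compact sets this compares the distances from `x` to `A` and `B`. -/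
def Closer {n : ℕ} (g : Geometry) (x : Ambient n) (A B : Set (Ambient n)) : Prop :=
  ∃ a ∈ A, ∀ b ∈ B, gdist g x a < gdist g x b

open Classical in
/-- The sign of the charge at the point `y` of the layer, relative to the base point `x₀`: it is
`+1` if, in the connected component of the layer containing `y`, the part of `{p = ε₁}` lies closer
to `x₀` than the part of `{p = ε₂}`, and `-1` otherwise. -/
def chargeSign {n : ℕ} (g : Geometry) (p : MvPolynomial (Fin (n + 1)) ℝ) (ε₁ ε₂ : ℝ)
    (x₀ y : Ambient n) : ℝ :=
  if Closer g x₀ (connectedComponentIn (layer g p ε₁ ε₂) y ∩ levelSet g p ε₁)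
      (connectedComponentIn (layer g p ε₁ ε₂) y ∩ levelSet g p ε₂)
  then 1 else -1

/-- The force at `x` exerted by the charge element at `y`, for the layer charged with the constant
density `ρ` and with signs relative to `x₀`. -/
def fieldIntegrand {n : ℕ} (g : Geometry) (p : MvPolynomial (Fin (n + 1)) ℝ) (ε₁ ε₂ ρ : ℝ)
    (x₀ x y : Ambient n) : Ambient n :=
  (ρ * chargeSign g p ε₁ ε₂ x₀ y) • force g x y

/-- The electrostatic field at `x` of the charged layer. -/
def layerField {n : ℕ} (g : Geometry) (p : MvPolynomial (Fin (n + 1)) ℝ) (ε₁ ε₂ ρ : ℝ)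
    (x₀ x : Ambient n) : Ambient n :=
  ∫ y in layer g p ε₁ ε₂, fieldIntegrand g p ε₁ ε₂ ρ x₀ x y ∂(vol g n)

end ConstCurv

end

/-! In polar coordinates about `x` the volume element carries a factor `sn(r)^(n-1)`, which cancels
the magnitude of the force. Suppose the charge has the sign of the derivative of `p` in the
direction away from `x`, and let `f` be the restriction of `p` to a geodesic through `x` with unit
direction `u`. At negative parameters both this sign and the direction of the force are reversed, so
the whole geodesic contributes `u` times the signed length `∫ sign f'` over `{ε₁ ≤ f ≤ ε₂}`. It
suffices that each signed length vanishes (`InDomain.integral_sign_slope`).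

If `f' ≠ 0` on the strip, the strip is a union of intervals, each running monotonically between the
two levels, and the signed length is the sum of the roots of `f = ε₂` minus the sum of the roots of
`f = ε₁` (`integral_sign_deriv`). On a great circle `f` is a polynomial in `exp(iθ)` divided by a
middle power of `exp(iθ)`; on a hyperbolic geodesic the same holds with `exp(2r)`, provided that `d`
is even. Subtracting a level changes only the middle coefficient, so by Vieta the product of the
exponentials of the roots, a ratio of the extreme coefficients, is the same for all fully attained
levels (`coeff_mul_prod_neg_roots`). Hence the sums of roots agree, modulo `2π` on the sphere; there
the signed length is less than `2π` in absolute value, so it is zero. In the hyperbolic case `d` is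
even because the level `0` is hyperbolic (`even_of_hyperbolicityDomain_nonempty`).

Transversality comes from counting: both levels are attained so often that between neighbouring
roots there is just one critical point. A critical point with value in `[ε₁, ε₂]` would lie in such
a gap for each level, as a maximum over one gap and a minimum over the other, which is impossible
(`notMem_Icc_of_unique_critical_gaps`).

It remains to compare charges. Transversality makes the sign given by distances from `x₀` equal to
the sign of the derivative of `p` away from `x₀` (`InDomain.chargeSign_eq`). Replacing `x₀` by `x`
changes these signs at most by one global factor (`InDomain.exists_sign`), by a connectedness
argument on the sphere of directions. -/

namespace ConstCurv

/-! ### Functions of one variable: critical points, signed length of a strip, Vieta. -/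

section LineAnalysis

open Set

/-- If `e₁ < f c < e₂`, then `c` is the maximum over its gap for `e₁` and the minimum over its gap
for `e₂`. The left end of one gap lies in the other, where its value contradicts extremality. -/
theorem notMem_Icc_of_unique_critical_gaps {f : ℝ → ℝ} (hf : Differentiable ℝ f) {e₁ e₂ c : ℝ}
    (gap : ∀ e, e = e₁ ∨ e = e₂ → ∃ x y, x < c ∧ c < y ∧ f x = e ∧ f y = e ∧
      ∀ z ∈ Ioo x y, deriv f z = 0 → z = c) : f c ∉ Icc e₁ e₂ := by
  have hne : ∀ e, e = e₁ ∨ e = e₂ → f c ≠ e := by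
    rintro e he hc
    obtain ⟨x, y, hx, hy, fx, fy, hu⟩ := gap e he
    obtain ⟨z, hz, hz'⟩ := exists_deriv_eq_zero hx hf.continuous.continuousOn (fx.trans hc.symm)
    exact hz.2.ne (hu z ⟨hz.1, hz.2.trans hy⟩ hz')
  rintro ⟨h1, h2⟩
  replace h1 := lt_of_le_of_ne h1 (hne e₁ (Or.inl rfl)).symm
  replace h2 := lt_of_le_of_ne h2 (hne e₂ (Or.inr rfl))
  obtain ⟨a, a', ha, ha', fa, fa', hua⟩ := gap e₁ (Or.inl rfl)
  obtain ⟨b, b', hb, hb', fb, fb', hub⟩ := gap e₂ (Or.inr rfl)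
  -- A maximum over the gap exceeds the boundary value `e₁`, so it is interior and critical, and `c`
  -- is the only candidate.
  have hmax : ∀ t ∈ Icc a a', f t ≤ f c := by
    obtain ⟨m, hm, hmax⟩ := isCompact_Icc.exists_isMaxOn (nonempty_Icc.2 (ha.trans ha').le)
      (hf.continuous.continuousOn (s := Icc a a'))
    have hcm : f c ≤ f m := hmax ⟨ha.le, ha'.le⟩
    have hm1 : m ≠ a := by rintro rfl; linarith
    have hm2 : m ≠ a' := by rintro rfl; linarith
    have hmI : m ∈ Ioo a a' := ⟨lt_of_le_of_ne hm.1 hm1.symm, lt_of_le_of_ne hm.2 hm2⟩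
    have : deriv f m = 0 :=
      (hmax.isLocalMax (Icc_mem_nhds hmI.1 hmI.2)).deriv_eq_zero
    rw [hua m hmI this] at hmax
    exact fun t ht => hmax ht
  have hmin : ∀ t ∈ Icc b b', f c ≤ f t := by
    obtain ⟨m, hm, hmin⟩ := isCompact_Icc.exists_isMinOn (nonempty_Icc.2 (hb.trans hb').le)
      (hf.continuous.continuousOn (s := Icc b b'))
    have hcm : f m ≤ f c := hmin ⟨hb.le, hb'.le⟩
    have hm1 : m ≠ b := by rintro rfl; linarith
    have hm2 : m ≠ b' := by rintro rfl; linarith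
    have hmI : m ∈ Ioo b b' := ⟨lt_of_le_of_ne hm.1 hm1.symm, lt_of_le_of_ne hm.2 hm2⟩
    have : deriv f m = 0 :=
      (hmin.isLocalMin (Icc_mem_nhds hmI.1 hmI.2)).deriv_eq_zero
    rw [hub m hmI this] at hmin
    exact fun t ht => hmin ht
  rcases le_or_gt b a with h | h
  · have := hmin a ⟨h, by linarith⟩
    linarith
  · have := hmax b ⟨h.le, by linarith⟩
    linarith

/-- Rolle and a count. If every gap between neighbouring points of `s` contained a critical point
other than `c`, then `t` without `c` would have at least `s.card - 1` elements, too many for `t.card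
< s.card`. -/
theorem exists_unique_critical_gap {f : ℝ → ℝ} (hf : Differentiable ℝ f) {e c : ℝ}
    {s t : Finset ℝ} (hs : ∀ x ∈ s, f x = e)
    (ht : ∀ x ∈ s, ∀ y ∈ s, ∀ z ∈ Ioo x y, deriv f z = 0 → z ∈ t)
    (hcard : t.card < s.card) (hc : c ∈ t) :
    ∃ x y, x < c ∧ c < y ∧ f x = e ∧ f y = e ∧ ∀ z ∈ Ioo x y, deriv f z = 0 → z = c := by
  by_contra hcon
  have key : s.card ≤ ((t.erase c) \ s).card + 1 := by
    refine Finset.card_le_sdiff_of_interleaved fun x hx y hy hxy _ => ?_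
    by_contra hno
    refine hcon ⟨x, y, ?_⟩
    have huniq : ∀ z ∈ Ioo x y, deriv f z = 0 → z = c := by
      intro z hz hz0
      by_contra hzc
      exact hno ⟨z, Finset.mem_erase.2 ⟨hzc, ht x hx y hy z hz hz0⟩, hz.1, hz.2⟩
    obtain ⟨z, hz, hz0⟩ := exists_deriv_eq_zero hxy hf.continuous.continuousOn
      ((hs x hx).trans (hs y hy).symm)
    obtain rfl := huniq z hz hz0
    exact ⟨hz.1, hz.2, hs x hx, hs y hy, huniq⟩
  have h1 : ((t.erase c) \ s).card ≤ (t.erase c).card := Finset.card_le_card Finset.sdiff_subset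
  have h2 := Finset.card_erase_add_one hc
  omega

/-- Moving right inside the strip `f` cannot turn, so it keeps increasing. Since `f R` is outside of
the strip, `f` has to leave through the level `e₂` before `R`. -/
theorem exists_right_end {f : ℝ → ℝ} (hf : Differentiable ℝ f) (hf' : Continuous (deriv f))
    {e₁ e₂ θ R : ℝ} (hθ : θ ≤ R) (hR : f R ∉ Icc e₁ e₂)
    (hK : ∀ τ ∈ Icc θ R, f τ ∈ Icc e₁ e₂ → deriv f τ ≠ 0) (hfθ : f θ ∈ Icc e₁ e₂)
    (hd : 0 < deriv f θ) :
    ∃ β ∈ Ico θ R, f β = e₂ ∧ ∀ τ ∈ Icc θ β, f τ ∈ Icc e₁ e₂ ∧ 0 < deriv f τ := by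
  -- The stopping set; its least element is the exit point.
  set Z : Set ℝ := Icc θ R ∩ {τ | e₂ ≤ f τ ∨ deriv f τ ≤ 0} with hZ
  have hZc : IsCompact Z := isCompact_Icc.inter_right
    ((isClosed_le continuous_const hf.continuous).union (isClosed_le hf' continuous_const))
  have mono : ∀ β ≤ R, (∀ τ ∈ Ico θ β, τ ∉ Z) → ∀ τ ∈ Icc θ β, f θ ≤ f τ := by
    intro β hβ h τ hτ
    have : MonotoneOn f (Icc θ β) := by
      refine monotoneOn_of_deriv_nonneg (convex_Icc _ _) hf.continuous.continuousOn
        hf.differentiableOn fun z hz => ?_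
      rw [interior_Icc] at hz
      by_contra hneg
      exact h z ⟨hz.1.le, hz.2⟩ ⟨⟨hz.1.le, hz.2.le.trans hβ⟩, Or.inr (not_le.1 hneg).le⟩
    exact this ⟨le_rfl, hτ.1.trans hτ.2⟩ hτ hτ.1
  have hZne : Z.Nonempty := by
    by_contra hne
    rw [not_nonempty_iff_eq_empty] at hne
    have h1 := mono R le_rfl (fun τ _ => by simp [hne]) R ⟨hθ, le_rfl⟩
    refine hR ⟨hfθ.1.trans h1, ?_⟩
    by_contra hlt
    have : R ∈ Z := ⟨⟨hθ, le_rfl⟩, Or.inl (not_le.1 hlt).le⟩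
    simp [hne] at this
  obtain ⟨β, hβZ, hβmin⟩ := hZc.exists_isLeast hZne
  have hnot : ∀ τ ∈ Ico θ β, τ ∉ Z := fun τ hτ hτZ => absurd (hβmin hτZ) (not_le.2 hτ.2)
  have hθβ : θ ≤ β := hβZ.1.1
  have hβR : β ≤ R := hβZ.1.2
  have hbefore : ∀ τ ∈ Ico θ β, f τ < e₂ ∧ 0 < deriv f τ := by
    intro τ hτ
    have h := hnot τ hτ
    by_contra hcon
    refine h ⟨⟨hτ.1, hτ.2.le.trans hβR⟩, ?_⟩
    by_contra h2
    simp only [mem_ofPred_eq, not_or, not_le] at h2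
    exact hcon h2
  have hle : f β ≤ e₂ ∧ 0 ≤ deriv f β := by
    rcases hθβ.eq_or_lt with h | h
    · rw [← h]; exact ⟨hfθ.2, hd.le⟩
    · have hcl : β ∈ closure (Ico θ β) := by rw [closure_Ico h.ne]; exact ⟨h.le, le_rfl⟩
      have hcs : IsClosed {τ | f τ ≤ e₂ ∧ 0 ≤ deriv f τ} :=
        (isClosed_le hf.continuous continuous_const).inter (isClosed_le continuous_const hf')
      have hsub : Ico θ β ⊆ {τ | f τ ≤ e₂ ∧ 0 ≤ deriv f τ} := fun τ hτ =>
        And.intro (hbefore τ hτ).1.le (hbefore τ hτ).2.le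
      exact closure_minimal hsub hcs hcl
  have hmon := mono β hβR hnot
  have hβK : f β ∈ Icc e₁ e₂ := ⟨hfθ.1.trans (hmon β ⟨hθβ, le_rfl⟩), hle.1⟩
  have hdβ : 0 < deriv f β := lt_of_le_of_ne hle.2 (hK β hβZ.1 hβK).symm
  have hβe : f β = e₂ := by
    rcases hβZ.2 with h | h
    · exact le_antisymm hle.1 h
    · exact absurd h (not_le.2 hdβ)
  refine ⟨β, ⟨hθβ, lt_of_le_of_ne hβR ?_⟩, hβe, fun τ hτ => ?_⟩
  · rintro rfl; exact hR hβK
  · rcases hτ.2.eq_or_lt with h | h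
    · rw [h]; exact ⟨hβK, hdβ⟩
    · have := hbefore τ ⟨hτ.1, h⟩
      exact ⟨⟨hfθ.1.trans (hmon τ hτ), this.1.le⟩, this.2⟩

theorem exists_left_end {f : ℝ → ℝ} (hf : Differentiable ℝ f) (hf' : Continuous (deriv f))
    {e₁ e₂ θ L : ℝ} (hθ : L ≤ θ) (hL : f L ∉ Icc e₁ e₂)
    (hK : ∀ τ ∈ Icc L θ, f τ ∈ Icc e₁ e₂ → deriv f τ ≠ 0) (hfθ : f θ ∈ Icc e₁ e₂)
    (hd : 0 < deriv f θ) :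
    ∃ α ∈ Ioc L θ, f α = e₁ ∧ ∀ τ ∈ Icc α θ, f τ ∈ Icc e₁ e₂ ∧ 0 < deriv f τ := by
  have hder : ∀ t, deriv (fun t => -f (-t)) t = deriv f (-t) := fun t => by
    rw [deriv.fun_neg, deriv_comp_neg, neg_neg]
  have hmem : ∀ t, (-f t ∈ Icc (-e₂) (-e₁)) ↔ f t ∈ Icc e₁ e₂ := fun t => by
    simp only [mem_Icc, neg_le_neg_iff]; tauto
  -- The substitution `t ↦ -f (-t)` reverses the line and exchanges the levels, but keeps the sign
  -- of the derivative.
  obtain ⟨β, hβ, hβe, hall⟩ := exists_right_end (f := fun t => -f (-t)) (e₁ := -e₂) (e₂ := -e₁)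
    (θ := -θ) (R := -L) (hf.comp differentiable_neg).neg
    (by rw [funext hder]; exact hf'.comp continuous_neg) (neg_le_neg hθ)
    (by rw [neg_neg, hmem]; exact hL)
    (fun τ hτ h => by
      rw [hder]; exact hK _ ⟨by linarith [hτ.2], by linarith [hτ.1]⟩ ((hmem _).1 h))
    (by rw [neg_neg, hmem]; exact hfθ) (by rw [hder, neg_neg]; exact hd)
  refine ⟨-β, ⟨by linarith [hβ.2], by linarith [hβ.1]⟩, neg_injective hβe, fun τ hτ => ?_⟩
  have := hall (-τ) ⟨by linarith [hτ.2], by linarith [hτ.1]⟩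
  rw [hder, neg_neg, hmem] at this
  exact this

/-- The increasing part of the strip is a disjoint union of intervals, each from a point of `A` to a
point of `B`. The matching `φ` of left with right ends is a bijection, so the lengths add up to the
difference of the two sums. -/
theorem volume_increasing_strip {f : ℝ → ℝ} (hf : Differentiable ℝ f) (hf' : Continuous (deriv f))
    {e₁ e₂ L R : ℝ} (he : e₁ < e₂) (hL : f L ∉ Icc e₁ e₂) (hR : f R ∉ Icc e₁ e₂)
    (hK : ∀ τ ∈ Icc L R, f τ ∈ Icc e₁ e₂ → deriv f τ ≠ 0) {A B : Finset ℝ}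
    (hA : ∀ t, t ∈ A ↔ t ∈ Icc L R ∧ f t = e₁ ∧ 0 < deriv f t)
    (hB : ∀ t, t ∈ B ↔ t ∈ Icc L R ∧ f t = e₂ ∧ 0 < deriv f t) :
    volume.real {t | t ∈ Icc L R ∧ f t ∈ Icc e₁ e₂ ∧ 0 < deriv f t} =
      ∑ t ∈ B, t - ∑ t ∈ A, t := by
  have hright : ∀ t ∈ Icc L R, f t ∈ Icc e₁ e₂ → 0 < deriv f t →
      ∃ β ∈ B, t ≤ β ∧ ∀ τ ∈ Icc t β, f τ ∈ Icc e₁ e₂ ∧ 0 < deriv f τ := by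
    intro t ht hft hd
    obtain ⟨β, hβ, hβe, hall⟩ := exists_right_end hf hf' ht.2 hR
      (fun τ hτ => hK τ ⟨ht.1.trans hτ.1, hτ.2⟩) hft hd
    exact ⟨β, (hB β).2 ⟨⟨ht.1.trans hβ.1, hβ.2.le⟩, hβe, (hall β ⟨hβ.1, le_rfl⟩).2⟩, hβ.1, hall⟩
  have hleft : ∀ t ∈ Icc L R, f t ∈ Icc e₁ e₂ → 0 < deriv f t →
      ∃ α ∈ A, α ≤ t ∧ ∀ τ ∈ Icc α t, f τ ∈ Icc e₁ e₂ ∧ 0 < deriv f τ := by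
    intro t ht hft hd
    obtain ⟨α, hα, hαe, hall⟩ := exists_left_end hf hf' ht.1 hL
      (fun τ hτ => hK τ ⟨hτ.1, hτ.2.trans ht.2⟩) hft hd
    exact ⟨α, (hA α).2 ⟨⟨hα.1.le, hα.2.trans ht.2⟩, hαe, (hall α ⟨le_rfl, hα.2⟩).2⟩, hα.2, hall⟩
  have smono : ∀ {x y z : ℝ}, (∀ τ ∈ Icc x y, f τ ∈ Icc e₁ e₂ ∧ 0 < deriv f τ) → x < z → z ≤ y →
      f x < f z := by
    intro x y z h hxz hzy
    refine strictMonoOn_of_deriv_pos (convex_Icc x y) hf.continuous.continuousOn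
      (fun τ hτ => (h τ (interior_subset hτ)).2) ⟨le_rfl, hxz.le.trans hzy⟩ ⟨hxz.le, hzy⟩ hxz
  have smono' : ∀ {x y z : ℝ}, (∀ τ ∈ Icc x y, f τ ∈ Icc e₁ e₂ ∧ 0 < deriv f τ) → x ≤ z → z < y →
      f z < f y := by
    intro x y z h hxz hzy
    refine strictMonoOn_of_deriv_pos (convex_Icc x y) hf.continuous.continuousOn
      (fun τ hτ => (h τ (interior_subset hτ)).2) ⟨hxz, hzy.le⟩ ⟨hxz.trans hzy.le, le_rfl⟩ hzy
  have hφ : ∀ α ∈ A, ∃ β ∈ B, α ≤ β ∧ ∀ τ ∈ Icc α β, f τ ∈ Icc e₁ e₂ ∧ 0 < deriv f τ := by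
    intro α hα
    obtain ⟨h1, h2, h3⟩ := (hA α).1 hα
    exact hright α h1 (by rw [h2]; exact ⟨le_rfl, he.le⟩) h3
  choose! φ hφB hφle hφall using hφ
  have hsum : ∑ t ∈ A, φ t = ∑ t ∈ B, t := by
    refine Finset.sum_bij (fun a _ => φ a) hφB ?_ ?_ (fun _ _ => rfl)
    · have aux : ∀ a ∈ A, ∀ a' ∈ A, φ a = φ a' → ¬ a < a' := by
        intro a ha a' ha' h hlt
        have := smono (hφall a ha) hlt (h ▸ hφle a' ha')
        rw [((hA a).1 ha).2.1, ((hA a').1 ha').2.1] at this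
        exact lt_irrefl _ this
      intro a ha a' ha' h
      exact le_antisymm (not_lt.1 (aux a' ha' a ha h.symm)) (not_lt.1 (aux a ha a' ha' h))
    · intro b hb
      obtain ⟨h1, h2, h3⟩ := (hB b).1 hb
      obtain ⟨a, ha, hab, hall⟩ := hleft b h1 (by rw [h2]; exact ⟨he.le, le_rfl⟩) h3
      have h4 : f (φ a) = e₂ := ((hB _).1 (hφB a ha)).2.1
      refine ⟨a, ha, ?_⟩
      rcases lt_trichotomy (φ a) b with h | h | h
      · have := smono' hall (hφle a ha) h
        linarith
      · exact h
      · have := smono' (hφall a ha) hab h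
        linarith
  have hset : {t | t ∈ Icc L R ∧ f t ∈ Icc e₁ e₂ ∧ 0 < deriv f t} = ⋃ a ∈ A, Icc a (φ a) := by
    ext t
    simp only [mem_ofPred_eq, mem_iUnion, exists_prop]
    constructor
    · rintro ⟨h1, h2, h3⟩
      obtain ⟨a, ha, hat, hall⟩ := hleft t h1 h2 h3
      refine ⟨a, ha, hat, ?_⟩
      by_contra hlt
      have := smono' hall (hφle a ha) (not_le.1 hlt)
      rw [((hB _).1 (hφB a ha)).2.1] at this
      exact absurd h2.2 (not_le.2 this)
    · rintro ⟨a, ha, hat⟩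
      have h1 := ((hA a).1 ha).1
      have h2 := ((hB _).1 (hφB a ha)).1
      exact ⟨⟨h1.1.trans hat.1, hat.2.trans h2.2⟩, hφall a ha t hat⟩
  rw [hset, measureReal_biUnion_finset ?_ ?_ ?_]
  · rw [← hsum, ← Finset.sum_sub_distrib]
    refine Finset.sum_congr rfl fun a ha => ?_
    rw [Measure.real, Real.volume_Icc, ENNReal.toReal_ofReal (sub_nonneg.2 (hφle a ha))]
  · have aux : ∀ a ∈ A, ∀ a' ∈ A, a < a' → ∀ t, t ∈ Icc a (φ a) → t ∈ Icc a' (φ a') → False := by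
      intro a ha a' ha' hlt t ht ht'
      have := smono (hφall a ha) hlt (ht'.1.trans ht.2)
      rw [((hA a).1 ha).2.1, ((hA a').1 ha').2.1] at this
      exact lt_irrefl _ this
    intro a ha a' ha' hne
    refine disjoint_left.2 fun t ht ht' => ?_
    rcases lt_or_gt_of_ne hne with h | h
    · exact aux a ha a' ha' h t ht ht'
    · exact aux a' ha' a ha h t ht' ht
  · exact fun a _ => measurableSet_Icc
  · exact fun a _ => (by rw [Real.volume_Icc]; exact ENNReal.ofReal_ne_top)

/-- Decreasing intervals run from level `e₂` to level `e₁` and count negatively, so they give the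
same expression, right end and left end having changed roles twice. -/
theorem integral_sign_deriv {f : ℝ → ℝ} (hf : Differentiable ℝ f) (hf' : Continuous (deriv f))
    {e₁ e₂ L R : ℝ} (he : e₁ < e₂) (hL : f L ∉ Icc e₁ e₂) (hR : f R ∉ Icc e₁ e₂)
    (hK : ∀ τ ∈ Icc L R, f τ ∈ Icc e₁ e₂ → deriv f τ ≠ 0) {A B : Finset ℝ}
    (hA : ∀ t, t ∈ A ↔ t ∈ Icc L R ∧ f t = e₁) (hB : ∀ t, t ∈ B ↔ t ∈ Icc L R ∧ f t = e₂) :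
    ∫ t in {t | t ∈ Icc L R ∧ f t ∈ Icc e₁ e₂}, Real.sign (deriv f t) =
      ∑ t ∈ B, t - ∑ t ∈ A, t := by
  have h1 := volume_increasing_strip hf hf' he hL hR hK
    (A := A.filter fun t => 0 < deriv f t) (B := B.filter fun t => 0 < deriv f t)
    (fun t => by rw [Finset.mem_filter, hA, and_assoc]) (fun t => by rw [Finset.mem_filter, hB, and_assoc])
  have hmem : ∀ t, (-f t ∈ Icc (-e₂) (-e₁)) ↔ f t ∈ Icc e₁ e₂ := fun t => by
    simp only [mem_Icc, neg_le_neg_iff]; tauto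
  have hder : ∀ t, deriv (fun t => -f t) t = -deriv f t := fun t => deriv.fun_neg
  have h2 := volume_increasing_strip (f := fun t => -f t) hf.neg
    (by rw [funext hder]; exact hf'.neg) (neg_lt_neg he)
    (L := L) (R := R) (by rwa [hmem]) (by rwa [hmem])
    (fun τ hτ h => by rw [hder]; exact neg_ne_zero.2 (hK τ hτ ((hmem _).1 h)))
    (A := B.filter fun t => ¬ 0 < deriv f t) (B := A.filter fun t => ¬ 0 < deriv f t)
    (fun t => by
      rw [Finset.mem_filter, hB, and_assoc, hder, neg_inj, neg_pos, not_lt]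
      refine and_congr_right fun ht => and_congr_right fun hft => ?_
      exact ⟨fun h => lt_of_le_of_ne h (hK t ht (by rw [hft]; exact ⟨he.le, le_rfl⟩)), le_of_lt⟩)
    (fun t => by
      rw [Finset.mem_filter, hA, and_assoc, hder, neg_inj, neg_pos, not_lt]
      refine and_congr_right fun ht => and_congr_right fun hft => ?_
      exact ⟨fun h => lt_of_le_of_ne h (hK t ht (by rw [hft]; exact ⟨le_rfl, he.le⟩)), le_of_lt⟩)
  simp only [hmem, hder, neg_pos] at h2
  have hKm : MeasurableSet {t | t ∈ Icc L R ∧ f t ∈ Icc e₁ e₂} :=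
    measurableSet_Icc.inter (hf.continuous.measurable measurableSet_Icc)
  have hP : MeasurableSet {t | 0 < deriv f t} := hf'.measurable measurableSet_Ioi
  have hN : MeasurableSet {t | deriv f t < 0} := hf'.measurable measurableSet_Iio
  have hfin : volume {t | t ∈ Icc L R ∧ f t ∈ Icc e₁ e₂} ≠ ⊤ :=
    ((measure_mono fun t ht => ht.1).trans_lt (isCompact_Icc (a := L) (b := R)).measure_lt_top).ne
  have hsplit : ∀ t, Real.sign (deriv f t) =
      indicator {t | 0 < deriv f t} (fun _ => (1 : ℝ)) t -
        indicator {t | deriv f t < 0} (fun _ => (1 : ℝ)) t := by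
    intro t
    rcases lt_trichotomy (deriv f t) 0 with h | h | h
    · simp [Real.sign_of_neg h, h, not_lt.2 h.le]
    · simp [h]
    · simp [Real.sign_of_pos h, h, not_lt.2 h.le]
  simp_rw [hsplit]
  have hint : ∀ s : Set ℝ, MeasurableSet s → Integrable (s.indicator fun _ => (1 : ℝ))
      (volume.restrict {t | t ∈ Icc L R ∧ f t ∈ Icc e₁ e₂}) := fun s hs =>
    (integrableOn_const hfin).indicator hs
  rw [integral_sub (hint _ hP) (hint _ hN), setIntegral_indicator hP, setIntegral_indicator hN,
    setIntegral_const, setIntegral_const, smul_eq_mul, smul_eq_mul, mul_one, mul_one]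
  have e1 : {t | t ∈ Icc L R ∧ f t ∈ Icc e₁ e₂} ∩ {t | 0 < deriv f t} =
      {t | t ∈ Icc L R ∧ f t ∈ Icc e₁ e₂ ∧ 0 < deriv f t} := by
    ext t; simp only [mem_inter_iff, mem_ofPred_eq, and_assoc]
  have e2 : {t | t ∈ Icc L R ∧ f t ∈ Icc e₁ e₂} ∩ {t | deriv f t < 0} =
      {t | t ∈ Icc L R ∧ f t ∈ Icc e₁ e₂ ∧ deriv f t < 0} := by
    ext t; simp only [mem_inter_iff, mem_ofPred_eq, and_assoc]
  rw [e1, e2, h1, h2]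
  have s1 := Finset.sum_filter_add_sum_filter_not A (fun t => 0 < deriv f t) (fun t => t)
  have s2 := Finset.sum_filter_add_sum_filter_not B (fun t => 0 < deriv f t) (fun t => t)
  linarith

/-- Vieta for `Q - e X ^ m`. Since `0 < m < N`, the level `e` affects neither the leading nor the
constant coefficient, so the product of the roots does not depend on it. -/
theorem coeff_mul_prod_neg_roots {K : Type*} [Field K] {Q : Polynomial K} {N m : ℕ} {e : K}
    (hQ : Q.natDegree ≤ N) (hm : 0 < m) (hmN : m < N) {Z : Finset K} (hZ : Z.card = N)
    (hroot : ∀ z ∈ Z, Q.eval z = e * z ^ m) (hne : ∃ z, Q.eval z ≠ e * z ^ m) :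
    Q.coeff N ≠ 0 ∧ Q.coeff N * ∏ z ∈ Z, (-z) = Q.coeff 0 := by
  classical
  set P : Polynomial K := Q - Polynomial.C e * Polynomial.X ^ m with hP
  have hP0 : P ≠ 0 := by
    obtain ⟨z, hz⟩ := hne
    intro h
    have := congrArg (Polynomial.eval z) h
    simp only [hP, Polynomial.eval_sub, Polynomial.eval_mul, Polynomial.eval_C,
      Polynomial.eval_pow, Polynomial.eval_X, Polynomial.eval_zero, sub_eq_zero] at this
    exact hz this
  have hPdeg : P.natDegree ≤ N := (Polynomial.natDegree_sub_le_of_le hQ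
    ((Polynomial.natDegree_C_mul_X_pow_le e m).trans hmN.le)).trans (max_self N).le
  have hsub : Z.val ≤ P.roots := by
    rw [Multiset.le_iff_subset Z.nodup]
    intro z hz
    rw [Polynomial.mem_roots hP0, Polynomial.IsRoot]
    simp [hP, hroot z hz]
  have hcard : P.roots.card = N := le_antisymm ((Polynomial.card_roots' P).trans hPdeg)
    (hZ ▸ Multiset.card_le_card hsub)
  have hroots : P.roots = Z.val :=
    (Multiset.eq_of_le_of_card_le hsub (by rw [hcard]; exact hZ.ge)).symm
  have hdeg : P.natDegree = N := le_antisymm hPdeg (hcard ▸ Polynomial.card_roots' P)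
  have hlead : P.leadingCoeff = Q.coeff N := by
    rw [Polynomial.leadingCoeff, hdeg, hP, Polynomial.coeff_sub, Polynomial.coeff_C_mul,
      Polynomial.coeff_X_pow, if_neg hmN.ne', mul_zero, sub_zero]
  have hfac := Polynomial.C_leadingCoeff_mul_prod_multiset_X_sub_C (p := P)
    (by rw [hcard, hdeg])
  refine ⟨hlead ▸ Polynomial.leadingCoeff_ne_zero.2 hP0, ?_⟩
  have h0 := congrArg (Polynomial.eval 0) hfac
  rw [hroots, hlead, Polynomial.eval_mul, Polynomial.eval_C] at h0
  change _ * Polynomial.eval 0 (∏ z ∈ Z, (Polynomial.X - Polynomial.C z)) = _ at h0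
  rw [Polynomial.eval_prod] at h0
  simp only [Polynomial.eval_sub, Polynomial.eval_X, Polynomial.eval_C, zero_sub] at h0
  rw [h0, hP, Polynomial.coeff_zero_eq_eval_zero]
  simp [hm.ne']

end LineAnalysis

/-! ### Trigonometric and exponential polynomials with the maximal number of roots. -/

section ExponentialPolynomials

open Set Polynomial

/-- The polynomial `X Q' - m Q`, which represents the derivative of `f` when `Q` represents `f` via
`Q(E) = E ^ m f`, `E` being an exponential. -/
noncomputable def derivSymbol {K : Type*} [Field K] (Q : K[X]) (m : ℕ) : K[X] :=
  X * derivative Q - C (m : K) * Q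

theorem natDegree_derivSymbol_le {K : Type*} [Field K] {Q : K[X]} {m N : ℕ}
    (hQ : Q.natDegree ≤ N) : (derivSymbol Q m).natDegree ≤ N := by
  refine (natDegree_sub_le_of_le (m := N) (n := N) ?_ ((natDegree_C_mul_le _ _).trans hQ)).trans
    (max_self N).le
  rcases Nat.eq_zero_or_pos Q.natDegree with h | h
  · rw [eq_C_of_natDegree_eq_zero h, derivative_C, mul_zero, natDegree_zero]
    exact Nat.zero_le N
  · refine (natDegree_mul_le).trans ?_
    have := natDegree_derivative_le Q
    have := natDegree_X_le (R := K)
    omega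

theorem coeff_derivSymbol {K : Type*} [Field K] (Q : K[X]) (m k : ℕ) :
    (derivSymbol Q m).coeff k = ((k : K) - m) * Q.coeff k := by
  rw [derivSymbol, coeff_sub, coeff_C_mul]
  cases k with
  | zero => simp
  | succ k => rw [coeff_X_mul, coeff_derivative]; push_cast; ring

theorem exp_mul_I_eq_iff {x y : ℝ} : Complex.exp (x * Complex.I) = Complex.exp (y * Complex.I) ↔
    ∃ k : ℤ, x = y + k * (2 * Real.pi) := by
  rw [Complex.exp_eq_exp_iff_exists_int]
  refine exists_congr fun k => ?_
  constructor
  · intro h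
    have := congrArg Complex.im h
    simpa using this
  · intro h
    rw [h]; push_cast; ring

theorem eq_of_sub_lt_two_pi {x y : ℝ}
    (h : Complex.exp (x * Complex.I) = Complex.exp (y * Complex.I)) (h1 : x - y < 2 * Real.pi)
    (h2 : y - x < 2 * Real.pi) : x = y := by
  obtain ⟨k, hk⟩ := exp_mul_I_eq_iff.1 h
  have hpi := Real.pi_pos
  have h3 : (k : ℝ) < 1 := by nlinarith
  have h4 : (-1 : ℝ) < k := by nlinarith
  have h5 : k = 0 := by
    have : k < 1 := by exact_mod_cast h3
    have : -1 < k := by exact_mod_cast h4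
    omega
  rw [hk, h5]; simp

/-- `f` is the trigonometric polynomial of degree `d` represented by `Q`. -/
def TrigRep (f : ℝ → ℝ) (d : ℕ) (Q : ℂ[X]) : Prop :=
  Q.natDegree ≤ 2 * d ∧
    ∀ θ : ℝ, Q.eval (Complex.exp (θ * Complex.I)) = (f θ : ℂ) * Complex.exp (θ * Complex.I) ^ d

theorem TrigRep.periodic {f : ℝ → ℝ} {d : ℕ} {Q : ℂ[X]} (h : TrigRep f d Q) {x y : ℝ}
    (hxy : Complex.exp (x * Complex.I) = Complex.exp (y * Complex.I)) : f x = f y := by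
  have h1 := h.2 x
  rw [hxy, h.2 y] at h1
  have := mul_right_cancel₀ (pow_ne_zero d (Complex.exp_ne_zero _)) h1
  exact_mod_cast this.symm

theorem TrigRep.eval_derivSymbol {f : ℝ → ℝ} {d : ℕ} {Q : ℂ[X]} (h : TrigRep f d Q)
    (hf : Differentiable ℝ f) (θ : ℝ) :
    Complex.I * (derivSymbol Q d).eval (Complex.exp (θ * Complex.I)) =
      ((deriv f θ : ℝ) : ℂ) * Complex.exp (θ * Complex.I) ^ d := by
  have hE : HasDerivAt (fun t : ℝ => Complex.exp (t * Complex.I))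
      (Complex.exp (θ * Complex.I) * Complex.I) θ := by
    have h0 : HasDerivAt (fun t : ℝ => (t : ℂ) * Complex.I) (1 * Complex.I) θ :=
      (Complex.ofRealCLM.hasDerivAt (x := θ)).mul_const _
    simpa using h0.cexp
  have hL := (Q.hasDerivAt (Complex.exp (θ * Complex.I))).comp θ hE
  have hfθ : HasDerivAt (fun t : ℝ => (f t : ℂ)) ((deriv f θ : ℝ) : ℂ) θ :=
    (hf θ).hasDerivAt.ofReal_comp
  have hR := hfθ.mul (hE.pow d)
  have heq : (fun t : ℝ => Q.eval (Complex.exp (t * Complex.I))) =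
      (fun t : ℝ => (f t : ℂ)) * (fun t : ℝ => Complex.exp (t * Complex.I)) ^ d := by
    funext t; exact h.2 t
  have hu := hL.unique (heq ▸ hR)
  rw [derivSymbol, eval_sub, eval_mul, eval_mul, eval_X, eval_C, h.2 θ]
  rcases d with _ | d
  · simp only [Pi.pow_apply, Nat.cast_zero, zero_mul, mul_zero, add_zero, pow_zero, mul_one] at hu ⊢
    linear_combination hu
  · simp only [Pi.pow_apply, Nat.add_sub_cancel] at hu
    linear_combination hu

/-- The zeros of `f - e` in a period, with the right number of them. -/
def FullCircle (f : ℝ → ℝ) (d : ℕ) (e : ℝ) (A : Finset ℝ) : Prop :=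
  A.card = 2 * d ∧ ∀ t, t ∈ A ↔ t ∈ Ioc (-Real.pi) Real.pi ∧ f t = e

/-- The number `2 * d` of roots is even, so the signs in Vieta's product disappear. The level `e`
does not occur in the conclusion: the sum of the roots modulo `2π` is common to all full levels. -/
theorem TrigRep.coeff_of_roots {f : ℝ → ℝ} {d : ℕ} {Q : ℂ[X]} (h : TrigRep f d Q) (hd : 0 < d)
    {e : ℝ} {A : Finset ℝ} (hA : FullCircle f d e A) (hne : f 0 ≠ e) :
    Q.coeff (2 * d) ≠ 0 ∧
      Q.coeff (2 * d) * Complex.exp ((∑ t ∈ A, t : ℝ) * Complex.I) = Q.coeff 0 := by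
  have hmem : ∀ t ∈ A, -Real.pi < t ∧ t ≤ Real.pi := fun t ht => ((hA.2 t).1 ht).1
  have hinj : InjOn (fun t : ℝ => Complex.exp (t * Complex.I)) (A : Set ℝ) := by
    intro x hx y hy hxy
    have h1 := hmem x hx
    have h2 := hmem y hy
    exact eq_of_sub_lt_two_pi hxy (by linarith) (by linarith)
  classical
  obtain ⟨h1, h2⟩ := coeff_mul_prod_neg_roots (Q := Q) (N := 2 * d) (m := d) (e := (e : ℂ)) h.1 hd
    (by omega) (Z := A.image fun t : ℝ => Complex.exp (t * Complex.I))
    (by rw [Finset.card_image_of_injOn hinj, hA.1])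
    (by
      intro z hz
      obtain ⟨t, ht, rfl⟩ := Finset.mem_image.1 hz
      rw [h.2, ((hA.2 t).1 ht).2])
    ⟨Complex.exp ((0 : ℝ) * Complex.I), by
      rw [h.2]
      intro hcon
      have := mul_right_cancel₀ (pow_ne_zero d (Complex.exp_ne_zero _)) hcon
      exact hne (by exact_mod_cast this)⟩
  refine ⟨h1, ?_⟩
  rw [← h2, Finset.prod_image hinj, Finset.prod_neg, hA.1, pow_mul]
  congr 1
  push_cast
  rw [Finset.sum_mul, Complex.exp_sum]
  simp

theorem TrigRep.exists_critical_finset {f : ℝ → ℝ} {d : ℕ} {Q : ℂ[X]} (h : TrigRep f d Q)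
    (hd : 0 < d) (hf : Differentiable ℝ f) (hQ : Q.coeff (2 * d) ≠ 0) (a : ℝ) :
    ∃ t : Finset ℝ, t.card ≤ 2 * d ∧
      ∀ z, z ∈ t ↔ z ∈ Ico a (a + 2 * Real.pi) ∧ deriv f z = 0 := by
  classical
  set T : Set ℝ := {z | z ∈ Ico a (a + 2 * Real.pi) ∧ deriv f z = 0}
  have hinj : InjOn (fun t : ℝ => Complex.exp (t * Complex.I)) T := by
    intro x hx y hy hxy
    exact eq_of_sub_lt_two_pi hxy (by linarith [hx.1.2, hy.1.1]) (by linarith [hy.1.2, hx.1.1])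
  -- Its top coefficient is `d` times that of `Q`.
  have hR : derivSymbol Q d ≠ 0 := by
    intro h0
    have := coeff_derivSymbol Q d (2 * d)
    rw [h0, coeff_zero] at this
    have h2 : ((2 * d : ℕ) : ℂ) - d = d := by push_cast; ring
    rw [h2] at this
    exact mul_ne_zero (Nat.cast_ne_zero.2 hd.ne') hQ this.symm
  have hmaps : MapsTo (fun t : ℝ => Complex.exp (t * Complex.I)) T
      ((derivSymbol Q d).roots.toFinset : Set ℂ) := by
    intro z hz
    rw [Finset.mem_coe, Multiset.mem_toFinset, mem_roots hR, IsRoot]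
    have := h.eval_derivSymbol hf z
    rw [hz.2, Complex.ofReal_zero, zero_mul] at this
    exact (mul_eq_zero.1 this).resolve_left Complex.I_ne_zero
  have hfin : T.Finite := Finite.of_injOn hmaps hinj (Finset.finite_toSet _)
  refine ⟨hfin.toFinset, ?_, fun z => hfin.mem_toFinset⟩
  refine (Finset.card_le_card_of_injOn _ (by simpa using hmaps) (by simpa using hinj)).trans ?_
  exact ((Multiset.toFinset_card_le _).trans (card_roots' _)).trans (natDegree_derivSymbol_le h.1)

/-- A closed period that starts at a root contains `2 * d + 1` roots, both ends included, against at
most `2 * d` critical points in the half-open period. -/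
theorem TrigRep.exists_gap {f : ℝ → ℝ} {d : ℕ} {Q : ℂ[X]} (h : TrigRep f d Q) (hd : 0 < d)
    (hf : Differentiable ℝ f) {e : ℝ} {A : Finset ℝ} (hA : FullCircle f d e A)
    (hne : f 0 ≠ e) {c : ℝ} (hc : deriv f c = 0) :
    ∃ x y, x < c ∧ c < y ∧ f x = e ∧ f y = e ∧ ∀ z ∈ Ioo x y, deriv f z = 0 → z = c := by
  classical
  have h2pi : (0 : ℝ) < 2 * Real.pi := by positivity
  obtain ⟨α, hα⟩ : A.Nonempty := Finset.card_pos.1 (by rw [hA.1]; omega)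
  have hexp : ∀ b x : ℝ, Complex.exp (toIcoMod h2pi b x * Complex.I) =
      Complex.exp (x * Complex.I) := fun b x =>
    exp_mul_I_eq_iff.2 ⟨-toIcoDiv h2pi b x, by
      rw [← self_sub_toIcoDiv_zsmul, zsmul_eq_mul]; push_cast; ring⟩
  -- A translate of a root is chosen so that the period beginning there contains `c`.
  obtain ⟨a, hac, hca, hfa⟩ : ∃ a, a ≤ c ∧ c < a + 2 * Real.pi ∧ f a = e := by
    have h1 : Complex.exp (toIocMod h2pi (c - 2 * Real.pi) α * Complex.I) =
        Complex.exp (α * Complex.I) :=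
      exp_mul_I_eq_iff.2 ⟨-toIocDiv h2pi (c - 2 * Real.pi) α, by
        rw [← self_sub_toIocDiv_zsmul, zsmul_eq_mul]; push_cast; ring⟩
    have h2 := toIocMod_mem_Ioc h2pi (c - 2 * Real.pi) α
    exact ⟨_, by linarith [h2.2], by linarith [h2.1], (h.periodic h1).trans ((hA.2 α).1 hα).2⟩
  obtain ⟨t, htc, ht⟩ := h.exists_critical_finset hd hf (h.coeff_of_roots hd hA hne).1 a
  have hmem : ∀ t ∈ A, -Real.pi < t ∧ t ≤ Real.pi := fun t ht => ((hA.2 t).1 ht).1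
  have hinj : InjOn (toIcoMod h2pi a) (A : Set ℝ) := by
    intro x hx y hy hxy
    have h1 := hmem x hx
    have h2 := hmem y hy
    refine eq_of_sub_lt_two_pi ?_ (by linarith) (by linarith)
    rw [← hexp a x, ← hexp a y, hxy]
  have hnot : a + 2 * Real.pi ∉ A.image (toIcoMod h2pi a) := by
    intro hcon
    obtain ⟨x, -, hx⟩ := Finset.mem_image.1 hcon
    have := (toIcoMod_mem_Ico h2pi a x).2
    linarith
  set s : Finset ℝ := insert (a + 2 * Real.pi) (A.image (toIcoMod h2pi a)) with hs
  have hscard : s.card = 2 * d + 1 := by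
    rw [hs, Finset.card_insert_of_notMem hnot, Finset.card_image_of_injOn hinj, hA.1]
  have hsI : ∀ x ∈ s, x ∈ Icc a (a + 2 * Real.pi) ∧ f x = e := by
    intro x hx
    rcases Finset.mem_insert.1 hx with rfl | hx
    · exact ⟨⟨by linarith, le_rfl⟩,
        (h.periodic (exp_mul_I_eq_iff.2 ⟨1, by push_cast; ring⟩)).trans hfa⟩
    · obtain ⟨y, hy, rfl⟩ := Finset.mem_image.1 hx
      have := toIcoMod_mem_Ico h2pi a y
      exact ⟨⟨this.1, this.2.le⟩, (h.periodic (hexp a y)).trans ((hA.2 y).1 hy).2⟩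
  refine exists_unique_critical_gap hf (s := s) (t := t) (fun x hx => (hsI x hx).2) ?_
    (by omega) ((ht c).2 ⟨⟨hac, hca⟩, hc⟩)
  intro x hx y hy z hz hz0
  exact (ht z).2 ⟨⟨(hsI x hx).1.1.trans hz.1.le, hz.2.trans_le (hsI y hy).1.2⟩, hz0⟩

theorem TrigRep.deriv_ne_zero {f : ℝ → ℝ} {d : ℕ} {Q : ℂ[X]} (h : TrigRep f d Q) (hd : 0 < d)
    (hf : Differentiable ℝ f) {e₁ e₂ : ℝ} {A B : Finset ℝ} (hA : FullCircle f d e₁ A)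
    (hB : FullCircle f d e₂ B) (h1 : f 0 ≠ e₁) (h2 : f 0 ≠ e₂) {c : ℝ}
    (hc : f c ∈ Icc e₁ e₂) : deriv f c ≠ 0 := by
  intro h0
  refine notMem_Icc_of_unique_critical_gaps hf (fun e he => ?_) hc
  rcases he with rfl | rfl
  · exact h.exists_gap hd hf hA h1 h0
  · exact h.exists_gap hd hf hB h2 h0

theorem TrigRep.integral_sign_deriv_eq_zero {f : ℝ → ℝ} {d : ℕ} {Q : ℂ[X]} (h : TrigRep f d Q)
    (hd : 0 < d) (hf : Differentiable ℝ f) (hf' : Continuous (deriv f)) {e₁ e₂ : ℝ} (he : e₁ < e₂)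
    {A B : Finset ℝ} (hA : FullCircle f d e₁ A) (hB : FullCircle f d e₂ B)
    (h1 : f 0 ≠ e₁) (h2 : f 0 ≠ e₂) (hpi : f Real.pi ∉ Icc e₁ e₂) :
    ∫ t in {t | t ∈ Icc (-Real.pi) Real.pi ∧ f t ∈ Icc e₁ e₂}, Real.sign (deriv f t) = 0 := by
  have hper : f (-Real.pi) = f Real.pi :=
    (h.periodic (exp_mul_I_eq_iff.2 ⟨1, by push_cast; ring⟩)).symm
  have hpos := Real.pi_pos
  have hIcc : ∀ e ∈ Icc e₁ e₂, ∀ C, FullCircle f d e C →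
      ∀ t, t ∈ C ↔ t ∈ Icc (-Real.pi) Real.pi ∧ f t = e := by
    intro e he C hC t
    rw [hC.2]
    refine ⟨fun ht => ⟨⟨ht.1.1.le, ht.1.2⟩, ht.2⟩, fun ht =>
      ⟨⟨lt_of_le_of_ne ht.1.1 ?_, ht.1.2⟩, ht.2⟩⟩
    rintro rfl
    exact hpi (by rw [← hper, ht.2]; exact he)
  have hint := integral_sign_deriv hf hf' he (hper ▸ hpi) hpi
    (fun τ _ => h.deriv_ne_zero hd hf hA hB h1 h2) (hIcc e₁ ⟨le_rfl, he.le⟩ A hA)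
    (hIcc e₂ ⟨he.le, le_rfl⟩ B hB)
  have hcA := h.coeff_of_roots hd hA h1
  have hcB := h.coeff_of_roots hd hB h2
  have hexp := mul_left_cancel₀ hcA.1 (hcB.2.trans hcA.2.symm)
  have hKm : MeasurableSet {t | t ∈ Icc (-Real.pi) Real.pi ∧ f t ∈ Icc e₁ e₂} :=
    measurableSet_Icc.inter (hf.continuous.measurable measurableSet_Icc)
  -- The two sums agree modulo `2π`. The bound is strict because the strip misses a neighbourhood of
  -- `π`, and it forces them to be equal.
  have hbound : |∑ t ∈ B, t - ∑ t ∈ A, t| < 2 * Real.pi := by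
    rw [← hint, ← Real.norm_eq_abs]
    have hfin : volume {t | t ∈ Icc (-Real.pi) Real.pi ∧ f t ∈ Icc e₁ e₂} < ⊤ :=
      (measure_mono fun t ht => ht.1).trans_lt (isCompact_Icc (a := -Real.pi)).measure_lt_top
    refine (norm_setIntegral_le_of_norm_le_const (C := 1) hfin fun t _ => ?_).trans_lt ?_
    · rcases Real.sign_apply_eq (deriv f t) with h | h | h <;> simp [h]
    · obtain ⟨δ, hδ, hδs⟩ : ∃ δ > 0, ∀ t, |t - Real.pi| < δ → f t ∉ Icc e₁ e₂ := by
        have := hf.continuous.continuousAt.preimage_mem_nhds (isClosed_Icc.isOpen_compl.mem_nhds hpi)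
        obtain ⟨δ, hδ, hsub⟩ := Metric.mem_nhds_iff.1 this
        exact ⟨δ, hδ, fun t ht => hsub ht⟩
      have hsub : {t | t ∈ Icc (-Real.pi) Real.pi ∧ f t ∈ Icc e₁ e₂} ⊆
          Icc (-Real.pi) (Real.pi - δ) := by
        rintro t ⟨ht, hft⟩
        refine ⟨ht.1, ?_⟩
        by_contra hlt
        refine hδs t ?_ hft
        rw [abs_lt]
        constructor <;> linarith [ht.2]
      have hfin' : volume (Icc (-Real.pi) (Real.pi - δ)) ≠ ⊤ := by
        rw [Real.volume_Icc]; exact ENNReal.ofReal_ne_top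
      have hmono := measureReal_mono hsub hfin'
      rw [Measure.real, Measure.real, Real.volume_Icc, ENNReal.toReal_ofReal'] at hmono
      rw [one_mul, Measure.real]
      refine hmono.trans_lt (max_lt ?_ ?_) <;> linarith
  rw [hint]
  have := eq_of_sub_lt_two_pi hexp (by linarith [(abs_lt.1 hbound).2])
    (by linarith [(abs_lt.1 hbound).1])
  linarith

/-- `f` is the exponential polynomial represented by `Q`. -/
def ExpRep (f : ℝ → ℝ) (m : ℕ) (Q : ℝ[X]) : Prop :=
  Q.natDegree ≤ 2 * m ∧ ∀ r : ℝ, Q.eval (Real.exp (2 * r)) = f r * Real.exp (2 * r) ^ m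

/-- The zeros of `f - e` on the line, with the right number of them. -/
def FullLine (f : ℝ → ℝ) (N : ℕ) (e : ℝ) (A : Finset ℝ) : Prop :=
  A.card = N ∧ ∀ t, t ∈ A ↔ f t = e

theorem exp_two_mul_injective : Function.Injective fun r : ℝ => Real.exp (2 * r) := by
  intro x y h
  have := Real.exp_injective h
  linarith

theorem ExpRep.eval_derivSymbol {f : ℝ → ℝ} {m : ℕ} {Q : ℝ[X]} (h : ExpRep f m Q)
    (hf : Differentiable ℝ f) (r : ℝ) :
    2 * (derivSymbol Q m).eval (Real.exp (2 * r)) = deriv f r * Real.exp (2 * r) ^ m := by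
  have hE : HasDerivAt (fun t : ℝ => Real.exp (2 * t)) (Real.exp (2 * r) * 2) r := by
    simpa using ((hasDerivAt_id r).const_mul 2).exp
  have hL := (Q.hasDerivAt (Real.exp (2 * r))).comp r hE
  have hR := (hf r).hasDerivAt.mul (hE.pow m)
  have heq : (fun t : ℝ => Q.eval (Real.exp (2 * t))) =
      f * (fun t : ℝ => Real.exp (2 * t)) ^ m := by
    funext t; exact h.2 t
  have hu := hL.unique (heq ▸ hR)
  rw [derivSymbol, eval_sub, eval_mul, eval_mul, eval_X, eval_C, h.2 r]
  rcases m with _ | m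
  · simp only [Pi.pow_apply, Nat.cast_zero, zero_mul, mul_zero, add_zero, pow_zero, mul_one] at hu ⊢
    linear_combination hu
  · simp only [Pi.pow_apply, Nat.add_sub_cancel] at hu
    linear_combination hu

theorem ExpRep.coeff_of_roots {f : ℝ → ℝ} {m : ℕ} {Q : ℝ[X]} (h : ExpRep f m Q) (hm : 0 < m)
    {e : ℝ} {A : Finset ℝ} (hA : FullLine f (2 * m) e A) :
    Q.coeff (2 * m) ≠ 0 ∧ Q.coeff (2 * m) * Real.exp (2 * ∑ t ∈ A, t) = Q.coeff 0 := by
  classical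
  obtain ⟨r, hr⟩ : ∃ r, f r ≠ e := by
    obtain ⟨r, hr⟩ := Infinite.exists_notMem_finset A
    exact ⟨r, fun hcon => hr ((hA.2 r).2 hcon)⟩
  have hinj : InjOn (fun r : ℝ => Real.exp (2 * r)) (A : Set ℝ) := exp_two_mul_injective.injOn
  obtain ⟨h1, h2⟩ := coeff_mul_prod_neg_roots (Q := Q) (N := 2 * m) (m := m) (e := e) h.1 hm
    (by omega) (Z := A.image fun t : ℝ => Real.exp (2 * t))
    (by rw [Finset.card_image_of_injOn hinj, hA.1])
    (by
      intro z hz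
      obtain ⟨t, ht, rfl⟩ := Finset.mem_image.1 hz
      rw [h.2, (hA.2 t).1 ht])
    ⟨Real.exp (2 * r), by
      rw [h.2]
      intro hcon
      exact hr (mul_right_cancel₀ (pow_ne_zero m (Real.exp_ne_zero _)) hcon)⟩
  refine ⟨h1, ?_⟩
  rw [← h2, Finset.prod_image hinj, Finset.prod_neg, hA.1, pow_mul, Finset.mul_sum, Real.exp_sum]
  simp

/-- On a line there is no extra root from periodicity, so one critical point has to be saved. The
extreme coefficients of `derivSymbol Q m` are `m` and `-m` times those of `Q`, hence of opposite
signs, whereas `2 * m` distinct positive roots would make their ratio positive. -/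
theorem ExpRep.exists_critical_finset {f : ℝ → ℝ} {m : ℕ} {Q : ℝ[X]} (h : ExpRep f m Q)
    (hm : 0 < m) (hf : Differentiable ℝ f) (hQ : Q.coeff (2 * m) ≠ 0)
    (hQ0 : 0 < Q.coeff (2 * m) * Q.coeff 0) :
    ∃ t : Finset ℝ, t.card < 2 * m ∧ ∀ z, z ∈ t ↔ deriv f z = 0 := by
  classical
  have hm' : (0 : ℝ) < m := Nat.cast_pos.2 hm
  have hlead : (derivSymbol Q m).coeff (2 * m) = m * Q.coeff (2 * m) := by
    rw [coeff_derivSymbol]; push_cast; ring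
  have hconst : (derivSymbol Q m).coeff 0 = -m * Q.coeff 0 := by
    rw [coeff_derivSymbol]; push_cast; ring
  have hR : derivSymbol Q m ≠ 0 := by
    intro h0
    rw [h0, coeff_zero] at hlead
    exact mul_ne_zero hm'.ne' hQ hlead.symm
  have hzero : ∀ z, deriv f z = 0 → (derivSymbol Q m).eval (Real.exp (2 * z)) = 0 := by
    intro z hz
    have := h.eval_derivSymbol hf z
    rw [hz, zero_mul] at this
    exact (mul_eq_zero.1 this).resolve_left two_ne_zero
  have hmaps : MapsTo (fun t : ℝ => Real.exp (2 * t)) {z | deriv f z = 0}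
      ((derivSymbol Q m).roots.toFinset : Set ℝ) := by
    intro z hz
    rw [Finset.mem_coe, Multiset.mem_toFinset, mem_roots hR, IsRoot]
    exact hzero z hz
  have hfin : {z | deriv f z = 0}.Finite :=
    Finite.of_injOn hmaps exp_two_mul_injective.injOn (Finset.finite_toSet _)
  have hdeg := natDegree_derivSymbol_le (m := m) h.1
  have hle : hfin.toFinset.card ≤ 2 * m := by
    refine (Finset.card_le_card_of_injOn _ (by simpa using hmaps)
      exp_two_mul_injective.injOn).trans ?_
    exact ((Multiset.toFinset_card_le _).trans (card_roots' _)).trans hdeg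
  refine ⟨hfin.toFinset, lt_of_le_of_ne hle fun hcard => ?_, fun z => hfin.mem_toFinset⟩
  have hinj : InjOn (fun r : ℝ => Real.exp (2 * r)) (hfin.toFinset : Set ℝ) :=
    exp_two_mul_injective.injOn
  obtain ⟨z₀, hz₀⟩ : ∃ z, (derivSymbol Q m).eval z ≠ 0 := by
    by_contra hcon
    push Not at hcon
    exact hR (Polynomial.funext fun z => by rw [hcon z, eval_zero])
  obtain ⟨-, h2⟩ := coeff_mul_prod_neg_roots (Q := derivSymbol Q m) (N := 2 * m) (m := 1) (e := 0)
    hdeg one_pos (by omega) (Z := hfin.toFinset.image fun t : ℝ => Real.exp (2 * t))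
    (by rw [Finset.card_image_of_injOn hinj, hcard])
    (by
      intro z hz
      obtain ⟨t, ht, rfl⟩ := Finset.mem_image.1 hz
      rw [zero_mul]
      exact hzero t (hfin.mem_toFinset.1 ht))
    ⟨z₀, by rwa [zero_mul]⟩
  rw [Finset.prod_image hinj, Finset.prod_neg, hcard, pow_mul, neg_one_sq, one_pow, one_mul,
    ← Real.exp_sum, hlead, hconst] at h2
  have hpos := Real.exp_pos (∑ x ∈ hfin.toFinset, 2 * x)
  have h3 : Q.coeff (2 * m) * Real.exp (∑ x ∈ hfin.toFinset, 2 * x) = -Q.coeff 0 := by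
    refine mul_left_cancel₀ hm'.ne' ?_
    linear_combination h2
  have h4 : 0 < Q.coeff (2 * m) ^ 2 * Real.exp (∑ x ∈ hfin.toFinset, 2 * x) := by positivity
  rw [sq, mul_assoc, h3] at h4
  linarith

theorem ExpRep.deriv_ne_zero {f : ℝ → ℝ} {m : ℕ} {Q : ℝ[X]} (h : ExpRep f m Q) (hm : 0 < m)
    (hf : Differentiable ℝ f) {e₁ e₂ : ℝ} {A B : Finset ℝ} (hA : FullLine f (2 * m) e₁ A)
    (hB : FullLine f (2 * m) e₂ B) {c : ℝ}
    (hc : f c ∈ Icc e₁ e₂) : deriv f c ≠ 0 := by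
  intro h0
  have hcA := h.coeff_of_roots hm hA
  -- The constant coefficient is a positive multiple of the leading one, by Vieta for the level
  -- `e₁`.
  obtain ⟨t, htc, ht⟩ := h.exists_critical_finset hm hf hcA.1 (by
    rw [← hcA.2, ← mul_assoc, ← sq]
    have := hcA.1
    positivity)
  have gap : ∀ e C, FullLine f (2 * m) e C →
      ∃ x y, x < c ∧ c < y ∧ f x = e ∧ f y = e ∧ ∀ z ∈ Ioo x y, deriv f z = 0 → z = c :=
    fun e C hC => exists_unique_critical_gap hf (s := C) (t := t) (fun x hx => (hC.2 x).1 hx)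
      (fun x _ y _ z _ hz => (ht z).2 hz) (by rw [hC.1]; exact htc) ((ht c).2 h0)
  refine notMem_Icc_of_unique_critical_gaps hf (fun e he => ?_) hc
  rcases he with rfl | rfl
  · exact gap _ _ hA
  · exact gap _ _ hB

theorem ExpRep.integral_sign_deriv_eq_zero {f : ℝ → ℝ} {m : ℕ} {Q : ℝ[X]} (h : ExpRep f m Q)
    (hm : 0 < m) (hf : Differentiable ℝ f) (hf' : Continuous (deriv f)) {e₁ e₂ : ℝ} (he : e₁ < e₂)
    {A B : Finset ℝ} (hA : FullLine f (2 * m) e₁ A) (hB : FullLine f (2 * m) e₂ B) {R : ℝ}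
    (hR : ∀ t, f t ∈ Icc e₁ e₂ → |t| < R) :
    ∫ t in {t | f t ∈ Icc e₁ e₂}, Real.sign (deriv f t) = 0 := by
  have hmem : ∀ t, f t ∈ Icc e₁ e₂ → t ∈ Icc (-R) R := fun t ht =>
    ⟨(abs_lt.1 (hR t ht)).1.le, (abs_lt.1 (hR t ht)).2.le⟩
  have hint := integral_sign_deriv hf hf' he (L := -R) (R := R)
    (fun hcon => by have := (abs_lt.1 (hR _ hcon)).1; exact lt_irrefl _ this)
    (fun hcon => by have := (abs_lt.1 (hR _ hcon)).2; exact lt_irrefl _ this)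
    (fun τ _ => h.deriv_ne_zero hm hf hA hB)
    (A := A) (B := B)
    (fun t => by
      rw [hA.2]
      exact ⟨fun ht => ⟨hmem t (by rw [ht]; exact ⟨le_rfl, he.le⟩), ht⟩, fun ht => ht.2⟩)
    (fun t => by
      rw [hB.2]
      exact ⟨fun ht => ⟨hmem t (by rw [ht]; exact ⟨he.le, le_rfl⟩), ht⟩, fun ht => ht.2⟩)
  have hset : {t | f t ∈ Icc e₁ e₂} = {t | t ∈ Icc (-R) R ∧ f t ∈ Icc e₁ e₂} := by
    ext t
    exact ⟨fun ht => ⟨hmem t ht, ht⟩, fun ht => ht.2⟩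
  rw [hset, hint]
  have hcA := h.coeff_of_roots hm hA
  have hcB := h.coeff_of_roots hm hB
  have hexp := Real.exp_injective (mul_left_cancel₀ hcA.1 (hcB.2.trans hcA.2.symm))
  linarith

end ExponentialPolynomials

/-! ### The ambient form and the reflection that moves a point to the pole. -/

section AmbientGeometry

variable {n : ℕ} {g : Geometry}

/-- The sign of the curvature. -/
def kap (g : Geometry) : ℝ :=
  match g with
  | .spherical => 1
  | .hyperbolic => -1

theorem kap_mul_self (g : Geometry) : kap g * kap g = 1 := by cases g <;> simp [kap]

theorem kap_ne_zero (g : Geometry) : kap g ≠ 0 := by cases g <;> simp [kap]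

theorem pairing_eq (g : Geometry) (x y : Ambient n) :
    pairing g x y = kap g * (x 0 * y 0) + ∑ i : Fin n, x i.succ * y i.succ := by
  cases g
  · simp only [pairing, kap, PiLp.inner_apply, Fin.sum_univ_succ, RCLike.inner_apply, conj_trivial,
      one_mul]
    simp only [mul_comm]
  · simp only [pairing, kap]; ring

theorem pairing_comm (g : Geometry) (x y : Ambient n) : pairing g x y = pairing g y x := by
  simp only [pairing_eq, mul_comm]

theorem pairing_add_left (g : Geometry) (x y z : Ambient n) :
    pairing g (x + y) z = pairing g x z + pairing g y z := by
  simp only [pairing_eq, PiLp.add_apply, add_mul, Finset.sum_add_distrib]; ring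

theorem pairing_smul_left (g : Geometry) (a : ℝ) (x z : Ambient n) :
    pairing g (a • x) z = a * pairing g x z := by
  simp only [pairing_eq, PiLp.smul_apply, smul_eq_mul, mul_add, Finset.mul_sum]
  congr 1
  · ring
  · exact Finset.sum_congr rfl fun i _ => by ring

theorem pairing_sub_left (g : Geometry) (x y z : Ambient n) :
    pairing g (x - y) z = pairing g x z - pairing g y z := by
  rw [sub_eq_add_neg, ← neg_one_smul ℝ y, pairing_add_left, pairing_smul_left]; ring

theorem pairing_add_right (g : Geometry) (x y z : Ambient n) :
    pairing g x (y + z) = pairing g x y + pairing g x z := by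
  rw [pairing_comm, pairing_add_left, pairing_comm g y, pairing_comm g z]

theorem pairing_smul_right (g : Geometry) (a : ℝ) (x z : Ambient n) :
    pairing g x (a • z) = a * pairing g x z := by
  rw [pairing_comm, pairing_smul_left, pairing_comm g z]

theorem pairing_sub_right (g : Geometry) (x y z : Ambient n) :
    pairing g x (y - z) = pairing g x y - pairing g x z := by
  rw [pairing_comm, pairing_sub_left, pairing_comm g y, pairing_comm g z]

theorem continuous_pairing (g : Geometry) :
    Continuous fun q : Ambient n × Ambient n => pairing g q.1 q.2 := by
  simp only [pairing_eq]; fun_prop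

theorem _root_.Continuous.pairing {α : Type*} [TopologicalSpace α] {a b : α → Ambient n}
    (ha : Continuous a) (hb : Continuous b) (g : Geometry) :
    Continuous fun t => pairing g (a t) (b t) :=
  (continuous_pairing g).comp (ha.prodMk hb)

/-- The vector with first coordinate `a` and remaining coordinates `w`. -/
noncomputable def cons (a : ℝ) (w : EuclideanSpace ℝ (Fin n)) : Ambient n :=
  WithLp.toLp 2 (Fin.cons a w.ofLp : Fin (n + 1) → ℝ)

@[simp] theorem cons_zero (a : ℝ) (w : EuclideanSpace ℝ (Fin n)) : cons a w 0 = a := rfl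

@[simp] theorem cons_succ (a : ℝ) (w : EuclideanSpace ℝ (Fin n)) (i : Fin n) :
    cons a w i.succ = w i := rfl

theorem cons_ext {y z : Ambient n} (h0 : y 0 = z 0) (h : ∀ i : Fin n, y i.succ = z i.succ) :
    y = z := by
  ext i
  exact Fin.cases h0 h i

theorem exists_eq_cons (y : Ambient n) :
    ∃ w : EuclideanSpace ℝ (Fin n), y = cons (y 0) w :=
  ⟨WithLp.toLp 2 fun i => y i.succ, cons_ext rfl fun _ => rfl⟩

theorem cons_add (a b : ℝ) (v w : EuclideanSpace ℝ (Fin n)) :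
    cons a v + cons b w = cons (a + b) (v + w) := cons_ext rfl fun _ => rfl

theorem smul_cons (c a : ℝ) (v : EuclideanSpace ℝ (Fin n)) :
    c • cons a v = cons (c * a) (c • v) := cons_ext rfl fun _ => rfl

theorem cons_sub (a b : ℝ) (v w : EuclideanSpace ℝ (Fin n)) :
    cons a v - cons b w = cons (a - b) (v - w) := cons_ext rfl fun _ => rfl

theorem continuous_cons :
    Continuous fun q : ℝ × EuclideanSpace ℝ (Fin n) => (cons q.1 q.2 : Ambient n) := by
  refine (PiLp.continuous_toLp 2 _).comp (continuous_pi fun i => ?_)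
  refine Fin.cases ?_ (fun i => ?_) i
  · exact continuous_fst
  · simp only [Fin.cons_succ]; fun_prop

theorem pairing_cons (a b : ℝ) (v w : EuclideanSpace ℝ (Fin n)) :
    pairing g (cons a v) (cons b w) = kap g * (a * b) + inner ℝ v w := by
  rw [pairing_eq]
  simp only [cons_zero, cons_succ, PiLp.inner_apply, RCLike.inner_apply, conj_trivial]
  simp only [mul_comm]

theorem mem_space_iff {y : Ambient n} :
    y ∈ space g n ↔ pairing g y y = kap g ∧ (g = .hyperbolic → 0 < y 0) := by
  cases g
  · simp only [space, mem_sphere_zero_iff_norm, pairing, kap, real_inner_self_eq_norm_sq,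
      reduceCtorEq, false_imp_iff, and_true]
    exact (pow_eq_one_iff_of_nonneg (norm_nonneg _) two_ne_zero).symm
  · simp [space, kap]

/-- The unit vector in the direction of the first coordinate. -/
noncomputable def pole (n : ℕ) : Ambient n := cons 1 0

theorem pairing_pole (y : Ambient n) : pairing g y (pole n) = kap g * y 0 := by
  obtain ⟨w, hw⟩ := exists_eq_cons y
  rw [hw, pole, pairing_cons]; simp

theorem pole_mem_space : pole n ∈ space g n := by
  rw [mem_space_iff, pairing_pole, pole]; simp

/-- On the upper sheet the spatial part is shorter than the time coordinate, so Cauchy–Schwarz for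
the spatial parts decides the sign. -/
theorem pairing_neg_of_mem {x y : Ambient n} (hx : x ∈ space .hyperbolic n)
    (hy : y ∈ space .hyperbolic n) : pairing .hyperbolic x y < 0 := by
  obtain ⟨hx1, hx0⟩ := mem_space_iff.1 hx
  obtain ⟨hy1, hy0⟩ := mem_space_iff.1 hy
  replace hx0 := hx0 rfl
  replace hy0 := hy0 rfl
  obtain ⟨v, hv⟩ := exists_eq_cons x
  obtain ⟨w, hw⟩ := exists_eq_cons y
  rw [hv, pairing_cons, real_inner_self_eq_norm_sq] at hx1
  rw [hw, pairing_cons, real_inner_self_eq_norm_sq] at hy1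
  rw [hv, hw, pairing_cons]
  simp only [kap] at hx1 hy1 ⊢
  have h1 : ‖v‖ < x 0 := by nlinarith [norm_nonneg v]
  have h2 : ‖w‖ < y 0 := by nlinarith [norm_nonneg w]
  have h3 := real_inner_le_norm v w
  have h4 : ‖v‖ * ‖w‖ < x 0 * y 0 := mul_lt_mul'' h1 h2 (norm_nonneg _) (norm_nonneg _)
  linarith

/-- The reflection that exchanges the pole and `x`. -/
noncomputable def refl (g : Geometry) (x : Ambient n) : Ambient n →ₗ[ℝ] Ambient n where
  toFun z := z - (2 * pairing g z (x - pole n) / pairing g (x - pole n) (x - pole n)) •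
    (x - pole n)
  map_add' y z := by
    rw [pairing_add_left, mul_add, add_div, add_smul]; abel
  map_smul' a z := by
    rw [pairing_smul_left, RingHom.id_apply, smul_sub a z, smul_smul]
    congr 2; ring

theorem refl_apply (x z : Ambient n) : refl g x z =
    z - (2 * pairing g z (x - pole n) / pairing g (x - pole n) (x - pole n)) •
      (x - pole n) := rfl

theorem pairing_refl_refl (x y z : Ambient n) :
    pairing g (refl g x y) (refl g x z) = pairing g y z := by
  simp only [refl_apply, pairing_sub_left _ y, pairing_sub_right _ _ z, pairing_smul_left, pairing_smul_right]
  set u := x - pole n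
  rw [pairing_comm g u z]
  rcases eq_or_ne (pairing g u u) 0 with h | h
  · simp [h]
  · field_simp; ring

theorem refl_refl (x z : Ambient n) : refl g x (refl g x z) = z := by
  simp only [refl_apply, pairing_sub_left _ z, pairing_smul_left]
  set u := x - pole n
  rcases eq_or_ne (pairing g u u) 0 with h | h
  · simp [h]
  · rw [sub_sub, ← add_smul, sub_eq_self]
    refine smul_eq_zero_of_left ?_ _
    field_simp; ring

theorem pairing_refl_left (x y z : Ambient n) :
    pairing g (refl g x y) z = pairing g y (refl g x z) := by
  rw [← pairing_refl_refl x y, refl_refl]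

theorem refl_pole {x : Ambient n} (hx : x ∈ space g n) : refl g x (pole n) = x := by
  rw [refl_apply]
  obtain ⟨hx1, hx0⟩ := mem_space_iff.1 hx
  obtain ⟨hp1, -⟩ := mem_space_iff.1 (pole_mem_space (n := n) (g := g))
  have huu : pairing g (x - pole n) (x - pole n) = 2 * kap g * (1 - x 0) := by
    rw [pairing_sub_left, pairing_sub_right, pairing_sub_right, pairing_comm g (pole n) x,
      pairing_pole, hx1, hp1]; ring
  have hpu : pairing g (pole n) (x - pole n) = kap g * (x 0 - 1) := by
    rw [pairing_sub_right, hp1, pairing_comm, pairing_pole]; ring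
  rw [huu, hpu]
  -- Here `x 0 = 1` forces `x` to be the pole, and the reflection degenerates to the identity;
  -- otherwise the coefficient is `-1`.
  rcases eq_or_ne (x 0) 1 with h | h
  · obtain ⟨w, hw⟩ := exists_eq_cons x
    have hw0 : w = 0 := by
      rw [hw, pairing_cons, h] at hx1
      simpa using hx1
    have : x = pole n := by rw [hw, h, hw0]; rfl
    rw [this]; simp
  · have h1 : 1 - x 0 ≠ 0 := sub_ne_zero.2 h.symm
    have h2 := kap_ne_zero g
    have : 2 * (kap g * (x 0 - 1)) / (2 * kap g * (1 - x 0)) = -1 := by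
      field_simp; ring
    rw [this, neg_one_smul]; abel

theorem refl_self {x : Ambient n} (hx : x ∈ space g n) : refl g x x = pole n := by
  have := refl_refl (g := g) x (pole n)
  rwa [refl_pole hx] at this

theorem kap_pairing_refl {x : Ambient n} (hx : x ∈ space g n) (y : Ambient n) :
    pairing g x (refl g x y) = kap g * y 0 := by
  rw [← pairing_refl_left, refl_self hx, pairing_comm, pairing_pole]

theorem refl_mem_space {x y : Ambient n} (hx : x ∈ space g n) (hy : y ∈ space g n) :
    refl g x y ∈ space g n := by
  rw [mem_space_iff, pairing_refl_refl]
  refine ⟨(mem_space_iff.1 hy).1, ?_⟩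
  rintro rfl
  have h1 : pairing .hyperbolic (refl .hyperbolic x y) (pole n) = pairing .hyperbolic y x := by
    rw [pairing_refl_left, refl_pole hx]
  rw [pairing_pole] at h1
  have h2 := pairing_neg_of_mem hy hx
  simp only [kap] at h1
  linarith

theorem continuous_refl (x : Ambient n) : Continuous (refl g x) :=
  (refl g x).continuous_of_finiteDimensional

end AmbientGeometry

/-! ### Geodesics, distance and force in polar coordinates. -/

section Geodesics

variable {n : ℕ} {g : Geometry}

theorem cs_sq_add (g : Geometry) (r : ℝ) : kap g * cs g r ^ 2 + sn g r ^ 2 = kap g := by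
  cases g
  · simp [kap, cs, sn]
  · simp only [kap, cs, sn]; linarith [Real.cosh_sq r]

theorem cs_zero (g : Geometry) : cs g 0 = 1 := by cases g <;> simp [cs]

theorem sn_zero (g : Geometry) : sn g 0 = 0 := by cases g <;> simp [sn]

theorem cs_neg (g : Geometry) (r : ℝ) : cs g (-r) = cs g r := by cases g <;> simp [cs]

theorem sn_neg (g : Geometry) (r : ℝ) : sn g (-r) = -sn g r := by cases g <;> simp [sn]

theorem cs_sub (g : Geometry) (r s : ℝ) :
    cs g (r - s) = cs g r * cs g s + kap g * (sn g r * sn g s) := by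
  cases g
  · simp only [cs, sn, kap, Real.cos_sub]; ring
  · simp only [cs, sn, kap, Real.cosh_sub]; ring

theorem sn_sub (g : Geometry) (r s : ℝ) :
    sn g (r - s) = sn g r * cs g s - cs g r * sn g s := by
  cases g
  · simp only [cs, sn, Real.sin_sub]
  · simp only [cs, sn, Real.sinh_sub]

theorem hasDerivAt_cs (g : Geometry) (r : ℝ) : HasDerivAt (cs g) (-kap g * sn g r) r := by
  cases g
  · rw [kap, neg_one_mul]; exact Real.hasDerivAt_cos r
  · rw [kap, neg_neg, one_mul]; exact Real.hasDerivAt_cosh r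

theorem hasDerivAt_sn (g : Geometry) (r : ℝ) : HasDerivAt (sn g) (cs g r) r := by
  cases g
  · exact Real.hasDerivAt_sin r
  · exact Real.hasDerivAt_sinh r

theorem continuous_cs (g : Geometry) : Continuous (cs g) :=
  continuous_iff_continuousAt.2 fun r => (hasDerivAt_cs g r).continuousAt

theorem continuous_sn (g : Geometry) : Continuous (sn g) :=
  continuous_iff_continuousAt.2 fun r => (hasDerivAt_sn g r).continuousAt

/-- The geodesic from `x` in the direction of the unit vector `u`. -/
noncomputable def geo (g : Geometry) (x : Ambient n) (u : EuclideanSpace ℝ (Fin n)) (r : ℝ) :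
    Ambient n := refl g x (cons (cs g r) (sn g r • u))

/-- The velocity of `geo`. -/
noncomputable def dgeo (g : Geometry) (x : Ambient n) (u : EuclideanSpace ℝ (Fin n)) (r : ℝ) :
    Ambient n := refl g x (cons (-kap g * sn g r) (cs g r • u))

theorem geo_zero {x : Ambient n} (hx : x ∈ space g n) (u : EuclideanSpace ℝ (Fin n)) :
    geo g x u 0 = x := by
  rw [geo, cs_zero, sn_zero, zero_smul]; exact refl_pole hx

theorem geo_neg (x : Ambient n) (u : EuclideanSpace ℝ (Fin n)) (r : ℝ) :
    geo g x (-u) r = geo g x u (-r) := by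
  rw [geo, geo, cs_neg, sn_neg, neg_smul, smul_neg]

theorem geo_eq {x : Ambient n} (hx : x ∈ space g n) (u : EuclideanSpace ℝ (Fin n)) (r : ℝ) :
    geo g x u r = cs g r • x + sn g r • refl g x (cons 0 u) := by
  have h : cs g r • x = refl g x (cs g r • pole n) := by rw [map_smul, refl_pole hx]
  rw [h, ← map_smul, ← map_add, geo, pole, smul_cons, smul_cons, cons_add]
  simp

/-- This expresses the direction away from the point with parameter `s` through the velocity of the
geodesic. It allows the derivative of `p` away from any centre on a geodesic to be read off from the
slope along it. -/
theorem cs_smul_geo_sub (x : Ambient n) (u : EuclideanSpace ℝ (Fin n)) (r s : ℝ) :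
    cs g (r - s) • geo g x u r - geo g x u s = sn g (r - s) • dgeo g x u r := by
  rw [geo, geo, dgeo, ← map_smul, ← map_smul, ← map_sub, smul_cons, smul_cons, cons_sub, smul_smul,
    smul_smul, ← sub_smul]
  have h1 := cs_sq_add g r
  have h2 := kap_mul_self g
  rw [cs_sub, sn_sub]
  congr 2
  · linear_combination (kap g * cs g s) * h1 + (cs g s - cs g s * cs g r ^ 2) * h2
  · congr 1
    linear_combination sn g s * kap g * h1 + (sn g s - sn g s * cs g r ^ 2) * h2

theorem pairing_geo_geo {u : EuclideanSpace ℝ (Fin n)} (hu : ‖u‖ = 1) (x : Ambient n) (r s : ℝ) :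
    pairing g (geo g x u r) (geo g x u s) = kap g * cs g (r - s) := by
  rw [geo, geo, pairing_refl_refl, pairing_cons, inner_smul_left, inner_smul_right,
    real_inner_self_eq_norm_sq, hu, cs_sub, conj_trivial]
  linear_combination (-(sn g r * sn g s)) * kap_mul_self g

theorem cs_pos_hyperbolic (r : ℝ) : 0 < cs .hyperbolic r := Real.cosh_pos r

theorem geo_mem_space {x : Ambient n} (hx : x ∈ space g n) {u : EuclideanSpace ℝ (Fin n)}
    (hu : ‖u‖ = 1) (r : ℝ) : geo g x u r ∈ space g n := by
  refine refl_mem_space hx (mem_space_iff.2 ⟨?_, ?_⟩)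
  · rw [pairing_cons, inner_smul_left, inner_smul_right, real_inner_self_eq_norm_sq, hu,
      conj_trivial]
    linear_combination cs_sq_add g r
  · rintro rfl; exact cs_pos_hyperbolic r

theorem continuous_geo (g : Geometry) (x : Ambient n) :
    Continuous fun q : EuclideanSpace ℝ (Fin n) × ℝ => geo g x q.1 q.2 := by
  refine (continuous_refl x).comp (continuous_cons.comp (Continuous.prodMk ?_ ?_))
  · exact (continuous_cs g).comp continuous_snd
  · exact ((continuous_sn g).comp continuous_snd).smul continuous_fst

theorem continuous_dgeo (g : Geometry) (x : Ambient n) :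
    Continuous fun q : EuclideanSpace ℝ (Fin n) × ℝ => dgeo g x q.1 q.2 := by
  refine (continuous_refl x).comp (continuous_cons.comp (Continuous.prodMk ?_ ?_))
  · exact continuous_const.mul ((continuous_sn g).comp continuous_snd)
  · exact ((continuous_cs g).comp continuous_snd).smul continuous_fst

theorem hasDerivAt_geo (x : Ambient n) (u : EuclideanSpace ℝ (Fin n)) (r : ℝ) :
    HasDerivAt (geo g x u) (dgeo g x u r) r := by
  have h1 : ∀ a b : ℝ, refl g x (cons a (b • u)) =
      a • refl g x (cons 1 0) + b • refl g x (cons 0 u) := by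
    intro a b
    rw [← map_smul, ← map_smul, ← map_add, smul_cons, smul_cons, cons_add]; simp
  have h2 : geo g x u = fun r => cs g r • refl g x (cons 1 0) + sn g r • refl g x (cons 0 u) := by
    funext r; exact h1 _ _
  rw [h2, dgeo, h1]
  exact ((hasDerivAt_cs g r).smul_const _).add ((hasDerivAt_sn g r).smul_const _)

/-- The range of the distance function. -/
def radialRange (g : Geometry) : Set ℝ :=
  match g with
  | .spherical => Set.Icc 0 Real.pi
  | .hyperbolic => Set.Ici 0

theorem nonneg_of_mem_radialRange {r : ℝ} (hr : r ∈ radialRange g) : 0 ≤ r := by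
  cases g
  · exact hr.1
  · exact hr

theorem sn_nonneg {r : ℝ} (hr : r ∈ radialRange g) : 0 ≤ sn g r := by
  cases g
  · exact Real.sin_nonneg_of_mem_Icc hr
  · exact Real.sinh_nonneg_iff.2 hr

theorem exists_cs_sn {a b : ℝ} (h : kap g * a ^ 2 + b ^ 2 = kap g) (hb : 0 ≤ b)
    (ha : g = .hyperbolic → 0 < a) : ∃ r ∈ radialRange g, a = cs g r ∧ b = sn g r := by
  cases g
  · simp only [kap, one_mul] at h
    have h1 : -1 ≤ a := by nlinarith
    have h2 : a ≤ 1 := by nlinarith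
    refine ⟨Real.arccos a, ⟨Real.arccos_nonneg a, Real.arccos_le_pi a⟩, ?_, ?_⟩
    · exact (Real.cos_arccos h1 h2).symm
    · change b = Real.sin _
      rw [Real.sin_arccos, eq_comm, Real.sqrt_eq_iff_mul_self_eq (by nlinarith) hb]
      linarith
  · simp only [kap] at h
    refine ⟨Real.arsinh b, Real.arsinh_nonneg_iff.2 hb, ?_, (Real.sinh_arsinh b).symm⟩
    change a = Real.cosh _
    have h3 := Real.cosh_sq (Real.arsinh b)
    rw [Real.sinh_arsinh] at h3
    have h4 := Real.cosh_pos (Real.arsinh b)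
    have := ha rfl
    nlinarith

theorem exists_unit (hn : 1 ≤ n) : ∃ u : EuclideanSpace ℝ (Fin n), ‖u‖ = 1 :=
  ⟨EuclideanSpace.single ⟨0, hn⟩ 1, by simp⟩

theorem exists_eq_geo (hn : 1 ≤ n) {x y : Ambient n} (hx : x ∈ space g n) (hy : y ∈ space g n) :
    ∃ u : EuclideanSpace ℝ (Fin n), ‖u‖ = 1 ∧ ∃ r ∈ radialRange g, y = geo g x u r := by
  obtain ⟨w, hw⟩ := exists_eq_cons (refl g x y)
  obtain ⟨h1, h0⟩ := mem_space_iff.1 (refl_mem_space hx hy)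
  set a := refl g x y 0
  rw [hw, pairing_cons, real_inner_self_eq_norm_sq] at h1
  obtain ⟨r, hr, hra, hrb⟩ := exists_cs_sn (a := a) (b := ‖w‖) (g := g)
    (by linear_combination h1) (norm_nonneg w) h0
  have hy' : y = refl g x (cons a w) := by rw [← hw, refl_refl]
  rcases eq_or_ne w 0 with hw0 | hw0
  · obtain ⟨u, hu⟩ := exists_unit hn
    refine ⟨u, hu, r, hr, ?_⟩
    rw [hy', geo, ← hra, ← hrb, hw0]; simp
  · refine ⟨‖w‖⁻¹ • w, norm_smul_inv_norm hw0, r, hr, ?_⟩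
    rw [hy', geo, ← hra, ← hrb, smul_inv_smul₀ (norm_ne_zero_iff.2 hw0)]

theorem gdist_geo {x : Ambient n} (hx : x ∈ space g n) {u : EuclideanSpace ℝ (Fin n)}
    (hu : ‖u‖ = 1) {r : ℝ} (hr : r ∈ radialRange g) : gdist g x (geo g x u r) = r := by
  have h : pairing g x (geo g x u r) = kap g * cs g r := by
    have := pairing_geo_geo (g := g) hu x 0 r
    rwa [geo_zero hx, zero_sub, cs_neg] at this
  cases g
  · rw [gdist, h, kap, one_mul]; exact Real.arccos_cos hr.1 hr.2
  · rw [gdist, h, kap, neg_one_mul, neg_neg]; exact Real.arcosh_cosh hr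

theorem force_geo {x : Ambient n} (hx : x ∈ space g n) {u : EuclideanSpace ℝ (Fin n)}
    (hu : ‖u‖ = 1) {r : ℝ} (hr : r ∈ radialRange g) (hs : sn g r ≠ 0) :
    force g x (geo g x u r) = (sn g r ^ (n - 1))⁻¹ • refl g x (cons 0 u) := by
  rw [force, direction, gdist_geo hx hu hr, geo_eq hx, add_sub_cancel_left, inv_smul_smul₀ hs]

end Geodesics

/-! ### Restriction of a homogeneous polynomial to a geodesic. -/

section Profiles

open Set Polynomial

theorem eval_mul_of_isHomogeneous {σ R : Type*} [Fintype σ] [CommRing R]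
    {p : MvPolynomial σ R} {d : ℕ} (hp : p.IsHomogeneous d) (c : R) (x : σ → R) :
    MvPolynomial.eval (fun i => c * x i) p = c ^ d * MvPolynomial.eval x p := by
  rw [MvPolynomial.eval_eq', MvPolynomial.eval_eq', Finset.mul_sum]
  refine Finset.sum_congr rfl fun m hm => ?_
  have hdeg : ∑ i, m i = d := by
    have := hp (MvPolynomial.mem_support_iff.1 hm)
    rw [Finsupp.weight_apply, Finsupp.sum_fintype _ _ (by simp)] at this
    simpa using this
  simp only [mul_pow, Finset.prod_mul_distrib, Finset.prod_pow_eq_pow_sum, hdeg]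
  ring

variable {n d : ℕ} {g : Geometry} {p : MvPolynomial (Fin (n + 1)) ℝ}

/-- The function on the ambient space defined by a polynomial. -/
noncomputable def pol (p : MvPolynomial (Fin (n + 1)) ℝ) (y : Ambient n) : ℝ :=
  MvPolynomial.eval y.ofLp p

theorem pol_smul (hp : p.IsHomogeneous d) (c : ℝ) (y : Ambient n) :
    pol p (c • y) = c ^ d * pol p y :=
  eval_mul_of_isHomogeneous hp c y.ofLp

theorem contDiff_pol (p : MvPolynomial (Fin (n + 1)) ℝ) : ContDiff ℝ 1 (pol p) := by
  have h : ContDiff ℝ 1 fun x : Fin (n + 1) → ℝ => MvPolynomial.eval x p :=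
    (AnalyticOnNhd.eval_mvPolynomial p).contDiff
  exact h.comp (PiLp.contDiff_ofLp)

theorem continuous_pol (p : MvPolynomial (Fin (n + 1)) ℝ) : Continuous (pol p) :=
  (contDiff_pol p).continuous

/-- The derivative of `pol p` along a geodesic. -/
noncomputable def slope (g : Geometry) (p : MvPolynomial (Fin (n + 1)) ℝ) (x : Ambient n)
    (u : EuclideanSpace ℝ (Fin n)) (r : ℝ) : ℝ :=
  fderiv ℝ (pol p) (geo g x u r) (dgeo g x u r)

theorem hasDerivAt_profile (g : Geometry) (p : MvPolynomial (Fin (n + 1)) ℝ) (x : Ambient n)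
    (u : EuclideanSpace ℝ (Fin n)) (r : ℝ) :
    HasDerivAt (fun r => pol p (geo g x u r)) (slope g p x u r) r :=
  (((contDiff_pol p).differentiable one_ne_zero _).hasFDerivAt).comp_hasDerivAt r
    (hasDerivAt_geo x u r)

theorem deriv_profile (g : Geometry) (p : MvPolynomial (Fin (n + 1)) ℝ) (x : Ambient n)
    (u : EuclideanSpace ℝ (Fin n)) :
    deriv (fun r => pol p (geo g x u r)) = slope g p x u :=
  funext fun r => (hasDerivAt_profile g p x u r).deriv

theorem differentiable_profile (g : Geometry) (p : MvPolynomial (Fin (n + 1)) ℝ) (x : Ambient n)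
    (u : EuclideanSpace ℝ (Fin n)) : Differentiable ℝ fun r => pol p (geo g x u r) :=
  fun r => (hasDerivAt_profile g p x u r).differentiableAt

theorem continuous_fderiv_pol_apply (p : MvPolynomial (Fin (n + 1)) ℝ) :
    Continuous fun q : Ambient n × Ambient n => fderiv ℝ (pol p) q.1 q.2 :=
  ((contDiff_pol p).continuous_fderiv one_ne_zero).fst'.clm_apply continuous_snd

theorem continuous_slope (g : Geometry) (p : MvPolynomial (Fin (n + 1)) ℝ) (x : Ambient n) :
    Continuous fun q : EuclideanSpace ℝ (Fin n) × ℝ => slope g p x q.1 q.2 := by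
  have h1 : Continuous fun q : EuclideanSpace ℝ (Fin n) × ℝ => fderiv ℝ (pol p) (geo g x q.1 q.2) :=
    ((contDiff_pol p).continuous_fderiv one_ne_zero).comp (continuous_geo g x)
  exact h1.clm_apply (continuous_dgeo g x)

theorem continuous_deriv_profile (g : Geometry) (p : MvPolynomial (Fin (n + 1)) ℝ) (x : Ambient n)
    (u : EuclideanSpace ℝ (Fin n)) : Continuous (deriv fun r => pol p (geo g x u r)) := by
  rw [deriv_profile]
  have h : Continuous fun r : ℝ => (u, r) := by fun_prop
  have h2 := (continuous_slope g p x).comp h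
  simpa only [Function.comp_def] using h2

/-- A positive multiple (by the generalized sine of the distance) of the derivative of `pol p`
at `y` in the direction away from `x`. -/
noncomputable def away (g : Geometry) (p : MvPolynomial (Fin (n + 1)) ℝ) (x y : Ambient n) : ℝ :=
  fderiv ℝ (pol p) y ((kap g * pairing g x y) • y - x)

theorem away_geo_geo {u : EuclideanSpace ℝ (Fin n)} (hu : ‖u‖ = 1) (x : Ambient n) (r s : ℝ) :
    away g p (geo g x u s) (geo g x u r) = sn g (r - s) * slope g p x u r := by
  rw [away, pairing_comm, pairing_geo_geo hu, ← mul_assoc, kap_mul_self, one_mul, cs_smul_geo_sub,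
    map_smul, smul_eq_mul, slope]

theorem away_geo {x : Ambient n} (hx : x ∈ space g n) {u : EuclideanSpace ℝ (Fin n)}
    (hu : ‖u‖ = 1) (r : ℝ) : away g p x (geo g x u r) = sn g r * slope g p x u r := by
  have := away_geo_geo (g := g) (p := p) hu x r 0
  rwa [geo_zero hx, sub_zero] at this

theorem continuous_away (p : MvPolynomial (Fin (n + 1)) ℝ) (x : Ambient n) :
    Continuous (away g p x) := by
  refine (continuous_fderiv_pol_apply p).comp (continuous_id.prodMk ?_)
  exact ((continuous_const.mul (continuous_const.pairing continuous_id g)).smul continuous_id).sub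
    continuous_const

/-- With `z = exp(iθ)` one has `z (cos θ x + sin θ v) = z² (x - i v) / 2 + (x + i v) / 2`;
homogeneity turns the factor `z` into `z ^ d`. -/
theorem trigRep_profile (hp : p.IsHomogeneous d) {x : Ambient n} (hx : x ∈ space .spherical n)
    (u : EuclideanSpace ℝ (Fin n)) :
    ∃ Q, TrigRep (fun r => pol p (geo .spherical x u r)) d Q := by
  set v : Ambient n := refl .spherical x (cons 0 u)
  set φ : Fin (n + 1) → ℂ[X] := fun i => C (((x i : ℂ) - Complex.I * v i) / 2) * X ^ 2 +
    C (((x i : ℂ) + Complex.I * v i) / 2) with hφ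
  have hp' : (MvPolynomial.map Complex.ofRealHom p).IsHomogeneous d := hp.map _
  refine ⟨MvPolynomial.aeval φ (MvPolynomial.map Complex.ofRealHom p), ?_, fun θ => ?_⟩
  · rw [mul_comm]
    refine MvPolynomial.aeval_natDegree_le _ hp'.totalDegree_le _ fun i => ?_
    exact natDegree_add_le_of_degree_le (natDegree_C_mul_X_pow_le _ _)
      ((natDegree_C _).le.trans (by norm_num))
  · set z := Complex.exp (θ * Complex.I) with hz
    have hev : (MvPolynomial.aeval φ (MvPolynomial.map Complex.ofRealHom p)).eval z =
        MvPolynomial.eval (fun i => (φ i).eval z) (MvPolynomial.map Complex.ofRealHom p) := by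
      rw [MvPolynomial.eval_eq', MvPolynomial.aeval_def, MvPolynomial.eval₂_eq', eval_finsetSum]
      refine Finset.sum_congr rfl fun m _ => ?_
      rw [eval_mul, eval_prod]; simp
    have hcoord : ∀ i, (φ i).eval z = z * ((geo .spherical x u θ i : ℝ) : ℂ) := by
      intro i
      have hzz : z = Complex.cos θ + Complex.sin θ * Complex.I := by
        rw [hz, Complex.exp_mul_I]
      have hg : geo .spherical x u θ i = Real.cos θ * x i + Real.sin θ * v i := by
        rw [geo_eq hx]; rfl
      have h1 := Complex.cos_sq_add_sin_sq θ
      rw [hg, hφ]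
      simp only [eval_add, eval_mul, eval_C, eval_pow, eval_X]
      push_cast
      rw [hzz]
      linear_combination (((x i : ℂ) + Complex.I * v i) / 2) * (-h1) +
        ((x i : ℂ) * Complex.sin θ ^ 2 / 2 - Complex.I * v i * Complex.sin θ ^ 2 / 2 -
          v i * Complex.cos θ * Complex.sin θ) * Complex.I_sq
    rw [hev, funext hcoord, eval_mul_of_isHomogeneous hp', mul_comm]
    congr 1
    rw [MvPolynomial.eval_map]
    exact (MvPolynomial.eval₂_comp_left Complex.ofRealHom (RingHom.id ℝ) _ p).symm

/-- The restriction of `p` to the affine line through `b` with direction `a`. -/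
noncomputable def linePoly (p : MvPolynomial (Fin (n + 1)) ℝ) (a b : Ambient n) : ℝ[X] :=
  MvPolynomial.aeval (fun i => C (a i) * X + C (b i)) p

theorem eval_linePoly (p : MvPolynomial (Fin (n + 1)) ℝ) (a b : Ambient n) (s : ℝ) :
    (linePoly p a b).eval s = pol p (s • a + b) := by
  rw [linePoly, pol, MvPolynomial.eval_eq', MvPolynomial.aeval_def, MvPolynomial.eval₂_eq',
    eval_finsetSum]
  refine Finset.sum_congr rfl fun m _ => ?_
  rw [eval_mul, eval_prod]
  simp only [algebraMap_eq, eval_C, eval_pow, eval_add, eval_mul, eval_X, PiLp.add_apply,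
    PiLp.smul_apply, smul_eq_mul, mul_comm]

theorem natDegree_linePoly_le (hp : p.IsHomogeneous d) (a b : Ambient n) :
    (linePoly p a b).natDegree ≤ d := by
  have := MvPolynomial.aeval_natDegree_le p hp.totalDegree_le
    (fun i => C (a i) * X + C (b i)) (n := 1) fun i => natDegree_linear_le
  rwa [mul_one] at this

theorem coeff_zero_linePoly (p : MvPolynomial (Fin (n + 1)) ℝ) (a b : Ambient n) :
    (linePoly p a b).coeff 0 = pol p b := by
  rw [coeff_zero_eq_eval_zero, eval_linePoly, zero_smul, zero_add]

/-- By homogeneity, exchanging `a` and `b` reverses the order of the coefficients, so the top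
coefficient is a constant coefficient. -/
theorem coeff_linePoly (hp : p.IsHomogeneous d) (a b : Ambient n) :
    (linePoly p a b).coeff d = pol p a := by
  have h : linePoly p a b = reflect d (linePoly p b a) := by
    refine eq_of_infinite_eval_eq _ _ ((Set.finite_singleton (0 : ℝ)).infinite_compl.mono ?_)
    intro s hs
    have hs : s ≠ 0 := hs
    let _ := invertibleOfNonzero (inv_ne_zero hs)
    have h1 := eval₂_reflect_mul_pow (RingHom.id ℝ) s⁻¹ d (linePoly p b a)
      (natDegree_linePoly_le hp b a)
    rw [invOf_eq_inv, inv_inv] at h1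
    change eval s _ * _ = eval s⁻¹ _ at h1
    change eval s _ = eval s _
    rw [eval_linePoly] at h1 ⊢
    have h2 : s • a + b = s • (s⁻¹ • b + a) := by
      rw [smul_add, smul_inv_smul₀ hs, add_comm]
    rw [h2, pol_smul hp, ← h1, inv_pow]
    field_simp
  rw [h, coeff_reflect, revAt_le le_rfl, Nat.sub_self, coeff_zero_linePoly]

/-- Before reflection, `exp r (cosh r, sinh r u)` equals `exp(2r) (1, u) / 2 + (1, -u) / 2`. The
extreme coefficients are thus values of `p` at opposite lightlike directions. -/
theorem eval_linePoly_exp (hp : p.IsHomogeneous d) (x : Ambient n)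
    (u : EuclideanSpace ℝ (Fin n)) (r : ℝ) :
    (linePoly p ((1 / 2 : ℝ) • refl .hyperbolic x (cons 1 u))
      ((1 / 2 : ℝ) • refl .hyperbolic x (cons 1 (-u)))).eval (Real.exp (2 * r)) =
      pol p (geo .hyperbolic x u r) * Real.exp r ^ d := by
  rw [eval_linePoly, mul_comm (pol p _), ← pol_smul hp, geo, ← map_smul, ← map_smul, ← map_smul, ← map_smul,
    ← map_add, smul_cons, smul_cons, smul_cons, smul_cons, cons_add]
  have h2 : Real.exp (2 * r) = Real.exp r * Real.exp r := by rw [← Real.exp_add]; ring_nf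
  have h3 : Real.exp r * Real.exp (-r) = 1 := by rw [← Real.exp_add]; simp
  congr 2
  congr 1
  · change _ = Real.exp r * Real.cosh r
    rw [Real.cosh_eq, h2]; linear_combination -h3 / 2
  · change _ = Real.exp r • Real.sinh r • u
    rw [smul_neg, smul_smul, smul_smul, ← sub_eq_add_neg, ← sub_smul, Real.sinh_eq, h2]
    congr 1; linear_combination h3 / 2

theorem expRep_profile {m : ℕ} (hp : p.IsHomogeneous (2 * m)) (x : Ambient n)
    (u : EuclideanSpace ℝ (Fin n)) :
    ExpRep (fun r => pol p (geo .hyperbolic x u r)) m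
      (linePoly p ((1 / 2 : ℝ) • refl .hyperbolic x (cons 1 u))
        ((1 / 2 : ℝ) • refl .hyperbolic x (cons 1 (-u)))) := by
  refine ⟨natDegree_linePoly_le hp _ _, fun r => ?_⟩
  rw [eval_linePoly_exp hp, pow_mul, sq, ← Real.exp_add, two_mul]

end Profiles

/-! ### Consequences of hyperbolicity: parity, transversality, compactness. -/

section Domains

open Set Polynomial

variable {n d : ℕ} {g : Geometry} {p : MvPolynomial (Fin (n + 1)) ℝ}

/-- The unit sphere is connected when `n ≥ 2`. With `v = -u` this excludes nonvanishing functions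
that change sign under the antipodal map. -/
theorem pos_mul_of_ne_zero_on_sphere (hn : 2 ≤ n) {h : EuclideanSpace ℝ (Fin n) → ℝ}
    (hc : Continuous h) (hne : ∀ u, ‖u‖ = 1 → h u ≠ 0) {u v : EuclideanSpace ℝ (Fin n)}
    (hu : ‖u‖ = 1) (hv : ‖v‖ = 1) : 0 < h u * h v := by
  have hrank : 1 < Module.rank ℝ (EuclideanSpace ℝ (Fin n)) := by
    rw [rank_eq_card_basis (EuclideanSpace.basisFun (Fin n) ℝ).toBasis, Fintype.card_fin]
    exact_mod_cast hn
  have hconn := isPreconnected_sphere hrank (0 : EuclideanSpace ℝ (Fin n)) 1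
  have key : ∀ a b : EuclideanSpace ℝ (Fin n), ‖a‖ = 1 → ‖b‖ = 1 → h a < 0 → 0 < h b → False := by
    intro a b ha hb h1 h2
    obtain ⟨c, hcs, hc0⟩ := hconn.intermediate_value (mem_sphere_zero_iff_norm.2 ha)
      (mem_sphere_zero_iff_norm.2 hb) hc.continuousOn ⟨h1.le, h2.le⟩
    exact hne c (mem_sphere_zero_iff_norm.1 hcs) hc0
  rcases lt_or_gt_of_ne (hne u hu) with h1 | h1 <;> rcases lt_or_gt_of_ne (hne v hv) with h2 | h2
  · exact mul_pos_of_neg_of_neg h1 h2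
  · exact (key u v hu hv h1 h2).elim
  · exact (key v u hv hu h2 h1).elim
  · exact mul_pos h1 h2

/-- A fundamental domain for the parameter of a geodesic. -/
def fullRange (g : Geometry) : Set ℝ :=
  match g with
  | .spherical => Ioc (-Real.pi) Real.pi
  | .hyperbolic => univ

theorem eq_of_cs_sn {r s : ℝ} (hr : r ∈ fullRange g) (hs : s ∈ fullRange g)
    (h1 : cs g r = cs g s) (h2 : sn g r = sn g s) : r = s := by
  cases g
  · refine eq_of_sub_lt_two_pi ?_ (by linarith [hr.2, hs.1]) (by linarith [hr.1, hs.2])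
    have h1' : Real.cos r = Real.cos s := h1
    have h2' : Real.sin r = Real.sin s := h2
    rw [Complex.exp_mul_I, Complex.exp_mul_I, ← Complex.ofReal_cos, ← Complex.ofReal_sin, h1', h2']
    simp
  · exact Real.sinh_injective h2

theorem exists_mem_fullRange {a b : ℝ} (h : kap g * a ^ 2 + b ^ 2 = kap g)
    (ha : g = .hyperbolic → 0 < a) : ∃ r ∈ fullRange g, a = cs g r ∧ b = sn g r := by
  obtain ⟨r, hr, hra, hrb⟩ := exists_cs_sn (by rwa [sq_abs]) (abs_nonneg b) ha
  rcases le_or_gt 0 b with hb | hb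
  · rw [abs_of_nonneg hb] at hrb
    refine ⟨r, ?_, hra, hrb⟩
    cases g
    · exact ⟨by linarith [hr.1, Real.pi_pos], hr.2⟩
    · trivial
  · rw [abs_of_neg hb] at hrb
    refine ⟨-r, ?_, by rw [cs_neg, hra], by rw [sn_neg, ← hrb, neg_neg]⟩
    cases g
    · refine ⟨neg_lt_neg (lt_of_le_of_ne hr.2 ?_), by linarith [hr.1, Real.pi_pos]⟩
      rintro rfl
      simp only [sn, Real.sin_pi] at hrb
      linarith
    · trivial

/-- The plane spanned by `x` and the initial velocity cuts the space in this geodesic, which is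
parametrized bijectively by `fullRange g`; points of the level set become roots. -/
theorem exists_roots {x : Ambient n} {c : ℝ} (hx : x ∈ hyperbolicityDomain g d p c)
    {u : EuclideanSpace ℝ (Fin n)} (hu : ‖u‖ = 1) :
    ∃ A : Finset ℝ, A.card = fullCount g d ∧
      ∀ t, t ∈ A ↔ t ∈ fullRange g ∧ pol p (geo g x u t) = c := by
  obtain ⟨hxs, -, hL⟩ := hx
  have hxx := (mem_space_iff.1 hxs).1
  set v : Ambient n := refl g x (cons 0 u) with hv
  have hxv : pairing g x v = 0 := by rw [hv, kap_pairing_refl hxs]; simp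
  have hvv : pairing g v v = 1 := by
    rw [hv, pairing_refl_refl, pairing_cons, real_inner_self_eq_norm_sq, hu]; simp
  have hpx : ∀ a b : ℝ, pairing g x (a • x + b • v) = kap g * a := fun a b => by
    rw [pairing_add_right, pairing_smul_right, pairing_smul_right, hxx, hxv]; ring
  have hpv : ∀ a b : ℝ, pairing g v (a • x + b • v) = b := fun a b => by
    rw [pairing_add_right, pairing_smul_right, pairing_smul_right, pairing_comm g v x, hxv, hvv]
    ring
  have hli : LinearIndependent ℝ ![x, v] := by
    rw [LinearIndependent.pair_iff]
    intro a b hab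
    have h1 := hpx a b
    have h2 := hpv a b
    have h0 : ∀ z : Ambient n, pairing g z 0 = 0 := fun z => by
      rw [← zero_smul ℝ (0 : Ambient n), pairing_smul_right, zero_mul]
    rw [hab, h0] at h1 h2
    exact ⟨(mul_eq_zero.1 h1.symm).resolve_left (kap_ne_zero g), h2.symm⟩
  have hspan : Submodule.span ℝ (range ![x, v]) = Submodule.span ℝ {x, v} := by
    rw [Matrix.range_cons, Matrix.range_cons, Matrix.range_empty, union_empty,
      singleton_union]
  have hcard := hL (Submodule.span ℝ {x, v})
    (by rw [← hspan, finrank_span_eq_card hli, Fintype.card_fin])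
    (Submodule.subset_span (mem_insert _ _))
  set T : Set ℝ := {t | t ∈ fullRange g ∧ pol p (geo g x u t) = c} with hT
  have hinj : InjOn (geo g x u) T := by
    intro r hr s hs hrs
    rw [geo_eq hxs, geo_eq hxs] at hrs
    have h1 := hpx (cs g r) (sn g r)
    have h2 := hpv (cs g r) (sn g r)
    rw [hrs, hpx] at h1
    rw [hrs, hpv] at h2
    exact eq_of_cs_sn hr.1 hs.1 (mul_left_cancel₀ (kap_ne_zero g) h1.symm) h2.symm
  have himage : geo g x u '' T = levelSet g p c ∩ (Submodule.span ℝ {x, v} : Set (Ambient n)) := by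
    ext y
    constructor
    · rintro ⟨t, ht, rfl⟩
      refine ⟨⟨geo_mem_space hxs hu t, ht.2⟩, ?_⟩
      rw [geo_eq hxs]
      exact Submodule.mem_span_pair.2 ⟨_, _, rfl⟩
    · rintro ⟨⟨hy, hyc⟩, hyL⟩
      obtain ⟨a, b, rfl⟩ := Submodule.mem_span_pair.1 hyL
      have h1 := (mem_space_iff.1 hy).1
      rw [pairing_add_left, pairing_smul_left, pairing_smul_left, hpx, hpv] at h1
      obtain ⟨r, hr, rfl, rfl⟩ := exists_mem_fullRange (a := a) (b := b) (g := g)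
        (by linear_combination h1) (by
          rintro rfl
          have := pairing_neg_of_mem hxs hy
          rw [hpx, kap] at this
          linarith)
      refine ⟨r, ⟨hr, ?_⟩, geo_eq hxs u r⟩
      rw [geo_eq hxs]; exact hyc
  rw [← himage, hinj.encard_image] at hcard
  have hfin : T.Finite := finite_of_encard_eq_coe hcard
  refine ⟨hfin.toFinset, ?_, fun t => hfin.mem_toFinset⟩
  rw [hfin.encard_eq_coe_toFinset_card] at hcard
  exact_mod_cast hcard

theorem continuous_pol_lightlike (p : MvPolynomial (Fin (n + 1)) ℝ) (g : Geometry) (x : Ambient n) :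
    Continuous fun w => pol p (refl g x (cons 1 w)) :=
  (continuous_pol p).comp ((continuous_refl x).comp
    (continuous_cons.comp (continuous_const.prodMk continuous_id)))

/-- For odd `d`, Vieta with `d` positive roots gives the extreme coefficients opposite signs. These
are multiples of the values of `p` at the lightlike vectors over `u` and `-u`, so a nonvanishing
continuous function on the sphere of directions would change sign. -/
theorem even_of_hyperbolicityDomain_nonempty (hn : 2 ≤ n) (hd : 2 ≤ d) (hp : p.IsHomogeneous d)
    (h : (hyperbolicityDomain .hyperbolic d p 0).Nonempty) : Even d := by
  classical
  obtain ⟨x, hx⟩ := h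
  by_contra hodd
  rw [Nat.not_even_iff_odd] at hodd
  have key : ∀ u : EuclideanSpace ℝ (Fin n), ‖u‖ = 1 →
      pol p (refl .hyperbolic x (cons 1 u)) * pol p (refl .hyperbolic x (cons 1 (-u))) < 0 := by
    intro u hu
    obtain ⟨A, hAc, hA⟩ := exists_roots hx hu
    set Q := linePoly p ((1 / 2 : ℝ) • refl .hyperbolic x (cons 1 u))
      ((1 / 2 : ℝ) • refl .hyperbolic x (cons 1 (-u))) with hQ
    have hinj : InjOn (fun r : ℝ => Real.exp (2 * r)) (A : Set ℝ) := exp_two_mul_injective.injOn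
    obtain ⟨r, hr⟩ := Infinite.exists_notMem_finset A
    obtain ⟨h1, h2⟩ := coeff_mul_prod_neg_roots (Q := Q) (N := d) (m := 1) (e := 0)
      (natDegree_linePoly_le hp _ _) one_pos (by omega)
      (Z := A.image fun t : ℝ => Real.exp (2 * t))
      (by rw [Finset.card_image_of_injOn hinj, hAc]; rfl)
      (by
        intro z hz
        obtain ⟨t, ht, rfl⟩ := Finset.mem_image.1 hz
        rw [eval_linePoly_exp hp, ((hA t).1 ht).2]; ring)
      ⟨Real.exp (2 * r), by
        rw [eval_linePoly_exp hp, zero_mul]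
        exact mul_ne_zero (fun h0 => hr ((hA r).2 ⟨trivial, h0⟩))
          (pow_ne_zero _ (Real.exp_ne_zero _))⟩
    rw [Finset.prod_image hinj, Finset.prod_neg, hAc] at h2
    have hfc : fullCount .hyperbolic d = d := rfl
    rw [hfc, hodd.neg_one_pow, ← Real.exp_sum, coeff_zero_linePoly, coeff_linePoly hp, pol_smul hp,
      pol_smul hp] at h2
    rw [coeff_linePoly hp, pol_smul hp] at h1
    set a := pol p (refl .hyperbolic x (cons 1 u))
    set b := pol p (refl .hyperbolic x (cons 1 (-u)))
    have ha : a ≠ 0 := right_ne_zero_of_mul h1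
    have hpos := Real.exp_pos (∑ x ∈ A, 2 * x)
    have hb : b = -(a * Real.exp (∑ x ∈ A, 2 * x)) := by
      refine mul_left_cancel₀ (pow_ne_zero d (by norm_num : (1 / 2 : ℝ) ≠ 0)) ?_
      rw [← h2]; ring
    have : 0 < a * a := mul_self_pos.2 ha
    rw [hb]
    nlinarith [mul_pos this hpos]
  obtain ⟨u, hu⟩ := exists_unit (n := n) (by omega)
  have h1 := pos_mul_of_ne_zero_on_sphere hn
    (continuous_pol_lightlike p .hyperbolic x)
    (fun w hw h0 => by have := key w hw; rw [h0, zero_mul] at this; exact lt_irrefl _ this) hu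
    (by rwa [norm_neg] : ‖-u‖ = 1)
  exact lt_asymm h1 (key u hu)

/-- The hypotheses on a layer: `p` is homogeneous of degree `d`, which is even in the hyperbolic
case, and `x` lies in the hyperbolicity domain of the layer. -/
structure InDomain (g : Geometry) (d : ℕ) (p : MvPolynomial (Fin (n + 1)) ℝ) (ε₁ ε₂ : ℝ)
    (x : Ambient n) : Prop where
  two_le : 2 ≤ n
  two_le_degree : 2 ≤ d
  homogeneous : p.IsHomogeneous d
  even_degree : g = .hyperbolic → Even d
  lt : ε₁ < ε₂
  mem₁ : x ∈ hyperbolicityDomain g d p ε₁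
  mem₂ : x ∈ hyperbolicityDomain g d p ε₂

namespace InDomain

variable {ε₁ ε₂ : ℝ} {x : Ambient n} {u : EuclideanSpace ℝ (Fin n)}

theorem mem_space (h : InDomain g d p ε₁ ε₂ x) : x ∈ space g n := h.mem₁.1

theorem exists_fullCircle {c : ℝ} (hx : x ∈ hyperbolicityDomain .spherical d p c)
    (hu : ‖u‖ = 1) : ∃ A, FullCircle (fun r => pol p (geo .spherical x u r)) d c A :=
  exists_roots hx hu

theorem exists_fullLine {m : ℕ} {c : ℝ} (hx : x ∈ hyperbolicityDomain .hyperbolic (2 * m) p c)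
    (hu : ‖u‖ = 1) : ∃ A, FullLine (fun r => pol p (geo .hyperbolic x u r)) (2 * m) c A := by
  obtain ⟨A, h1, h2⟩ := exists_roots hx hu
  exact ⟨A, h1, fun t => (h2 t).trans ⟨fun ht => ht.2, fun ht => ⟨trivial, ht⟩⟩⟩

theorem slope_ne_zero (h : InDomain g d p ε₁ ε₂ x) (hu : ‖u‖ = 1) {r : ℝ}
    (hr : pol p (geo g x u r) ∈ Icc ε₁ ε₂) : slope g p x u r ≠ 0 := by
  rw [← deriv_profile]
  have hd := h.two_le_degree
  cases g
  · obtain ⟨A, hA⟩ := exists_fullCircle h.mem₁ hu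
    obtain ⟨B, hB⟩ := exists_fullCircle h.mem₂ hu
    obtain ⟨Q, hQ⟩ := trigRep_profile h.homogeneous h.mem_space u
    refine hQ.deriv_ne_zero (by omega) (differentiable_profile _ p x u) hA hB ?_ ?_ hr
    · rw [geo_zero h.mem_space]; exact h.mem₁.2.1
    · rw [geo_zero h.mem_space]; exact h.mem₂.2.1
  · obtain ⟨m, rfl⟩ := even_iff_exists_two_mul.1 (h.even_degree rfl)
    obtain ⟨A, hA⟩ := exists_fullLine h.mem₁ hu
    obtain ⟨B, hB⟩ := exists_fullLine h.mem₂ hu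
    exact (expRep_profile h.homogeneous x u).deriv_ne_zero (by omega)
      (differentiable_profile _ p x u) hA hB hr

theorem slope_eq_of_sn_eq_zero {r : ℝ} (hr : sn g r = 0) (u : EuclideanSpace ℝ (Fin n)) :
    slope g p x u r = fderiv ℝ (pol p) (refl g x (cons (cs g r) 0)) (refl g x (cons 0 (cs g r • u)))
      := by
  rw [slope, geo, dgeo, hr, zero_smul, mul_zero]

/-- Geodesics of all directions meet at `x`, and on the sphere at `-x`. If such a point were in the
layer, the slope there would be a nonvanishing function of the direction, yet it is odd. -/
theorem geo_notMem_of_sn_eq_zero (h : InDomain g d p ε₁ ε₂ x) (hu : ‖u‖ = 1) {r : ℝ}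
    (hr : sn g r = 0) : pol p (geo g x u r) ∉ Icc ε₁ ε₂ := by
  intro hcon
  have hgeo : ∀ v : EuclideanSpace ℝ (Fin n), geo g x v r = geo g x u r := fun v => by
    rw [geo, geo, hr, zero_smul, zero_smul]
  have hc : Continuous fun v => slope g p x v r := by
    have h1 : Continuous fun v : EuclideanSpace ℝ (Fin n) => (v, r) := by fun_prop
    have h2 := (continuous_slope g p x).comp h1
    simpa only [Function.comp_def] using h2
  have hpos := pos_mul_of_ne_zero_on_sphere h.two_le hc
    (fun v hv => h.slope_ne_zero hv (by rw [hgeo]; exact hcon)) hu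
    (by rwa [norm_neg] : ‖-u‖ = 1)
  have hneg : slope g p x (-u) r = -slope g p x u r := by
    rw [slope_eq_of_sn_eq_zero hr, slope_eq_of_sn_eq_zero hr, smul_neg]
    have : (cons 0 (-(cs g r • u)) : Ambient n) = -cons 0 (cs g r • u) := by
      rw [← neg_one_smul ℝ (cons _ _), smul_cons]; simp
    rw [this, map_neg, map_neg]
  simp only [hneg] at hpos
  nlinarith [mul_self_nonneg (slope g p x u r)]

theorem pol_self_notMem (h : InDomain g d p ε₁ ε₂ x) : pol p x ∉ Icc ε₁ ε₂ := by
  obtain ⟨u, hu⟩ := exists_unit (n := n) (by have := h.two_le; omega)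
  have := h.geo_notMem_of_sn_eq_zero hu (sn_zero g)
  rwa [geo_zero h.mem_space] at this

theorem mem_layer_iff {y : Ambient n} :
    y ∈ layer g p ε₁ ε₂ ↔ y ∈ space g n ∧ pol p y ∈ Icc ε₁ ε₂ := Iff.rfl

theorem away_ne_zero (h : InDomain g d p ε₁ ε₂ x) {y : Ambient n} (hy : y ∈ layer g p ε₁ ε₂) :
    away g p x y ≠ 0 := by
  obtain ⟨u, hu, r, hr, rfl⟩ := exists_eq_geo (by have := h.two_le; omega) h.mem_space hy.1
  rw [away_geo h.mem_space hu]
  exact mul_ne_zero (fun h0 => h.geo_notMem_of_sn_eq_zero hu h0 hy.2) (h.slope_ne_zero hu hy.2)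

theorem pol_lightlike_ne_zero {m : ℕ} (h : InDomain .hyperbolic (2 * m) p ε₁ ε₂ x)
    (hu : ‖u‖ = 1) : pol p (refl .hyperbolic x (cons 1 u)) ≠ 0 := by
  have hm := h.two_le_degree
  obtain ⟨A, hA⟩ := exists_fullLine h.mem₁ hu
  have := ((expRep_profile h.homogeneous x u).coeff_of_roots (by omega) hA).1
  rw [coeff_linePoly h.homogeneous, pol_smul h.homogeneous] at this
  exact right_ne_zero_of_mul this

/-- In the projective ball model a point is `cosh r` times a vector over `w` in the unit ball, with
`1 - ‖w‖² = 1 / cosh² r`. As `p` does not vanish over the boundary sphere, its values near infinity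
grow like `cosh r ^ d`. -/
theorem exists_cosh_bound (h : InDomain .hyperbolic d p ε₁ ε₂ x) :
    ∃ B : ℝ, ∀ u : EuclideanSpace ℝ (Fin n), ‖u‖ = 1 → ∀ r,
      pol p (geo .hyperbolic x u r) ∈ Icc ε₁ ε₂ → Real.cosh r ≤ B := by
  have hd := h.two_le_degree
  obtain ⟨m, hm⟩ := even_iff_exists_two_mul.1 (h.even_degree rfl)
  obtain ⟨u₀, hu₀⟩ := exists_unit (n := n) (by have := h.two_le; omega)
  -- The second term is positive inside the ball and the first one on its boundary, so `ψ` has a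
  -- positive minimum, which serves all directions at once.
  set ψ : EuclideanSpace ℝ (Fin n) → ℝ := fun w =>
    max |pol p (refl .hyperbolic x (cons 1 w))| (1 - ‖w‖ ^ 2) with hψ
  have hψc : Continuous ψ := (continuous_pol_lightlike p _ x).abs.max
    (continuous_const.sub (continuous_norm.pow 2))
  obtain ⟨w₀, hw₀, hmin⟩ := (isCompact_closedBall (0 : EuclideanSpace ℝ (Fin n)) 1).exists_isMinOn
    ⟨0, by simp⟩ hψc.continuousOn
  have hpos : 0 < ψ w₀ := by
    rcases eq_or_lt_of_le (mem_closedBall_zero_iff.1 hw₀) with h1 | h1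
    · refine lt_max_of_lt_left (abs_pos.2 ?_)
      subst hm
      exact h.pol_lightlike_ne_zero h1
    · refine lt_max_of_lt_right ?_
      nlinarith [norm_nonneg w₀]
  set c := ψ w₀
  set M := max |ε₁| |ε₂|
  refine ⟨max (1 / c) (M / c), fun u hu r hr => ?_⟩
  have ha := Real.one_le_cosh r
  set a := Real.cosh r with haa
  have ha0 : 0 < a := by linarith
  set w : EuclideanSpace ℝ (Fin n) := (Real.sinh r / a) • u with hw
  have hnw : ‖w‖ ^ 2 = 1 - 1 / a ^ 2 := by
    rw [hw, norm_smul, hu, mul_one, Real.norm_eq_abs, sq_abs, div_pow, Real.sinh_sq, ← haa]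
    field_simp
  have hgeo : geo .hyperbolic x u r = a • refl .hyperbolic x (cons 1 w) := by
    rw [← map_smul, smul_cons, mul_one, hw, smul_smul, mul_div_cancel₀ _ ha0.ne']; rfl
  have hwb : w ∈ Metric.closedBall (0 : EuclideanSpace ℝ (Fin n)) 1 := by
    rw [mem_closedBall_zero_iff]
    have : 0 < 1 / a ^ 2 := by positivity
    nlinarith [norm_nonneg w]
  have hcw : c ≤ ψ w := hmin hwb
  rcases le_max_iff.1 hcw with h1 | h1
  · refine le_max_of_le_right ?_
    rw [hgeo, pol_smul h.homogeneous] at hr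
    have h2 : |a ^ d * pol p (refl .hyperbolic x (cons 1 w))| ≤ M := abs_le_max_abs_abs hr.1 hr.2
    rw [abs_mul, abs_of_pos (pow_pos ha0 d)] at h2
    rw [le_div_iff₀ hpos]
    have h3 : a ≤ a ^ d := le_self_pow₀ ha (by omega)
    calc a * c ≤ a ^ d * c := by gcongr
      _ ≤ a ^ d * |pol p (refl .hyperbolic x (cons 1 w))| := by gcongr
      _ ≤ M := h2
  · refine le_max_of_le_left ?_
    rw [hnw, sub_sub_cancel] at h1
    rw [le_div_iff₀ hpos]
    rw [le_div_iff₀ (by positivity)] at h1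
    nlinarith

theorem exists_radius (h : InDomain .hyperbolic d p ε₁ ε₂ x) :
    ∃ B : ℝ, ∀ u : EuclideanSpace ℝ (Fin n), ‖u‖ = 1 → ∀ r,
      pol p (geo .hyperbolic x u r) ∈ Icc ε₁ ε₂ → |r| < B := by
  obtain ⟨B, hB⟩ := h.exists_cosh_bound
  refine ⟨B, fun u hu r hr => lt_of_lt_of_le ?_ (hB u hu r hr)⟩
  rw [← Real.cosh_abs]
  exact (Real.self_le_sinh_iff.2 (abs_nonneg r)).trans_lt (Real.sinh_lt_cosh _)

theorem isClosed_space (g : Geometry) (n : ℕ) : IsClosed (space g n) := by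
  cases g
  · exact Metric.isClosed_sphere
  -- The strict inequality may be relaxed, since `y 0 = 0` would give a nonnegative square.
  · have : space .hyperbolic n = {y : Ambient n | pairing .hyperbolic y y = -1 ∧ 0 ≤ y 0} := by
      ext y
      refine ⟨fun hy => ⟨hy.1, hy.2.le⟩, fun hy => ⟨hy.1, lt_of_le_of_ne hy.2 fun h0 => ?_⟩⟩
      have h1 := hy.1
      obtain ⟨w, hw⟩ := exists_eq_cons y
      rw [hw, pairing_cons, real_inner_self_eq_norm_sq, ← h0] at h1
      nlinarith [sq_nonneg ‖w‖]
    rw [this]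
    have hc0 : Continuous fun y : Ambient n => y 0 := by fun_prop
    exact (isClosed_eq (continuous_id.pairing continuous_id _) continuous_const).inter
      (isClosed_le continuous_const hc0)

theorem isClosed_layer (g : Geometry) (p : MvPolynomial (Fin (n + 1)) ℝ) (ε₁ ε₂ : ℝ) :
    IsClosed (layer g p ε₁ ε₂) :=
  (isClosed_space g n).inter (isClosed_Icc.preimage (continuous_pol p))

theorem isCompact_layer (h : InDomain g d p ε₁ ε₂ x) : IsCompact (layer g p ε₁ ε₂) := by
  cases g
  · exact (isCompact_sphere (0 : Ambient n) 1).of_isClosed_subset (isClosed_layer _ p ε₁ ε₂)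
      fun y hy => hy.1
  · obtain ⟨B, hB⟩ := h.exists_radius
    have hK : IsCompact ((fun q : EuclideanSpace ℝ (Fin n) × ℝ => geo .hyperbolic x q.1 q.2) ''
        (Metric.sphere 0 1 ×ˢ Icc (-B) B)) :=
      ((isCompact_sphere _ _).prod isCompact_Icc).image (continuous_geo _ x)
    refine hK.of_isClosed_subset (isClosed_layer _ p ε₁ ε₂) fun y hy => ?_
    obtain ⟨u, hu, r, -, rfl⟩ := exists_eq_geo (by have := h.two_le; omega) h.mem_space hy.1
    have := abs_lt.1 (hB u hu r hy.2)
    exact ⟨(u, r), ⟨mem_sphere_zero_iff_norm.2 hu, this.1.le, this.2.le⟩, rfl⟩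

/-- The open fundamental domain for the parameter of a geodesic. -/
def _root_.ConstCurv.openRange (g : Geometry) : Set ℝ :=
  match g with
  | .spherical => Ioo (-Real.pi) Real.pi
  | .hyperbolic => univ

theorem integral_sign_slope (h : InDomain g d p ε₁ ε₂ x) (hu : ‖u‖ = 1) :
    ∫ r in {r | r ∈ openRange g ∧ pol p (geo g x u r) ∈ Icc ε₁ ε₂}, Real.sign (slope g p x u r)
      = 0 := by
  have hd := h.two_le_degree
  rw [← deriv_profile]
  cases g
  · obtain ⟨A, hA⟩ := exists_fullCircle h.mem₁ hu
    obtain ⟨B, hB⟩ := exists_fullCircle h.mem₂ hu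
    obtain ⟨Q, hQ⟩ := trigRep_profile h.homogeneous h.mem_space u
    have hpi : ∀ r, r = Real.pi ∨ r = -Real.pi → pol p (geo .spherical x u r) ∉ Icc ε₁ ε₂ := by
      rintro r (rfl | rfl) <;> exact h.geo_notMem_of_sn_eq_zero hu (by simp [sn])
    have := hQ.integral_sign_deriv_eq_zero (by omega) (differentiable_profile _ p x u)
      (continuous_deriv_profile _ p x u) h.lt hA hB
      (by rw [geo_zero h.mem_space]; exact h.mem₁.2.1)
      (by rw [geo_zero h.mem_space]; exact h.mem₂.2.1) (hpi _ (Or.inl rfl))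
    rw [← this]
    congr 2
    ext r
    refine ⟨fun hr => ⟨⟨hr.1.1.le, hr.1.2.le⟩, hr.2⟩, fun hr =>
      ⟨⟨lt_of_le_of_ne hr.1.1 fun h0 => ?_, lt_of_le_of_ne hr.1.2 fun h0 => ?_⟩, hr.2⟩⟩
    · exact hpi r (Or.inr h0.symm) hr.2
    · exact hpi r (Or.inl h0) hr.2
  · obtain ⟨m, rfl⟩ := even_iff_exists_two_mul.1 (h.even_degree rfl)
    obtain ⟨A, hA⟩ := exists_fullLine h.mem₁ hu
    obtain ⟨B, hB⟩ := exists_fullLine h.mem₂ hu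
    obtain ⟨R, hR⟩ := h.exists_radius
    have := (expRep_profile h.homogeneous x u).integral_sign_deriv_eq_zero (by omega)
      (differentiable_profile _ p x u) (continuous_deriv_profile _ p x u) h.lt hA hB (hR u hu)
    rw [← this]
    congr 2
    ext r
    exact ⟨fun hr => hr.2, fun hr => ⟨trivial, hr⟩⟩

end InDomain

end Domains

/-! ### Rays meeting a transversal strip: connectedness in the direction. -/

section FirstHit

open Set Filter Topology

/-- If the strip `e₁ ≤ F ≤ e₂` is transversal to the rays `{u} × [0, R]`, then the set of the rays
that meet a given open and closed part of it is open and closed. -/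
theorem exists_hit_of_exists_hit {E : Type*} [TopologicalSpace E] [T2Space E] {W : Set E}
    (hW : IsPreconnected W) (hWc : IsCompact W) {F G : E × ℝ → ℝ} (hF : Continuous F)
    (hG : Continuous G) {e₁ e₂ R : ℝ}
    (hint : ∀ u ∈ W, ∀ r ∈ Icc 0 R, F (u, r) ∈ Icc e₁ e₂ → r ∈ Ioo 0 R)
    (hG0 : ∀ u ∈ W, ∀ r ∈ Icc 0 R, F (u, r) ∈ Icc e₁ e₂ → G (u, r) ≠ 0)
    (happ : ∀ u ∈ W, ∀ r ∈ Icc 0 R, F (u, r) ∈ Icc e₁ e₂ → ∃ᶠ s in 𝓝 r, F (u, s) ∈ Ioo e₁ e₂)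
    {u₁ : E} (hu₁ : u₁ ∈ W) {r₁ : ℝ} (hr₁ : r₁ ∈ Icc 0 R) (hF₁ : F (u₁, r₁) ∈ Icc e₁ e₂)
    (hG₁ : 0 < G (u₁, r₁)) :
    ∀ u ∈ W, ∃ r ∈ Icc 0 R, F (u, r) ∈ Ioo e₁ e₂ ∧ 0 < G (u, r) := by
  -- Strict conditions make `O` open, weak ones make `V` closed by compactness. Transversality makes
  -- them coincide on `W`.
  set O : Set E := ⋃ r ∈ Icc 0 R, {u | F (u, r) ∈ Ioo e₁ e₂ ∧ 0 < G (u, r)} with hO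
  set V : Set E := Prod.fst '' (W ×ˢ Icc 0 R ∩ {q | F q ∈ Icc e₁ e₂ ∧ 0 ≤ G q}) with hV
  have hOo : IsOpen O := isOpen_biUnion fun r _ =>
    (isOpen_Ioo.preimage (hF.comp (Continuous.prodMk_left r))).inter
      (isOpen_Ioi.preimage (hG.comp (Continuous.prodMk_left r)))
  have hVc : IsClosed V := (((hWc.prod isCompact_Icc).inter_right
    ((isClosed_Icc.preimage hF).inter (isClosed_Ici.preimage hG))).image continuous_fst).isClosed
  have happ' : ∀ u ∈ W, ∀ r ∈ Icc 0 R, F (u, r) ∈ Icc e₁ e₂ → 0 < G (u, r) → u ∈ O := by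
    intro u hu r hr hFr hGr
    have h1 : ∀ᶠ s in 𝓝 r, s ∈ Ioo 0 R := isOpen_Ioo.mem_nhds (hint u hu r hr hFr)
    have h2 : ∀ᶠ s in 𝓝 r, 0 < G (u, s) :=
      (hG.comp (Continuous.prodMk_right u)).continuousAt.eventually (isOpen_Ioi.mem_nhds hGr)
    obtain ⟨s, hs, hs1, hs2⟩ := ((happ u hu r hr hFr).and_eventually (h1.and h2)).exists
    exact mem_iUnion₂.2 ⟨s, ⟨hs1.1.le, hs1.2.le⟩, hs, hs2⟩
  have hsub : W ⊆ O ∪ Vᶜ := by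
    intro u hu
    by_cases hv : u ∈ V
    · obtain ⟨⟨u', r⟩, ⟨hq, hFq, hGq⟩, rfl⟩ := hv
      exact Or.inl (happ' u' hu r hq.2 hFq (lt_of_le_of_ne hGq (hG0 u' hu r hq.2 hFq).symm))
    · exact Or.inr hv
  have hdisj : W ∩ (O ∩ Vᶜ) = ∅ := by
    rw [eq_empty_iff_forall_notMem]
    rintro u ⟨hu, ho, hv⟩
    obtain ⟨r, hr, hFr, hGr⟩ := mem_iUnion₂.1 ho
    exact hv ⟨(u, r), ⟨⟨hu, hr⟩, ⟨hFr.1.le, hFr.2.le⟩, hGr.le⟩, rfl⟩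
  have hW' : W ⊆ O := by
    rcases isPreconnected_iff_subset_of_disjoint.1 hW O Vᶜ hOo hVc.isOpen_compl hsub hdisj with
      h | h
    · exact h
    · exact absurd ⟨(u₁, r₁), ⟨⟨hu₁, hr₁⟩, hF₁, hG₁.le⟩, rfl⟩ (h hu₁)
  intro u hu
  obtain ⟨r, hr, h⟩ := mem_iUnion₂.1 (hW' hu)
  exact ⟨r, hr, h⟩

/-- The first point of the strip `e₁ ≤ F ≤ e₂` on the rays `{u} × [0, R]` stays in the part `0 < G`
or in the part `G < 0` of the strip, when the strip is transversal to the rays. -/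
theorem first_hit_dichotomy {E : Type*} [TopologicalSpace E] [T2Space E] {W : Set E}
    (hW : IsPreconnected W) (hWc : IsCompact W) {F G : E × ℝ → ℝ} (hF : Continuous F)
    (hG : Continuous G) {e₁ e₂ R : ℝ}
    (hint : ∀ u ∈ W, ∀ r ∈ Icc 0 R, F (u, r) ∈ Icc e₁ e₂ → r ∈ Ioo 0 R)
    (hG0 : ∀ u ∈ W, ∀ r ∈ Icc 0 R, F (u, r) ∈ Icc e₁ e₂ → G (u, r) ≠ 0)
    (happ : ∀ u ∈ W, ∀ r ∈ Icc 0 R, F (u, r) ∈ Icc e₁ e₂ → ∃ᶠ s in 𝓝 r, F (u, s) ∈ Ioo e₁ e₂)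
    (hne : ∀ u ∈ W, ∃ r ∈ Icc 0 R, F (u, r) ∈ Icc e₁ e₂) :
    (∀ u ∈ W, ∃ r ∈ Icc 0 R, F (u, r) ∈ Icc e₁ e₂ ∧ 0 ≤ G (u, r) ∧
      ∀ s ∈ Ico 0 r, ¬ (F (u, s) ∈ Ioo e₁ e₂ ∧ G (u, s) < 0)) ∨
    (∀ u ∈ W, ∃ r ∈ Icc 0 R, F (u, r) ∈ Icc e₁ e₂ ∧ G (u, r) ≤ 0 ∧
      ∀ s ∈ Ico 0 r, ¬ (F (u, s) ∈ Ioo e₁ e₂ ∧ 0 < G (u, s))) := by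
  -- The earlier points are tested with strict inequalities only, so that the condition is closed
  -- and survives projection along the compact interval.
  have closed : ∀ H : E × ℝ → ℝ, Continuous H →
      IsClosed (Prod.fst '' (W ×ˢ Icc 0 R ∩ {q : E × ℝ | F q ∈ Icc e₁ e₂ ∧ 0 ≤ H q ∧
        ∀ s ∈ Ico 0 q.2, ¬ (F (q.1, s) ∈ Ioo e₁ e₂ ∧ H (q.1, s) < 0)})) := by
    intro H hH
    have h1 : IsClosed {q : E × ℝ |
        ∀ s ∈ Ico 0 q.2, ¬ (F (q.1, s) ∈ Ioo e₁ e₂ ∧ H (q.1, s) < 0)} := by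
      have : {q : E × ℝ | ∀ s ∈ Ico 0 q.2, ¬ (F (q.1, s) ∈ Ioo e₁ e₂ ∧ H (q.1, s) < 0)} =
          ⋂ s ∈ Ici (0 : ℝ), {q : E × ℝ | s < q.2 ∧ F (q.1, s) ∈ Ioo e₁ e₂ ∧ H (q.1, s) < 0}ᶜ := by
        ext q
        simp only [mem_ofPred_eq, mem_Ico, mem_iInter, mem_Ici, mem_compl_iff]
        grind
      rw [this]
      refine isClosed_biInter fun s _ => IsOpen.isClosed_compl ?_
      have hs : Continuous fun q : E × ℝ => (q.1, s) := by fun_prop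
      exact (isOpen_lt continuous_const continuous_snd).inter
        ((isOpen_Ioo.preimage (hF.comp hs)).inter (isOpen_Iio.preimage (hH.comp hs)))
    exact (((hWc.prod isCompact_Icc).inter_right ((isClosed_Icc.preimage hF).inter
      ((isClosed_Ici.preimage hH).inter h1))).image continuous_fst).isClosed
  have hP := closed G hG
  have hN := closed (fun q => -G q) hG.neg
  set P : Set E := Prod.fst '' (W ×ˢ Icc 0 R ∩ {q : E × ℝ | F q ∈ Icc e₁ e₂ ∧ 0 ≤ G q ∧
        ∀ s ∈ Ico 0 q.2, ¬ (F (q.1, s) ∈ Ioo e₁ e₂ ∧ G (q.1, s) < 0)}) with hPdef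
  set N : Set E := Prod.fst '' (W ×ˢ Icc 0 R ∩ {q : E × ℝ | F q ∈ Icc e₁ e₂ ∧ 0 ≤ -G q ∧
        ∀ s ∈ Ico 0 q.2, ¬ (F (q.1, s) ∈ Ioo e₁ e₂ ∧ -G (q.1, s) < 0)}) with hNdef
  have hcover : W ⊆ P ∪ N := by
    intro u hu
    have hu' : Continuous fun r : ℝ => F (u, r) := hF.comp (Continuous.prodMk_right u)
    obtain ⟨r, hr, hmin⟩ := (isCompact_Icc.inter_right (isClosed_Icc.preimage hu')).exists_isLeast
      (hne u hu)
    have hnone : ∀ s ∈ Ico 0 r, F (u, s) ∉ Ioo e₁ e₂ := by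
      intro s hs hFs
      have := hmin ⟨⟨hs.1, hs.2.le.trans hr.1.2⟩, hFs.1.le, hFs.2.le⟩
      exact absurd hs.2 (not_lt.2 this)
    rcases le_total 0 (G (u, r)) with h | h
    · exact Or.inl ⟨(u, r), ⟨⟨hu, hr.1⟩, hr.2, h, fun s hs hc => hnone s hs hc.1⟩, rfl⟩
    · exact Or.inr ⟨(u, r), ⟨⟨hu, hr.1⟩, hr.2, neg_nonneg.2 h, fun s hs hc => hnone s hs hc.1⟩, rfl⟩
  -- A hit on the boundary of the strip can be moved slightly into its interior, keeping the sign of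
  -- `H` and staying before `r`.
  have aux : ∀ H : E × ℝ → ℝ, Continuous H → ∀ u ∈ W, ∀ r s, r ∈ Icc 0 R → s ∈ Icc 0 R →
      F (u, s) ∈ Icc e₁ e₂ → H (u, s) < 0 → s < r →
      ∃ t ∈ Ico 0 r, F (u, t) ∈ Ioo e₁ e₂ ∧ H (u, t) < 0 := by
    intro H hH u hu r s _ hs hFs hHs hsr
    have h1 : ∀ᶠ t in 𝓝 s, t ∈ Ioo 0 r := isOpen_Ioo.mem_nhds ⟨(hint u hu s hs hFs).1, hsr⟩
    have h2 : ∀ᶠ t in 𝓝 s, H (u, t) < 0 :=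
      (hH.comp (Continuous.prodMk_right u)).continuousAt.eventually (isOpen_Iio.mem_nhds hHs)
    obtain ⟨t, ht, ht1, ht2⟩ := ((happ u hu s hs hFs).and_eventually (h1.and h2)).exists
    exact ⟨t, ⟨ht1.1.le, ht1.2⟩, ht, ht2⟩
  have hdisj : W ∩ (P ∩ N) = ∅ := by
    rw [eq_empty_iff_forall_notMem]
    rintro u ⟨hu, ⟨⟨u', r⟩, ⟨hq, hF1, hG1, hall1⟩, h1⟩, ⟨⟨u'', s⟩, ⟨hq', hF2, hG2, hall2⟩, h2⟩⟩
    obtain rfl : u' = u := h1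
    obtain rfl : u'' = u' := h2
    have hG1' := lt_of_le_of_ne hG1 (hG0 _ hu r hq.2 hF1).symm
    have hG2' := lt_of_le_of_ne (neg_nonneg.1 hG2) (hG0 _ hu s hq'.2 hF2)
    rcases lt_trichotomy r s with h | h | h
    · obtain ⟨t, ht, ht'⟩ := aux (fun q => -G q) hG.neg _ hu s r hq'.2 hq.2 hF1
        (neg_lt_zero.2 hG1') h
      exact hall2 t ht ht'
    · rw [h] at hG1'; linarith
    · obtain ⟨t, ht, ht'⟩ := aux G hG _ hu r s hq.2 hq'.2 hF2 hG2' h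
      exact hall1 t ht ht'
  rcases isPreconnected_iff_subset_of_disjoint_closed.1 hW P N hP hN hcover hdisj with h | h
  · left
    intro u hu
    obtain ⟨⟨u', r⟩, ⟨hq, h1, h2, h3⟩, rfl⟩ := h hu
    exact ⟨r, hq.2, h1, h2, h3⟩
  · right
    intro u hu
    obtain ⟨⟨u', r⟩, ⟨hq, h1, h2, h3⟩, rfl⟩ := h hu
    exact ⟨r, hq.2, h1, neg_nonneg.1 h2, fun s hs hc => h3 s hs ⟨hc.1, neg_lt_zero.2 hc.2⟩⟩

end FirstHit

/-! ### The sign of the charge and its independence of the centre. -/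

section Signs

open Set Filter Topology

variable {n d : ℕ} {g : Geometry} {p : MvPolynomial (Fin (n + 1)) ℝ} {ε₁ ε₂ : ℝ}
  {x x₀ : Ambient n} {u : EuclideanSpace ℝ (Fin n)}

namespace InDomain

theorem exists_rayLength (h : InDomain g d p ε₁ ε₂ x) :
    ∃ R, Icc 0 R ⊆ radialRange g ∧ ∀ u : EuclideanSpace ℝ (Fin n), ‖u‖ = 1 →
      (∀ r ∈ radialRange g, pol p (geo g x u r) ∈ Icc ε₁ ε₂ → r ∈ Ioo 0 R) := by
  cases g
  · refine ⟨Real.pi, subset_rfl, fun u hu r hr hf => ⟨lt_of_le_of_ne hr.1 ?_, lt_of_le_of_ne hr.2 ?_⟩⟩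
    · rintro rfl
      exact h.geo_notMem_of_sn_eq_zero hu (sn_zero _) hf
    · rintro rfl
      exact h.geo_notMem_of_sn_eq_zero hu (by simp [sn]) hf
  · obtain ⟨B, hB⟩ := h.exists_radius
    refine ⟨B, fun r hr => hr.1, fun u hu r hr hf => ⟨lt_of_le_of_ne hr ?_, ?_⟩⟩
    · rintro rfl
      exact h.geo_notMem_of_sn_eq_zero hu (sn_zero _) hf
    · exact (le_abs_self r).trans_lt (hB u hu r hf)

theorem sn_pos (h : InDomain g d p ε₁ ε₂ x) (hu : ‖u‖ = 1) {r : ℝ} (hr : r ∈ radialRange g)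
    (hf : pol p (geo g x u r) ∈ Icc ε₁ ε₂) : 0 < sn g r :=
  lt_of_le_of_ne (sn_nonneg hr) fun h0 => h.geo_notMem_of_sn_eq_zero hu h0.symm hf

/-- Otherwise the profile would have a local extremum at `r`, contrary to its nonzero slope. -/
theorem frequently_mem_Ioo (h : InDomain g d p ε₁ ε₂ x) (hu : ‖u‖ = 1) {r : ℝ}
    (hf : pol p (geo g x u r) ∈ Icc ε₁ ε₂) :
    ∃ᶠ s in 𝓝 r, pol p (geo g x u s) ∈ Ioo ε₁ ε₂ := by
  intro hcon
  have hc : ContinuousAt (fun s => pol p (geo g x u s)) r :=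
    (differentiable_profile g p x u).continuous.continuousAt
  have hne := h.slope_ne_zero hu hf
  rw [← deriv_profile] at hne
  rcases eq_or_lt_of_le hf.1 with h1 | h1
  · have h2 : ∀ᶠ s in 𝓝 r, pol p (geo g x u s) < ε₂ :=
      hc.eventually (isOpen_Iio.mem_nhds (h1 ▸ h.lt : pol p (geo g x u r) < ε₂))
    have hmax : IsLocalMax (fun s => pol p (geo g x u s)) r := by
      filter_upwards [hcon, h2] with s hs1 hs2
      rw [← h1]
      by_contra hlt
      exact hs1 ⟨not_le.1 hlt, hs2⟩
    exact hne hmax.deriv_eq_zero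
  · have h2 : ∀ᶠ s in 𝓝 r, ε₁ < pol p (geo g x u s) := hc.eventually (isOpen_Ioi.mem_nhds h1)
    have hmin : IsLocalMin (fun s => pol p (geo g x u s)) r := by
      filter_upwards [hcon, h2] with s hs1 hs2
      by_contra hlt
      exact hs1 ⟨hs2, (not_le.1 hlt).trans_le hf.2⟩
    exact hne hmin.deriv_eq_zero

theorem geo_mem_layer_of_arc (h : InDomain g d p ε₁ ε₂ x) (hu : ‖u‖ = 1) {α r : ℝ} (hα : α ≤ r)
    (hall : ∀ τ ∈ Icc α r, pol p (geo g x u τ) ∈ Icc ε₁ ε₂) :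
    geo g x u α ∈ connectedComponentIn (layer g p ε₁ ε₂) (geo g x u r) := by
  have hpre : IsPreconnected (geo g x u '' Icc α r) :=
    isPreconnected_Icc.image _ fun t _ => (hasDerivAt_geo x u t).continuousAt.continuousWithinAt
  refine hpre.subset_connectedComponentIn ⟨r, ⟨hα, le_rfl⟩, rfl⟩ ?_ ⟨α, ⟨le_rfl, hα⟩, rfl⟩
  rintro _ ⟨τ, hτ, rfl⟩
  exact ⟨geo_mem_space h.mem_space hu τ, hall τ hτ⟩

/-- Moving towards `x` inside the layer, one reaches the level `ε₁` if the polynomial increases in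
the direction away from `x`, and the level `ε₂` if it decreases. -/
theorem exists_inner_end (h : InDomain g d p ε₁ ε₂ x) {z : Ambient n}
    (hz : z ∈ layer g p ε₁ ε₂) :
    ∃ a ∈ connectedComponentIn (layer g p ε₁ ε₂) z,
      (0 < away g p x z → pol p a = ε₁) ∧ (away g p x z < 0 → pol p a = ε₂) ∧
      gdist g x a ≤ gdist g x z ∧ (a ≠ z → gdist g x a < gdist g x z) := by
  obtain ⟨u, hu, r, hr, rfl⟩ := exists_eq_geo (by have := h.two_le; omega) h.mem_space hz.1
  have hr0 := nonneg_of_mem_radialRange hr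
  have hsn := h.sn_pos hu hr hz.2
  have hself : pol p (geo g x u 0) ∉ Icc ε₁ ε₂ := by
    rw [geo_zero h.mem_space]; exact h.pol_self_notMem
  have hK : ∀ τ ∈ Icc 0 r, pol p (geo g x u τ) ∈ Icc ε₁ ε₂ →
      deriv (fun r => pol p (geo g x u r)) τ ≠ 0 := by
    intro τ _ hτ
    rw [deriv_profile]; exact h.slope_ne_zero hu hτ
  have hradial : ∀ α ∈ Ioc 0 r, α ∈ radialRange g := by
    intro α hα
    cases g
    · exact ⟨hα.1.le, hα.2.trans hr.2⟩
    · exact hα.1.le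
  have key : ∀ α ∈ Ioc 0 r, gdist g x (geo g x u α) ≤ gdist g x (geo g x u r) ∧
      (geo g x u α ≠ geo g x u r → gdist g x (geo g x u α) < gdist g x (geo g x u r)) := by
    intro α hα
    rw [gdist_geo h.mem_space hu hr, gdist_geo h.mem_space hu (hradial α hα)]
    refine ⟨hα.2, fun hne => lt_of_le_of_ne hα.2 ?_⟩
    rintro rfl; exact hne rfl
  rw [away_geo h.mem_space hu]
  rcases lt_or_gt_of_ne (h.slope_ne_zero hu hz.2) with hs | hs
  · have hder : ∀ t, deriv (fun r => -pol p (geo g x u r)) t = -slope g p x u t := fun t => by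
      rw [deriv.fun_neg, deriv_profile]
    have hmem : ∀ t : ℝ, (-t ∈ Icc (-ε₂) (-ε₁)) ↔ t ∈ Icc ε₁ ε₂ := fun t => by
      simp only [mem_Icc, neg_le_neg_iff]; tauto
    obtain ⟨α, hα, hαe, hall⟩ := exists_left_end (f := fun r => -pol p (geo g x u r))
      (e₁ := -ε₂) (e₂ := -ε₁) (differentiable_profile g p x u).neg
      (by
        have := (continuous_deriv_profile g p x u).neg
        rw [deriv_profile] at this
        rw [funext hder]; exact this) hr0 (by rwa [hmem])
      (fun τ hτ hm => by
        rw [hder]; exact neg_ne_zero.2 (h.slope_ne_zero hu ((hmem _).1 hm)))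
      (by rw [hmem]; exact hz.2) (by rw [hder]; exact neg_pos.2 hs)
    refine ⟨_, h.geo_mem_layer_of_arc hu hα.2 fun τ hτ => (hmem _).1 (hall τ hτ).1,
      fun hpos => ?_, fun _ => neg_injective hαe, key α hα⟩
    nlinarith
  · obtain ⟨α, hα, hαe, hall⟩ := exists_left_end (differentiable_profile g p x u)
      (continuous_deriv_profile g p x u) hr0 hself hK hz.2 (by rw [deriv_profile]; exact hs)
    refine ⟨_, h.geo_mem_layer_of_arc hu hα.2 fun τ hτ => (hall τ hτ).1,
      fun _ => hαe, fun hneg => ?_, key α hα⟩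
    nlinarith

theorem gdist_le_gdist {y z : Ambient n} (hx : x ∈ space g n) (hy : y ∈ space g n)
    (hz : z ∈ space g n) (hyz : pairing g x z ≤ pairing g x y) : gdist g x y ≤ gdist g x z := by
  cases g
  · exact Real.arccos_le_arccos hyz
  · have h1 := pairing_neg_of_mem hx hy
    have h2 := pairing_neg_of_mem hx hz
    exact (Real.arcosh_le_arcosh (by linarith) (by linarith)).2 (by linarith)

theorem isClosed_component (y : Ambient n) (hy : y ∈ layer g p ε₁ ε₂) :
    IsClosed (connectedComponentIn (layer g p ε₁ ε₂) y) := by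
  refine isClosed_of_closure_subset ?_
  refine isPreconnected_connectedComponentIn.closure.subset_connectedComponentIn
    (subset_closure (mem_connectedComponentIn hy)) ?_
  exact closure_minimal (connectedComponentIn_subset _ _) (isClosed_layer g p ε₁ ε₂)

theorem away_mul_away_pos (h : InDomain g d p ε₁ ε₂ x) {y z : Ambient n}
    (hz : z ∈ connectedComponentIn (layer g p ε₁ ε₂) y) : 0 < away g p x y * away g p x z := by
  have hy : y ∈ layer g p ε₁ ε₂ := connectedComponentIn_nonempty_iff.1 ⟨z, hz⟩
  have hyK := mem_connectedComponentIn hy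
  have key : ∀ a b, a ∈ connectedComponentIn (layer g p ε₁ ε₂) y →
      b ∈ connectedComponentIn (layer g p ε₁ ε₂) y → away g p x a < 0 → 0 < away g p x b →
      False := by
    intro a b ha hb h1 h2
    obtain ⟨c, hcK, hc0⟩ := isPreconnected_connectedComponentIn.intermediate_value ha hb
      (continuous_away p x).continuousOn ⟨h1.le, h2.le⟩
    exact h.away_ne_zero (connectedComponentIn_subset _ _ hcK) hc0
  rcases lt_or_gt_of_ne (h.away_ne_zero hy) with h1 | h1 <;>
    rcases lt_or_gt_of_ne (h.away_ne_zero (connectedComponentIn_subset _ _ hz)) with h2 | h2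
  · exact mul_pos_of_neg_of_neg h1 h2
  · exact (key y z hyK hz h1 h2).elim
  · exact (key z y hz hyK h2 h1).elim
  · exact mul_pos h1 h2

/-- On a component the derivative away from `x` has a constant sign. Moving towards `x` from any of
its points ends, within the component, on `ε₁` if this sign is positive and on `ε₂` if it is
negative, so that level is the closer one. -/
theorem chargeSign_eq (h : InDomain g d p ε₁ ε₂ x) {y : Ambient n} (hy : y ∈ layer g p ε₁ ε₂) :
    chargeSign g p ε₁ ε₂ x y = Real.sign (away g p x y) := by
  set K := connectedComponentIn (layer g p ε₁ ε₂) y with hK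
  have hKS : K ⊆ layer g p ε₁ ε₂ := connectedComponentIn_subset _ _
  have hyK : y ∈ K := mem_connectedComponentIn hy
  have hKc : IsCompact K := h.isCompact_layer.of_isClosed_subset (isClosed_component y hy) hKS
  have hsign : ∀ z ∈ K, 0 < away g p x y * away g p x z := fun z hz => h.away_mul_away_pos hz
  have hcomp : ∀ z ∈ K, connectedComponentIn (layer g p ε₁ ε₂) z = K := fun z hz =>
    (connectedComponentIn_eq hz).symm
  rw [chargeSign]
  rcases lt_or_gt_of_ne (h.away_ne_zero hy) with hneg | hpos
  · rw [Real.sign_of_neg hneg, if_neg]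
    rintro ⟨a, ⟨haK, haL⟩, hall⟩
    have haway : away g p x a < 0 := by have := hsign a haK; nlinarith
    obtain ⟨b, hb, -, hb2, hb3, -⟩ := h.exists_inner_end (hKS haK)
    rw [hcomp a haK] at hb
    exact absurd (hall b ⟨hb, (hKS hb).1, hb2 haway⟩) (not_lt.2 hb3)
  · rw [Real.sign_of_pos hpos, if_pos]
    have hAc : IsCompact (K ∩ {z | pol p z = ε₁}) :=
      hKc.inter_right (isClosed_eq (continuous_pol p) continuous_const)
    obtain ⟨a₀, ha₀, ha₀1, -, -⟩ := h.exists_inner_end hy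
    -- In both geometries distance decreases as the pairing grows, so `a` is a nearest point of the
    -- level `ε₁`.
    obtain ⟨a, ⟨haK, hae⟩, hmax⟩ := hAc.exists_isMaxOn ⟨a₀, ha₀, ha₀1 hpos⟩
      (continuous_const.pairing continuous_id g : Continuous fun z => pairing g x z).continuousOn
    refine ⟨a, ⟨haK, (hKS haK).1, hae⟩, ?_⟩
    rintro b ⟨hbK, hbL⟩
    have haway : 0 < away g p x b := by have := hsign b hbK; nlinarith
    obtain ⟨a', ha', ha'1, -, -, ha'2⟩ := h.exists_inner_end (hKS hbK)
    rw [hcomp b hbK] at ha'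
    have hbe : pol p b = ε₂ := hbL.2
    have hne : a' ≠ b := by
      rintro rfl
      exact h.lt.ne ((ha'1 haway).symm.trans hbe)
    exact (gdist_le_gdist h.mem_space (hKS haK).1 (hKS ha').1 (hmax ⟨ha', ha'1 haway⟩)).trans_lt
      (ha'2 hne)

theorem _root_.ConstCurv.sn_sub_order {r s : ℝ} (hr : r ∈ radialRange g)
    (hs : s ∈ radialRange g) : (sn g (r - s) < 0 → r < s) ∧ (0 < sn g (r - s) → s < r) := by
  cases g
  · constructor
    · intro h
      by_contra hle
      exact absurd (Real.sin_nonneg_of_nonneg_of_le_pi (by linarith) (by linarith [hr.2, hs.1]))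
        (not_le.2 h)
    · intro h
      by_contra hle
      have := Real.sin_nonneg_of_nonneg_of_le_pi (x := s - r) (by linarith)
        (by linarith [hr.1, hs.2])
      have h2 : Real.sin (r - s) = -Real.sin (s - r) := by rw [← Real.sin_neg, neg_sub]
      have h3 : 0 < Real.sin (r - s) := h
      linarith
  · constructor
    · intro h
      have := Real.sinh_neg_iff.1 h
      linarith
    · intro h
      have := Real.sinh_pos_iff.1 h
      linarith

theorem _root_.ConstCurv.sn_add_order {r r' s : ℝ} (hr : r ∈ radialRange g)
    (hr' : r' ∈ radialRange g) (hs : s ∈ radialRange g) (h : sn g (r + s) < 0)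
    (h' : 0 < sn g (r' + s)) : r' < r := by
  cases g
  · have h1 : Real.pi < r + s := by
      by_contra hle
      exact absurd (Real.sin_nonneg_of_nonneg_of_le_pi (by linarith [hr.1, hs.1]) (not_lt.1 hle))
        (not_le.2 h)
    have h2 : r' + s < Real.pi := by
      by_contra hle
      have := Real.sin_nonneg_of_nonneg_of_le_pi (x := r' + s - Real.pi) (by linarith)
        (by linarith [hr'.2, hs.2])
      rw [Real.sin_sub_pi] at this
      have h3 : 0 < Real.sin (r' + s) := h'
      linarith
    linarith
  · have h1 := Real.sinh_neg_iff.1 h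
    have h2 : 0 ≤ r := hr
    have h3 : 0 ≤ s := hs
    linarith

/-- The two centres `x` and `x₀` induce the same signs of the charge, up to a global sign. -/
theorem exists_sign (h₀ : InDomain g d p ε₁ ε₂ x₀) (h : InDomain g d p ε₁ ε₂ x) :
    ∃ c : ℝ, ∀ y ∈ layer g p ε₁ ε₂,
      Real.sign (away g p x₀ y) = c * Real.sign (away g p x y) := by
  have hdich : (∀ y ∈ layer g p ε₁ ε₂, 0 < away g p x₀ y * away g p x y) ∨
      (∀ y ∈ layer g p ε₁ ε₂, away g p x₀ y * away g p x y < 0) := by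
    -- If both signs of the product occurred, every ray from `x₀` would meet both parts of the
    -- layer, and the part met first would not depend on the ray. The two rays of the geodesic
    -- through `x₀` and `x` contradict this.
    by_contra hcon
    push Not at hcon
    obtain ⟨⟨yn, hyn, hn0⟩, ⟨yp, hyp, hp0⟩⟩ := hcon
    have hn1 : 1 ≤ n := by have := h.two_le; omega
    obtain ⟨un, hun, rn, hrn, rfl⟩ := exists_eq_geo hn1 h₀.mem_space hyn.1
    obtain ⟨up, hup, rp, hrp, rfl⟩ := exists_eq_geo hn1 h₀.mem_space hyp.1
    obtain ⟨v, hv, ρ, hρ, hx⟩ := exists_eq_geo hn1 h₀.mem_space h.mem_space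
    obtain ⟨R, hR, hRay⟩ := h₀.exists_rayLength
    have hrank : 1 < Module.rank ℝ (EuclideanSpace ℝ (Fin n)) := by
      rw [rank_eq_card_basis (EuclideanSpace.basisFun (Fin n) ℝ).toBasis, Fintype.card_fin]
      exact_mod_cast h.two_le
    have hW := isPreconnected_sphere hrank (0 : EuclideanSpace ℝ (Fin n)) 1
    have hWc := isCompact_sphere (0 : EuclideanSpace ℝ (Fin n)) 1
    have hWm : ∀ {w : EuclideanSpace ℝ (Fin n)}, w ∈ Metric.sphere 0 1 ↔ ‖w‖ = 1 := fun {w} =>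
      mem_sphere_zero_iff_norm
    set F : EuclideanSpace ℝ (Fin n) × ℝ → ℝ := fun q => pol p (geo g x₀ q.1 q.2) with hFdef
    set G : EuclideanSpace ℝ (Fin n) × ℝ → ℝ := fun q =>
      away g p x₀ (geo g x₀ q.1 q.2) * away g p x (geo g x₀ q.1 q.2) with hGdef
    have hF : Continuous F := (continuous_pol p).comp (continuous_geo g x₀)
    have hG : Continuous G := ((continuous_away p x₀).comp (continuous_geo g x₀)).mul
      ((continuous_away p x).comp (continuous_geo g x₀))
    have hmemL : ∀ w, ‖w‖ = 1 → ∀ r, F (w, r) ∈ Icc ε₁ ε₂ → geo g x₀ w r ∈ layer g p ε₁ ε₂ :=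
      fun w hw r hr => ⟨geo_mem_space h₀.mem_space hw r, hr⟩
    have hint : ∀ w ∈ Metric.sphere (0 : EuclideanSpace ℝ (Fin n)) 1, ∀ r ∈ Icc 0 R,
        F (w, r) ∈ Icc ε₁ ε₂ → r ∈ Ioo 0 R := fun w hw r hr hF =>
      hRay w (hWm.1 hw) r (hR hr) hF
    have hG0 : ∀ w ∈ Metric.sphere (0 : EuclideanSpace ℝ (Fin n)) 1, ∀ r ∈ Icc 0 R,
        F (w, r) ∈ Icc ε₁ ε₂ → G (w, r) ≠ 0 := fun w hw r _ hF =>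
      mul_ne_zero (h₀.away_ne_zero (hmemL w (hWm.1 hw) r hF))
        (h.away_ne_zero (hmemL w (hWm.1 hw) r hF))
    have happ : ∀ w ∈ Metric.sphere (0 : EuclideanSpace ℝ (Fin n)) 1, ∀ r ∈ Icc 0 R,
        F (w, r) ∈ Icc ε₁ ε₂ → ∃ᶠ s in 𝓝 r, F (w, s) ∈ Ioo ε₁ ε₂ := fun w hw r _ hF =>
      h₀.frequently_mem_Ioo (hWm.1 hw) hF
    have hrp' := hRay up hup rp hrp hyp.2
    have hrn' := hRay un hun rn hrn hyn.2
    have hP := exists_hit_of_exists_hit hW hWc hF hG hint hG0 happ (hWm.2 hup)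
      ⟨hrp'.1.le, hrp'.2.le⟩ hyp.2
      (lt_of_le_of_ne hp0 (hG0 up (hWm.2 hup) rp ⟨hrp'.1.le, hrp'.2.le⟩ hyp.2).symm)
    have hN := exists_hit_of_exists_hit hW hWc hF hG.neg hint
      (fun w hw r hr hF => neg_ne_zero.2 (hG0 w hw r hr hF)) happ (hWm.2 hun)
      ⟨hrn'.1.le, hrn'.2.le⟩ hyn.2
      (neg_pos.2 (lt_of_le_of_ne hn0 (hG0 un (hWm.2 hun) rn ⟨hrn'.1.le, hrn'.2.le⟩ hyn.2)))
    -- On the ray through `x` negative hits lie before `x` and positive ones after it: the first hit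
    -- is negative.
    have hGv : ∀ r, G (v, r) = sn g (r - ρ) * (sn g r * slope g p x₀ v r ^ 2) := fun r => by
      simp only [hGdef]
      rw [away_geo h₀.mem_space hv, hx, away_geo_geo hv]; ring
    -- On the opposite ray hits are positive, except on the sphere beyond the antipode of `x`: the
    -- first hit is positive.
    have hGnv : ∀ r, G (-v, r) = sn g (r + ρ) * (sn g r * slope g p x₀ v (-r) ^ 2) := fun r => by
      simp only [hGdef]
      rw [geo_neg, away_geo h₀.mem_space hv, hx, away_geo_geo hv, ← neg_add', sn_neg, sn_neg]
      ring
    have hnv : ‖-v‖ = 1 := by rwa [norm_neg]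
    have hfac : ∀ r ∈ Icc 0 R, ∀ t : ℝ, 0 ≤ sn g r * t ^ 2 := fun r hr t =>
      mul_nonneg (sn_nonneg (hR hr)) (sq_nonneg t)
    have hneg_of : ∀ {a b : ℝ}, 0 ≤ b → a * b < 0 → a < 0 := fun {a b} hb hab => by
      by_contra hc
      exact absurd (mul_nonneg (not_lt.1 hc) hb) (not_le.2 hab)
    have hpos_of : ∀ {a b : ℝ}, 0 ≤ b → 0 < a * b → 0 < a := fun {a b} hb hab =>
      pos_of_mul_pos_left hab hb
    rcases first_hit_dichotomy hW hWc hF hG hint hG0 happ (fun w hw => by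
      obtain ⟨r, hr, hFr, -⟩ := hP w hw
      exact ⟨r, hr, hFr.1.le, hFr.2.le⟩) with hA | hA
    · obtain ⟨r, hr, hFr, hGr, hall⟩ := hA v (hWm.2 hv)
      obtain ⟨s, hs, hFs, hGs⟩ := hN v (hWm.2 hv)
      have hGr' := lt_of_le_of_ne hGr (hG0 v (hWm.2 hv) r hr hFr).symm
      have hGs' : G (v, s) < 0 := neg_pos.1 hGs
      have h1 := (sn_sub_order (hR hr) hρ).2 (hpos_of (hfac r hr _) (hGv r ▸ hGr'))
      have h2 := (sn_sub_order (hR hs) hρ).1 (hneg_of (hfac s hs _) (hGv s ▸ hGs'))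
      exact hall s ⟨hs.1, h2.trans h1⟩ ⟨hFs, hGs'⟩
    · obtain ⟨r, hr, hFr, hGr, hall⟩ := hA (-v) (hWm.2 hnv)
      obtain ⟨s, hs, hFs, hGs⟩ := hP (-v) (hWm.2 hnv)
      have hGr' := lt_of_le_of_ne hGr (hG0 (-v) (hWm.2 hnv) r hr hFr)
      have h1 := sn_add_order (hR hr) (hR hs) hρ (hneg_of (hfac r hr _) (hGnv r ▸ hGr'))
        (hpos_of (hfac s hs _) (hGnv s ▸ hGs))
      exact hall s ⟨hs.1, h1⟩ ⟨hFs, hGs⟩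
  rcases hdich with hd | hd
  · refine ⟨1, fun y hy => ?_⟩
    rcases pos_and_pos_or_neg_and_neg_of_mul_pos (hd y hy) with ⟨h1, h2⟩ | ⟨h1, h2⟩
    · rw [Real.sign_of_pos h1, Real.sign_of_pos h2, one_mul]
    · rw [Real.sign_of_neg h1, Real.sign_of_neg h2, one_mul]
  · refine ⟨-1, fun y hy => ?_⟩
    rcases mul_neg_iff.1 (hd y hy) with ⟨h1, h2⟩ | ⟨h1, h2⟩
    · rw [Real.sign_of_pos h1, Real.sign_of_neg h2]; norm_num
    · rw [Real.sign_of_neg h1, Real.sign_of_pos h2]; norm_num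

end InDomain

end Signs

/-! ### Polar coordinates around an axis and in a plane. -/

section Polar

open Set Measure

variable {n : ℕ} {V : Type*} [NormedAddCommGroup V] [NormedSpace ℝ V]

theorem measurePreserving_smul_sphere {E : Type*} [NormedAddCommGroup E] [NormedSpace ℝ E]
    [MeasurableSpace E] [BorelSpace E] [FiniteDimensional ℝ E] [Nontrivial E] (μ : Measure E)
    [μ.IsAddHaarMeasure] :
    MeasurePreserving (fun q : Metric.sphere (0 : E) 1 × Ioi (0 : ℝ) => (q.2 : ℝ) • (q.1 : E))
      (μ.toSphere.prod (volumeIoiPow (Module.finrank ℝ E - 1))) μ := by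
  have h1 := (measurePreserving_homeomorphUnitSphereProd μ)
  have h2 : MeasurePreserving (homeomorphUnitSphereProd E).symm
      (μ.toSphere.prod (volumeIoiPow (Module.finrank ℝ E - 1)))
      (Measure.comap Subtype.val μ) :=
    MeasurePreserving.symm (homeomorphUnitSphereProd E).toMeasurableEquiv h1
  have h3 : MeasurePreserving (Subtype.val : ({0}ᶜ : Set E) → E) (Measure.comap Subtype.val μ) μ := by
    refine ⟨measurable_subtype_coe, ?_⟩
    rw [map_comap_subtype_coe (measurableSet_singleton (0 : E)).compl, restrict_compl_singleton]
  exact h3.comp h2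

theorem measurePreserving_smul_sphere_prod {E : Type*} [NormedAddCommGroup E] [NormedSpace ℝ E]
    [MeasurableSpace E] [BorelSpace E] [FiniteDimensional ℝ E] [Nontrivial E] (μ : Measure E)
    [μ.IsAddHaarMeasure] :
    MeasurePreserving (fun q : Metric.sphere (0 : E) 1 × (Ioi (0 : ℝ) × ℝ) =>
        (((q.2.1 : ℝ) • (q.1 : E), q.2.2) : E × ℝ))
      (μ.toSphere.prod ((volumeIoiPow (Module.finrank ℝ E - 1)).prod volume)) (μ.prod volume) := by
  have h1 := (measurePreserving_smul_sphere μ).prod (MeasurePreserving.id (volume : Measure ℝ))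
  have h2 := MeasurePreserving.symm MeasurableEquiv.prodAssoc
    (measurePreserving_prodAssoc μ.toSphere (volumeIoiPow (Module.finrank ℝ E - 1))
      (volume : Measure ℝ))
  exact h1.comp h2

theorem sFinite_comap_Ioi : SFinite (Measure.comap (Subtype.val : Ioi (0 : ℝ) → ℝ) volume) := by
  have h : volumeIoiPow 0 = Measure.comap (Subtype.val : Ioi (0 : ℝ) → ℝ) volume := by
    simp only [volumeIoiPow, pow_zero, ENNReal.ofReal_one]
    exact withDensity_one
  rw [← h]
  infer_instance

theorem integral_volumeIoiPow_prod (k : ℕ) (G : ℝ × ℝ → V) :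
    ∫ q, G ((q.1 : ℝ), q.2) ∂((volumeIoiPow k).prod (volume : Measure ℝ)) =
      ∫ q in Ioi (0 : ℝ) ×ˢ univ, |q.1| ^ k • G q := by
  have hmp : MeasurePreserving (Subtype.val : Ioi (0 : ℝ) → ℝ) (Measure.comap Subtype.val volume)
      (volume.restrict (Ioi 0)) :=
    ⟨measurable_subtype_coe, map_comap_subtype_coe measurableSet_Ioi _⟩
  have : SFinite (Measure.comap (Subtype.val : Ioi (0 : ℝ) → ℝ) volume) := sFinite_comap_Ioi
  have hmp2 := hmp.prod (MeasurePreserving.id (volume : Measure ℝ))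
  have hme : MeasurableEmbedding (Prod.map (Subtype.val : Ioi (0 : ℝ) → ℝ) (id : ℝ → ℝ)) :=
    (MeasurableEmbedding.subtype_coe measurableSet_Ioi).prodMap MeasurableEmbedding.id
  have hf : Measurable fun r : Ioi (0 : ℝ) => ENNReal.ofReal ((r : ℝ) ^ k) := by fun_prop
  have hf' : Measurable fun z : Ioi (0 : ℝ) × ℝ => ENNReal.ofReal ((z.1 : ℝ) ^ k) :=
    hf.comp measurable_fst
  have hvol : (volume : Measure (ℝ × ℝ)).restrict (Ioi (0 : ℝ) ×ˢ univ) =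
      ((volume : Measure ℝ).restrict (Ioi 0)).prod volume := by
    rw [Measure.volume_eq_prod, ← Measure.prod_restrict, Measure.restrict_univ]
  rw [volumeIoiPow, prod_withDensity_left hf,
    integral_withDensity_eq_integral_toReal_smul hf'
      (Filter.Eventually.of_forall fun _ => ENNReal.ofReal_lt_top), hvol,
    ← hmp2.integral_comp hme]
  refine integral_congr_ae (Filter.Eventually.of_forall fun q => ?_)
  have h0 : (0 : ℝ) < q.1 := q.1.2
  simp [ENNReal.toReal_ofReal (pow_nonneg h0.le k), abs_of_pos h0]
  rfl

theorem integrable_volumeIoiPow_prod (k : ℕ) (G : ℝ × ℝ → V) :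
    Integrable (fun q : Ioi (0 : ℝ) × ℝ => G ((q.1 : ℝ), q.2))
      ((volumeIoiPow k).prod (volume : Measure ℝ)) ↔
      IntegrableOn (fun q : ℝ × ℝ => |q.1| ^ k • G q) (Ioi (0 : ℝ) ×ˢ univ) := by
  have hmp : MeasurePreserving (Subtype.val : Ioi (0 : ℝ) → ℝ) (Measure.comap Subtype.val volume)
      (volume.restrict (Ioi 0)) :=
    ⟨measurable_subtype_coe, map_comap_subtype_coe measurableSet_Ioi _⟩
  have : SFinite (Measure.comap (Subtype.val : Ioi (0 : ℝ) → ℝ) volume) := sFinite_comap_Ioi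
  have hmp2 := hmp.prod (MeasurePreserving.id (volume : Measure ℝ))
  have hme : MeasurableEmbedding (Prod.map (Subtype.val : Ioi (0 : ℝ) → ℝ) (id : ℝ → ℝ)) :=
    (MeasurableEmbedding.subtype_coe measurableSet_Ioi).prodMap MeasurableEmbedding.id
  have hf : Measurable fun r : Ioi (0 : ℝ) => ENNReal.ofReal ((r : ℝ) ^ k) := by fun_prop
  have hf' : Measurable fun z : Ioi (0 : ℝ) × ℝ => ENNReal.ofReal ((z.1 : ℝ) ^ k) :=
    hf.comp measurable_fst
  have hvol : (volume : Measure (ℝ × ℝ)).restrict (Ioi (0 : ℝ) ×ˢ univ) =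
      ((volume : Measure ℝ).restrict (Ioi 0)).prod volume := by
    rw [Measure.volume_eq_prod, ← Measure.prod_restrict, Measure.restrict_univ]
  rw [volumeIoiPow, prod_withDensity_left hf,
    integrable_withDensity_iff_integrable_smul' hf'
      (Filter.Eventually.of_forall fun _ => ENNReal.ofReal_lt_top), IntegrableOn, hvol,
    ← hmp2.integrable_comp_emb hme]
  refine integrable_congr (Filter.Eventually.of_forall fun q => ?_)
  have h0 : (0 : ℝ) < q.1 := q.1.2
  simp [ENNReal.toReal_ofReal (pow_nonneg h0.le k), abs_of_pos h0]
  rfl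

/-- A function on `E × ℝ` has integral zero if its integrals over the planes `ℝ u × ℝ`, weighted
by the power of the distance to the axis that comes from polar coordinates, are zero. -/
theorem integral_eq_zero_of_planes {E : Type*} [NormedAddCommGroup E] [NormedSpace ℝ E]
    [MeasurableSpace E] [BorelSpace E] [FiniteDimensional ℝ E] [Nontrivial E] (μ : Measure E)
    [μ.IsAddHaarMeasure] {Ψ : E × ℝ → V} (hm : StronglyMeasurable Ψ)
    (hΨ : Integrable Ψ (μ.prod volume))
    (h : ∀ u : E, ‖u‖ = 1 →
      ∫ q : ℝ × ℝ, |q.1| ^ (Module.finrank ℝ E - 1) • Ψ (q.1 • u, q.2) = 0) :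
    ∫ q, Ψ q ∂(μ.prod volume) = 0 := by
  set k := Module.finrank ℝ E - 1
  have hT := measurePreserving_smul_sphere_prod μ
  -- Polar coordinates only give half-planes. Adding the integral with `w` replaced by `-w`
  -- completes them to planes, at the cost of a factor `2`.
  have hN : MeasurePreserving (Prod.map (fun w : E => -w) (id : ℝ → ℝ)) (μ.prod volume)
      (μ.prod (volume : Measure ℝ)) :=
    (measurePreserving_neg μ).prod (MeasurePreserving.id _)
  have hTN := hN.comp hT
  have i1 := hT.integrable_comp_of_integrable hΨ
  have i2 := hTN.integrable_comp_of_integrable hΨ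
  have e1 := integral_map hT.aemeasurable hm.aestronglyMeasurable
  have e2 := integral_map hTN.aemeasurable hm.aestronglyMeasurable
  rw [hT.map_eq] at e1
  rw [hTN.map_eq] at e2
  replace e1 := e1.trans (integral_prod _ i1)
  replace e2 := e2.trans (integral_prod _ i2)
  have hsum : ∫ q, Ψ q ∂(μ.prod volume) + ∫ q, Ψ q ∂(μ.prod volume) = 0 := by
    nth_rewrite 1 [e1]
    rw [e2]
    refine (integral_add i1.integral_prod_left i2.integral_prod_left).symm.trans ?_
    refine integral_eq_zero_of_ae ?_
    filter_upwards [i1.prod_right_ae, i2.prod_right_ae] with u hu1 hu2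
    have hnorm : ‖(u : E)‖ = 1 := mem_sphere_zero_iff_norm.1 u.2
    set G : ℝ × ℝ → V := fun q => Ψ (q.1 • (u : E), q.2) with hG
    set G' : ℝ × ℝ → V := fun q => Ψ ((-q.1) • (u : E), q.2) with hG'
    have hu2' : Integrable (fun q : Ioi (0 : ℝ) × ℝ => G' ((q.1 : ℝ), q.2))
        ((volumeIoiPow k).prod (volume : Measure ℝ)) := by
      refine hu2.congr (Filter.Eventually.of_forall fun q => ?_)
      simp [hG', neg_smul]
    have j1 := (integrable_volumeIoiPow_prod k G).1 hu1
    have j2 := (integrable_volumeIoiPow_prod k G').1 hu2'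
    have f1 := integral_volumeIoiPow_prod k G
    have f2 := integral_volumeIoiPow_prod k G'
    have hR : MeasurePreserving (Prod.map (fun s : ℝ => -s) (id : ℝ → ℝ)) volume volume :=
      (measurePreserving_neg volume).prod (MeasurePreserving.id _)
    have hRe : MeasurableEmbedding (Prod.map (fun s : ℝ => -s) (id : ℝ → ℝ)) :=
      (MeasurableEquiv.neg ℝ).measurableEmbedding.prodMap MeasurableEmbedding.id
    have hpre : Prod.map (fun s : ℝ => -s) (id : ℝ → ℝ) ⁻¹' (Iio (0 : ℝ) ×ˢ univ) =
        Ioi (0 : ℝ) ×ˢ univ := by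
      ext q; simp
    have hcomp : (fun q : ℝ × ℝ => |q.1| ^ k • G' q) =
        (fun q : ℝ × ℝ => |q.1| ^ k • G q) ∘ Prod.map (fun s : ℝ => -s) (id : ℝ → ℝ) := by
      funext q; simp [hG, hG']
    have f2' : ∫ q in Ioi (0 : ℝ) ×ˢ univ, |q.1| ^ k • G' q =
        ∫ q in Iio (0 : ℝ) ×ˢ univ, |q.1| ^ k • G q := by
      refine Eq.trans ?_ (hR.setIntegral_preimage_emb hRe _ _)
      rw [hpre]
      exact integral_congr_ae (Filter.Eventually.of_forall fun q => congrFun hcomp q)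
    have j2' : IntegrableOn (fun q : ℝ × ℝ => |q.1| ^ k • G q) (Iio (0 : ℝ) ×ˢ univ) := by
      rw [← hR.integrableOn_comp_preimage hRe, hpre, ← hcomp]
      exact j2
    have hall : ∫ q : ℝ × ℝ, |q.1| ^ k • G q =
        (∫ q in Ioi (0 : ℝ) ×ˢ univ, |q.1| ^ k • G q) +
          ∫ q in Iio (0 : ℝ) ×ˢ univ, |q.1| ^ k • G q := by
      rw [← setIntegral_union _ (measurableSet_Iio.prod MeasurableSet.univ) j1 j2']
      · rw [← setIntegral_univ]
        refine setIntegral_congr_set ?_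
        have hnull : (volume : Measure (ℝ × ℝ)) ({0} ×ˢ univ) = 0 := by
          rw [Measure.volume_eq_prod, Measure.prod_prod]; simp
        have hc : univ \ (Ioi (0 : ℝ) ×ˢ (univ : Set ℝ) ∪ Iio (0 : ℝ) ×ˢ univ) ⊆ {0} ×ˢ univ := by
          rintro ⟨a, b⟩ hq
          simp only [mem_sdiff, mem_univ, mem_union, mem_prod, mem_Ioi, mem_Iio, and_true, true_and,
            not_or, not_lt] at hq
          exact ⟨le_antisymm hq.1 hq.2, trivial⟩
        exact (ae_eq_set.2 ⟨measure_mono_null hc hnull, by simp⟩)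
      · rw [disjoint_left]
        rintro ⟨a, b⟩ ⟨h1, -⟩ ⟨h2, -⟩
        exact lt_asymm (mem_Ioi.1 h1) (mem_Iio.1 h2)
    have hzero := h u hnorm
    change ∫ q : ℝ × ℝ, |q.1| ^ k • G q = 0 at hzero
    rw [hall, ← f2', ← f1, ← f2] at hzero
    refine Eq.trans ?_ hzero
    congr 1
    refine integral_congr_ae (Filter.Eventually.of_forall fun q => ?_)
    simp [hG', neg_smul]
  have : (2 : ℝ) • ∫ q, Ψ q ∂(μ.prod volume) = 0 := by rw [two_smul]; exact hsum
  exact (smul_eq_zero.1 this).resolve_left two_ne_zero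

/-- Polar coordinates in the plane, Euclidean or Minkowski. -/
theorem integral_planar (g : Geometry) (K : ℝ × ℝ → V)
    (hK : g = .hyperbolic → ∀ q : ℝ × ℝ, ¬ |q.2| < q.1 → K q = 0) :
    ∫ q, K q = ∫ q in Ioi (0 : ℝ) ×ˢ openRange g, q.1 • K (q.1 * cs g q.2, q.1 * sn g q.2) := by
  cases g
  · exact (integral_comp_polarCoord_symm K).symm
  -- Minkowski polar coordinates have Jacobian `t` and cover just the forward cone, outside of which
  -- `K` vanishes.
  · set f : ℝ × ℝ → ℝ × ℝ := fun q => (q.1 * Real.cosh q.2, q.1 * Real.sinh q.2) with hf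
    set f' : ℝ × ℝ → ℝ × ℝ →L[ℝ] ℝ × ℝ := fun q =>
      LinearMap.toContinuousLinearMap (Matrix.toLin (Module.Basis.finTwoProd ℝ)
        (Module.Basis.finTwoProd ℝ)
        !![Real.cosh q.2, q.1 * Real.sinh q.2; Real.sinh q.2, q.1 * Real.cosh q.2]) with hf'
    have hdet : ∀ q, (f' q).det = q.1 := fun q => by
      rw [hf', ContinuousLinearMap.det, LinearMap.coe_toContinuousLinearMap, LinearMap.det_toLin,
        Matrix.det_fin_two_of]
      linear_combination q.1 * Real.cosh_sq_sub_sinh_sq q.2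
    have hder : ∀ q, HasFDerivAt f (f' q) q := by
      intro q
      simp only [hf', Matrix.toLin_finTwoProd_toContinuousLinearMap]
      refine (HasFDerivAt.prodMk (𝕜 := ℝ)
        (hasFDerivAt_fst.mul ((Real.hasDerivAt_cosh q.2).comp_hasFDerivAt q hasFDerivAt_snd))
        (hasFDerivAt_fst.mul ((Real.hasDerivAt_sinh q.2).comp_hasFDerivAt q
          hasFDerivAt_snd))).congr_fderiv ?_
      ext <;> simp
    have hinj : InjOn f (Ioi (0 : ℝ) ×ˢ univ) := by
      rintro ⟨t, r⟩ ht ⟨t', r'⟩ ht' heq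
      have ht : 0 < t := ht.1
      have ht' : 0 < t' := ht'.1
      have h1 : t * Real.cosh r = t' * Real.cosh r' := congrArg Prod.fst heq
      have h2 : t * Real.sinh r = t' * Real.sinh r' := congrArg Prod.snd heq
      have h3 : t ^ 2 = t' ^ 2 := by
        linear_combination (t * Real.cosh r + t' * Real.cosh r') * h1 -
          (t * Real.sinh r + t' * Real.sinh r') * h2 - t ^ 2 * Real.cosh_sq_sub_sinh_sq r +
          t' ^ 2 * Real.cosh_sq_sub_sinh_sq r'
      have h4 : t = t' := (pow_left_inj₀ ht.le ht'.le two_ne_zero).1 h3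
      subst h4
      have h5 := Real.sinh_injective (mul_left_cancel₀ ht.ne' h2)
      rw [h5]
    have himage : f '' (Ioi (0 : ℝ) ×ˢ univ) = {q | |q.2| < q.1} := by
      ext ⟨a, s⟩
      constructor
      · rintro ⟨⟨t, r⟩, ⟨ht, -⟩, heq⟩
        have ht : 0 < t := ht
        obtain ⟨rfl, rfl⟩ := Prod.mk.inj heq
        change |t * Real.sinh r| < t * Real.cosh r
        rw [abs_mul, abs_of_pos ht, Real.abs_sinh, ← Real.cosh_abs]
        exact mul_lt_mul_of_pos_left (Real.sinh_lt_cosh _) ht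
      · intro hq
        have hq : |s| < a := hq
        have ha : 0 < a := (abs_nonneg s).trans_lt hq
        have hpos : 0 < a ^ 2 - s ^ 2 := by nlinarith [sq_abs s, abs_nonneg s]
        set t := Real.sqrt (a ^ 2 - s ^ 2) with ht
        have ht0 : 0 < t := Real.sqrt_pos.2 hpos
        have htt : t ^ 2 = a ^ 2 - s ^ 2 := Real.sq_sqrt hpos.le
        refine ⟨(t, Real.arsinh (s / t)), ⟨ht0, trivial⟩, ?_⟩
        have hsinh : t * Real.sinh (Real.arsinh (s / t)) = s := by
          rw [Real.sinh_arsinh, mul_div_cancel₀ _ ht0.ne']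
        have hcosh : t * Real.cosh (Real.arsinh (s / t)) = a := by
          have h1 := Real.cosh_pos (Real.arsinh (s / t))
          refine (pow_left_inj₀ (by positivity) ha.le two_ne_zero).1 ?_
          linear_combination t ^ 2 * Real.cosh_sq (Real.arsinh (s / t)) + htt +
            (t * Real.sinh (Real.arsinh (s / t)) + s) * hsinh
        exact Prod.ext hcosh hsinh
    have h := integral_image_eq_integral_abs_det_fderiv_smul volume
      (measurableSet_Ioi.prod MeasurableSet.univ) (fun q _ => (hder q).hasFDerivWithinAt) hinj K
    have h0 := setIntegral_eq_integral_of_forall_compl_eq_zero (μ := volume)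
      (s := {q : ℝ × ℝ | |q.2| < q.1}) (f := K) fun q hq => hK rfl q hq
    rw [himage] at h
    rw [← h0, h]
    refine setIntegral_congr_fun (measurableSet_Ioi.prod MeasurableSet.univ) fun q hq => ?_
    have hq0 : 0 < q.1 := hq.1
    simp only [hdet, abs_of_pos hq0]
    rfl

/-- A linear involution has determinant `1` or `-1`, even if it is not a Euclidean isometry. -/
theorem measurePreserving_refl (g : Geometry) (x : Ambient n) :
    MeasurePreserving (refl g x) volume volume := by
  have hdet : LinearMap.det (refl g x) * LinearMap.det (refl g x) = 1 := by
    rw [← LinearMap.det_comp]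
    have : refl g x ∘ₗ refl g x = LinearMap.id := LinearMap.ext fun z => refl_refl x z
    rw [this, LinearMap.det_id]
  refine ⟨(continuous_refl x).measurable, ?_⟩
  rw [map_linearMap_addHaar_eq_smul_addHaar volume (left_ne_zero_of_mul_eq_one hdet), abs_inv]
  have : |LinearMap.det (refl g x)| = 1 := by
    rcases mul_self_eq_one_iff.1 hdet with h | h <;> simp [h]
  rw [this]; simp

theorem measurePreserving_cons (n : ℕ) :
    MeasurePreserving (fun q : EuclideanSpace ℝ (Fin n) × ℝ => (cons q.2 q.1 : Ambient n))
      (volume.prod volume) volume := by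
  have h1 : MeasurePreserving (Prod.swap : EuclideanSpace ℝ (Fin n) × ℝ → _)
      ((volume : Measure (EuclideanSpace ℝ (Fin n))).prod volume) (volume.prod volume) :=
    measurePreserving_swap
  have h2 := (MeasurePreserving.id (volume : Measure ℝ)).prod (PiLp.volume_preserving_ofLp (Fin n))
  have h3 := MeasurePreserving.symm _ (volume_preserving_piFinSuccAbove (fun _ : Fin (n + 1) => ℝ) 0)
  have h4 := PiLp.volume_preserving_toLp (Fin (n + 1))
  have h5 : (fun q : EuclideanSpace ℝ (Fin n) × ℝ => (cons q.2 q.1 : Ambient n)) =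
      WithLp.toLp 2 ∘ (MeasurableEquiv.piFinSuccAbove (fun _ : Fin (n + 1) => ℝ) 0).symm ∘
        Prod.map id WithLp.ofLp ∘ Prod.swap := by
    funext q
    exact cons_ext rfl fun _ => rfl
  rw [h5]
  exact h4.comp (h3.comp (h2.comp h1))

end Polar

/-! ### The volume of the space as Lebesgue measure on a cone. -/

section Volume

open Set Measure

variable {n : ℕ} {g : Geometry} {V : Type*} [NormedAddCommGroup V]

/-- The open cone of height one over the space. -/
def unitCone (g : Geometry) (n : ℕ) : Set (Ambient n) :=
  {z | (0 < kap g * pairing g z z ∧ kap g * pairing g z z < 1) ∧ (g = .hyperbolic → 0 < z 0)}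

/-- The radial projection of the cone to the space. -/
noncomputable def normalize (g : Geometry) (z : Ambient n) : Ambient n :=
  (Real.sqrt (kap g * pairing g z z))⁻¹ • z

theorem continuous_kap_pairing (g : Geometry) :
    Continuous fun z : Ambient n => kap g * pairing g z z :=
  continuous_const.mul (continuous_id.pairing continuous_id g)

theorem measurable_normalize (g : Geometry) : Measurable (normalize g : Ambient n → Ambient n) :=
  ((continuous_kap_pairing g).measurable.sqrt.inv).smul measurable_id

theorem measurableSet_unitCone (g : Geometry) (n : ℕ) : MeasurableSet (unitCone g n) := by
  have h := (continuous_kap_pairing (n := n) g).measurable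
  have h0 : Measurable fun z : Ambient n => z 0 := by fun_prop
  refine ((measurableSet_lt measurable_const h).inter (measurableSet_lt h measurable_const)).inter ?_
  cases g
  · simp only [reduceCtorEq, false_imp_iff]
    exact MeasurableSet.univ
  · simp only [forall_const]
    exact measurableSet_lt measurable_const h0

theorem normalize_mem_space {z : Ambient n} (hz : z ∈ unitCone g n) : normalize g z ∈ space g n := by
  obtain ⟨⟨h1, -⟩, h0⟩ := hz
  have hs := Real.sqrt_pos.2 h1
  refine mem_space_iff.2 ⟨?_, fun hg => ?_⟩
  · rw [normalize, pairing_smul_left, pairing_smul_right]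
    have h2 := Real.mul_self_sqrt h1.le
    field_simp
    linear_combination -(kap g) * h2 - pairing g z z * kap_mul_self g
  · exact mul_pos (inv_pos.2 hs) (h0 hg)

theorem kap_pairing_smul {y : Ambient n} (hy : y ∈ space g n) (t : ℝ) :
    kap g * pairing g (t • y) (t • y) = t ^ 2 := by
  rw [pairing_smul_left, pairing_smul_right, (mem_space_iff.1 hy).1]
  linear_combination t ^ 2 * kap_mul_self g

theorem normalize_smul {y : Ambient n} (hy : y ∈ space g n) {t : ℝ} (ht : 0 < t) :
    normalize g (t • y) = y := by
  rw [normalize, kap_pairing_smul hy, Real.sqrt_sq ht.le, inv_smul_smul₀ ht.ne']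

theorem smul_mem_unitCone_iff {y : Ambient n} (hy : y ∈ space g n) {t : ℝ} (ht : 0 < t) :
    t • y ∈ unitCone g n ↔ t < 1 := by
  have h0 : g = .hyperbolic → 0 < (t • y) 0 := fun hg => mul_pos ht ((mem_space_iff.1 hy).2 hg)
  rw [unitCone, mem_ofPred_eq, kap_pairing_smul hy]
  refine ⟨fun h => ?_, fun h => ⟨⟨by positivity, ?_⟩, h0⟩⟩
  · exact (sq_lt_one_iff₀ ht.le).1 h.1.2
  · exact (sq_lt_one_iff₀ ht.le).2 h

theorem exists_smul_normalize {z : Ambient n} (hz : z ∈ unitCone g n) :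
    ∃ t ∈ Ioo (0 : ℝ) 1, z = t • normalize g z := by
  have h1 := Real.sqrt_pos.2 hz.1.1
  refine ⟨Real.sqrt (kap g * pairing g z z), ⟨h1, ?_⟩, ?_⟩
  · rw [Real.sqrt_lt' one_pos, one_pow]; exact hz.1.2
  · rw [normalize, smul_inv_smul₀ h1.ne']

/-- One description of both volumes, which lets integrals over the curved space be computed by
Fubini in the flat ambient space. -/
theorem vol_eq (g : Geometry) (n : ℕ) :
    vol g n = (n + 1) • (volume.restrict (unitCone g n)).map (normalize g) := by
  cases g
  · refine Measure.ext fun A hA => ?_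
    have hv : Measurable (Subtype.val : Metric.sphere (0 : Ambient n) 1 → Ambient n) :=
      measurable_subtype_coe
    rw [vol, Measure.map_apply hv hA, toSphere_apply' _ (hv hA), Measure.smul_apply,
      Measure.map_apply (measurable_normalize _) hA,
      Measure.restrict_apply (measurable_normalize _ hA), finrank_euclideanSpace_fin, nsmul_eq_mul]
    congr 2
    ext z
    constructor
    · rintro ⟨t, ht, _, ⟨y, hy, rfl⟩, rfl⟩
      have hys : (y : Ambient n) ∈ space .spherical n := y.2
      refine ⟨?_, (smul_mem_unitCone_iff hys ht.1).2 ht.2⟩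
      change normalize _ (t • (y : Ambient n)) ∈ A
      rw [normalize_smul hys ht.1]
      exact hy
    · rintro ⟨hzA, hz⟩
      obtain ⟨t, ht, hzt⟩ := exists_smul_normalize hz
      exact ⟨t, ht, _, ⟨⟨normalize _ z, normalize_mem_space hz⟩, hzA, rfl⟩, hzt.symm⟩
  · have h1 : unitCone .hyperbolic n = {z : Ambient n | 0 < z 0 ∧ -1 < pairing .hyperbolic z z ∧
        pairing .hyperbolic z z < 0} := by
      ext z
      simp only [unitCone, kap, mem_ofPred_eq, forall_const, neg_one_mul]
      constructor
      · rintro ⟨⟨h1, h2⟩, h3⟩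
        exact ⟨h3, by linarith, by linarith⟩
      · rintro ⟨h1, h2, h3⟩
        exact ⟨⟨by linarith, by linarith⟩, h1⟩
    have h2 : (normalize .hyperbolic : Ambient n → Ambient n) =
        fun z => (Real.sqrt (-pairing .hyperbolic z z))⁻¹ • z := by
      funext z; rw [normalize, kap, neg_one_mul]
    rw [h1, h2, vol]

/-- The extension of a function on the space to the cone over it, by zero outside of the cone. -/
noncomputable def coneExt (g : Geometry) (F : Ambient n → V) : Ambient n → V :=
  (unitCone g n).indicator (F ∘ normalize g)

theorem coneExt_smul (F : Ambient n → V) {y : Ambient n} (hy : y ∈ space g n) {t : ℝ} (ht : 0 < t) :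
    coneExt g F (t • y) = (Iio (1 : ℝ)).indicator (fun _ => F y) t := by
  by_cases h : t < 1
  · rw [coneExt, indicator_of_mem ((smul_mem_unitCone_iff hy ht).2 h), Function.comp_apply,
      normalize_smul hy ht, indicator_of_mem (mem_Iio.2 h)]
  · rw [coneExt, indicator_of_notMem (mt (smul_mem_unitCone_iff hy ht).1 h),
      indicator_of_notMem (show t ∉ Iio (1 : ℝ) from h)]

theorem coneExt_refl_eq_zero (F : Ambient n → V) {x : Ambient n} (hx : x ∈ space .hyperbolic n)
    {a : ℝ} {w : EuclideanSpace ℝ (Fin n)} (h : ¬ ‖w‖ < a) :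
    coneExt .hyperbolic F (refl .hyperbolic x (cons a w)) = 0 := by
  refine indicator_of_notMem (fun hz => h ?_) _
  have h1 := (mem_space_iff.1 (refl_mem_space hx (normalize_mem_space hz))).2 rfl
  rw [normalize, map_smul, refl_refl] at h1
  have ha : 0 < a := pos_of_mul_pos_right h1 (inv_nonneg.2 (Real.sqrt_nonneg _))
  have h2 := hz.1.1
  rw [pairing_refl_refl, pairing_cons, real_inner_self_eq_norm_sq] at h2
  simp only [kap] at h2
  exact lt_of_pow_lt_pow_left₀ 2 ha.le (by linarith)

theorem stronglyMeasurable_coneExt {F : Ambient n → V} (hF : StronglyMeasurable F) :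
    StronglyMeasurable (coneExt g F) :=
  (hF.comp_measurable (measurable_normalize g)).indicator (measurableSet_unitCone g n)

theorem integrable_vol {F : Ambient n → V} (hF : StronglyMeasurable F)
    (h : Integrable (coneExt g F)) : Integrable F (vol g n) := by
  rw [vol_eq]
  have h1 := (integrable_indicator_iff (measurableSet_unitCone g n)).1 h
  have h2 := (integrable_map_measure hF.aestronglyMeasurable
    (measurable_normalize g).aemeasurable).2 h1
  rw [← Nat.cast_smul_eq_nsmul ENNReal]
  exact h2.smul_measure (ENNReal.natCast_ne_top _)

theorem integral_vol [NormedSpace ℝ V] {F : Ambient n → V} (hF : StronglyMeasurable F) :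
    ∫ y, F y ∂(vol g n) = (n + 1) • ∫ z, coneExt g F z := by
  rw [vol_eq, coneExt, integral_indicator (measurableSet_unitCone g n),
    ← Nat.cast_smul_eq_nsmul ENNReal, integral_smul_measure, ENNReal.toReal_natCast,
    integral_map (measurable_normalize g).aemeasurable hF.aestronglyMeasurable,
    Nat.cast_smul_eq_nsmul]
  rfl

/-- The cone over `A` lies in the compact image of `[0, 1] × A`, so a function bounded on `A`
extends to an integrable one. -/
theorem integrable_coneExt_indicator {A : Set (Ambient n)} (hA : IsCompact A) {F : Ambient n → V}
    (hF : StronglyMeasurable F) {C : ℝ} (hC : ∀ y ∈ A, ‖F y‖ ≤ C) :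
    Integrable (coneExt g (A.indicator F)) := by
  have hT : MeasurableSet (normalize g ⁻¹' A) := measurable_normalize g hA.measurableSet
  have hT' := (measurableSet_unitCone g n).inter hT
  have heq : coneExt g (A.indicator F) =
      (unitCone g n ∩ normalize g ⁻¹' A).indicator (F ∘ normalize g) := by
    rw [coneExt, ← indicator_indicator]
    rfl
  rw [heq, integrable_indicator_iff hT']
  have hsub : unitCone g n ∩ normalize g ⁻¹' A ⊆
      (fun q : ℝ × Ambient n => q.1 • q.2) '' (Icc 0 1 ×ˢ A) := by
    rintro z ⟨hz, hzA⟩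
    obtain ⟨t, ht, hzt⟩ := exists_smul_normalize hz
    exact ⟨(t, normalize g z), ⟨⟨ht.1.le, ht.2.le⟩, hzA⟩, hzt.symm⟩
  have hfin : volume (unitCone g n ∩ normalize g ⁻¹' A) ≠ ⊤ :=
    measure_ne_top_of_subset hsub
      ((isCompact_Icc.prod hA).image (by fun_prop)).measure_lt_top.ne
  refine Measure.integrableOn_of_bounded hfin
    (hF.comp_measurable (measurable_normalize g)).aestronglyMeasurable (M := C) ?_
  filter_upwards [ae_restrict_mem hT'] with z hz
  exact hC _ hz.2

end Volume

/-! ### The field of the charged layer. -/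

section Field

open Set

variable {n d : ℕ} {g : Geometry} {p : MvPolynomial (Fin (n + 1)) ℝ} {ε₁ ε₂ : ℝ} {x x₀ : Ambient n}
  {u : EuclideanSpace ℝ (Fin n)}

theorem measurable_force (g : Geometry) (x : Ambient n) : Measurable (force g x) := by
  have h1 : Measurable (pairing g x) := (continuous_const.pairing continuous_id g).measurable
  have h2 : Measurable (gdist g x) := by
    cases g
    · exact Real.measurable_arccos.comp h1
    · have : Measurable Real.arcosh := by
        unfold Real.arcosh
        fun_prop
      exact this.comp h1.neg
  have h3 : Measurable fun y => sn g (gdist g x y) := (continuous_sn g).measurable.comp h2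
  have h4 : Measurable fun y => cs g (gdist g x y) := (continuous_cs g).measurable.comp h2
  exact (h3.pow_const _).inv.smul (h3.inv.smul (measurable_id.sub (h4.smul_const x)))

theorem measurable_sign : Measurable Real.sign := by
  unfold Real.sign
  exact Measurable.ite measurableSet_Iio measurable_const
    (Measurable.ite measurableSet_Ioi measurable_const measurable_const)

theorem norm_sign_le (a : ℝ) : ‖Real.sign a‖ ≤ 1 := by
  rcases Real.sign_apply_eq a with h | h | h <;> simp [h]

theorem sign_mul_of_pos {a : ℝ} (ha : 0 < a) (b : ℝ) : Real.sign (a * b) = Real.sign b := by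
  rcases lt_trichotomy b 0 with h | h | h
  · rw [Real.sign_of_neg h, Real.sign_of_neg (mul_neg_of_pos_of_neg ha h)]
  · rw [h, mul_zero]
  · rw [Real.sign_of_pos h, Real.sign_of_pos (mul_pos ha h)]

theorem mem_radialRange_or_neg {r : ℝ} (hr : r ∈ openRange g) :
    r ∈ radialRange g ∨ -r ∈ radialRange g := by
  cases g
  · rcases le_total 0 r with h | h
    · exact Or.inl ⟨h, hr.2.le⟩
    · exact Or.inr ⟨neg_nonneg.2 h, by linarith [hr.1]⟩
  · exact (le_total 0 r).imp id neg_nonneg.2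

/-- The force at `x` of a unit charge at `y` whose sign is that of the derivative of `p` away from
`x`. -/
noncomputable def signedForce (g : Geometry) (p : MvPolynomial (Fin (n + 1)) ℝ) (x y : Ambient n) :
    Ambient n :=
  Real.sign (away g p x y) • force g x y

theorem measurable_signedForce (g : Geometry) (p : MvPolynomial (Fin (n + 1)) ℝ) (x : Ambient n) :
    Measurable (signedForce g p x) :=
  (measurable_sign.comp (continuous_away p x).measurable).smul (measurable_force g x)

namespace InDomain

theorem signedForce_geo_of_mem (h : InDomain g d p ε₁ ε₂ x) (hu : ‖u‖ = 1) {r : ℝ}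
    (hr : r ∈ radialRange g) (hp : pol p (geo g x u r) ∈ Icc ε₁ ε₂) :
    |sn g r| ^ (n - 1) • signedForce g p x (geo g x u r) =
      Real.sign (slope g p x u r) • refl g x (cons 0 u) := by
  have hs := h.sn_pos hu hr hp
  rw [signedForce, away_geo h.mem_space hu, force_geo h.mem_space hu hr hs.ne', sign_mul_of_pos hs,
    abs_of_pos hs, smul_comm, smul_inv_smul₀ (pow_pos hs _).ne']

/-- The weight cancels the magnitude of the force. A negative `r` is a positive parameter in
direction `-u`; slope and direction both change sign, and the formula persists along the whole
geodesic. -/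
theorem signedForce_geo (h : InDomain g d p ε₁ ε₂ x) (hu : ‖u‖ = 1) {r : ℝ}
    (hr : r ∈ openRange g) (hp : pol p (geo g x u r) ∈ Icc ε₁ ε₂) :
    |sn g r| ^ (n - 1) • signedForce g p x (geo g x u r) =
      Real.sign (slope g p x u r) • refl g x (cons 0 u) := by
  rcases mem_radialRange_or_neg hr with hr | hr
  · exact h.signedForce_geo_of_mem hu hr hp
  · have hgeo : geo g x (-u) (-r) = geo g x u r := by rw [geo_neg, neg_neg]
    have hu' : ‖-u‖ = 1 := by rwa [norm_neg]
    have h1 := h.signedForce_geo_of_mem hu' hr (by rwa [hgeo])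
    have hs := h.sn_pos hu' hr (by rwa [hgeo])
    have h2 := away_geo (p := p) h.mem_space hu' (-r)
    rw [hgeo, away_geo h.mem_space hu, sn_neg] at h2
    have hslope : slope g p x (-u) (-r) = -slope g p x u r := by
      rw [sn_neg] at hs
      refine mul_left_cancel₀ hs.ne' ?_
      linear_combination -h2
    have hcons : (cons 0 (-u) : Ambient n) = -cons 0 u := by
      rw [← neg_one_smul ℝ (cons _ _), smul_cons]; simp
    rwa [hgeo, sn_neg, abs_neg, hslope, hcons, map_neg, Real.sign_neg, neg_smul_neg] at h1

/-- The compact layer avoids the zeros of `sn`. To obtain a lower bound by compactness, `sn²` is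
written as the continuous function `kap g * (1 - pairing g x y ^ 2)`. -/
theorem exists_signedForce_bound (h : InDomain g d p ε₁ ε₂ x) :
    ∃ C, ∀ y ∈ layer g p ε₁ ε₂, ‖signedForce g p x y‖ ≤ C := by
  have hn : 1 ≤ n := by have := h.two_le; omega
  obtain ⟨B, hB⟩ := (isCompact_sphere (0 : EuclideanSpace ℝ (Fin n)) 1).exists_bound_of_continuousOn
    (f := fun u => refl g x (cons 0 u)) ((continuous_refl x).comp
      (continuous_cons.comp (continuous_const.prodMk continuous_id))).continuousOn
  rcases (layer g p ε₁ ε₂).eq_empty_or_nonempty with hne | hne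
  · exact ⟨0, by simp [hne]⟩
  have hf : Continuous fun y => kap g * (1 - pairing g x y ^ 2) :=
    continuous_const.mul (continuous_const.sub ((continuous_const.pairing continuous_id g).pow 2))
  obtain ⟨z, hz, hmin⟩ := h.isCompact_layer.exists_isMinOn hne hf.continuousOn
  have hsq : ∀ (u : EuclideanSpace ℝ (Fin n)) (r : ℝ), ‖u‖ = 1 →
      kap g * (1 - pairing g x (geo g x u r) ^ 2) = sn g r ^ 2 := by
    intro u r hu
    have := pairing_geo_geo (g := g) hu x 0 r
    rw [geo_zero h.mem_space, zero_sub, cs_neg] at this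
    rw [this]
    linear_combination (-(kap g * cs g r ^ 2)) * kap_mul_self g - cs_sq_add g r
  set m := kap g * (1 - pairing g x z ^ 2) with hm
  have hm0 : 0 < m := by
    obtain ⟨u, hu, r, hr, rfl⟩ := exists_eq_geo hn h.mem_space hz.1
    rw [hm, hsq u r hu]
    exact pow_pos (h.sn_pos hu hr hz.2) 2
  refine ⟨(Real.sqrt m ^ (n - 1))⁻¹ * B, fun y hy => ?_⟩
  have hmy : m ≤ _ := hmin hy
  obtain ⟨u, hu, r, hr, rfl⟩ := exists_eq_geo hn h.mem_space hy.1
  have hs := h.sn_pos hu hr hy.2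
  have h1 : Real.sqrt m ≤ sn g r := by
    rw [Real.sqrt_le_left hs.le, ← hsq u r hu]
    exact hmy
  have h2 := hB u (mem_sphere_zero_iff_norm.2 hu)
  have h3 := Real.sqrt_pos.2 hm0
  rw [signedForce, force_geo h.mem_space hu hr hs.ne', norm_smul, norm_smul, norm_inv, norm_pow,
    Real.norm_of_nonneg hs.le]
  calc _ ≤ 1 * ((sn g r ^ (n - 1))⁻¹ * ‖refl g x (cons 0 u)‖) := by
        gcongr; exact norm_sign_le _
    _ ≤ _ := by rw [one_mul]; gcongr

theorem integrable_coneExt (h : InDomain g d p ε₁ ε₂ x) :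
    Integrable (coneExt g ((layer g p ε₁ ε₂).indicator (signedForce g p x))) := by
  obtain ⟨C, hC⟩ := h.exists_signedForce_bound
  exact integrable_coneExt_indicator h.isCompact_layer
    (measurable_signedForce g p x).stronglyMeasurable hC

theorem coneExt_smul_geo (h : InDomain g d p ε₁ ε₂ x) (hu : ‖u‖ = 1) {t r : ℝ} (ht : 0 < t)
    (hr : r ∈ openRange g) :
    |t * sn g r| ^ (n - 1) •
      coneExt g ((layer g p ε₁ ε₂).indicator (signedForce g p x)) (t • geo g x u r) =
    ((Iio (1 : ℝ)).indicator (fun t => t ^ (n - 1)) t *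
      {r | pol p (geo g x u r) ∈ Icc ε₁ ε₂}.indicator (fun r => Real.sign (slope g p x u r)) r) •
        refl g x (cons 0 u) := by
  rw [coneExt_smul _ (geo_mem_space h.mem_space hu r) ht]
  by_cases h1 : t ∈ Iio (1 : ℝ)
  · rw [indicator_of_mem h1, indicator_of_mem h1]
    by_cases hp : pol p (geo g x u r) ∈ Icc ε₁ ε₂
    · rw [indicator_of_mem (show r ∈ {r | pol p (geo g x u r) ∈ Icc ε₁ ε₂} from hp),
        indicator_of_mem (mem_layer_iff.2 ⟨geo_mem_space h.mem_space hu r, hp⟩), abs_mul,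
        abs_of_pos ht, mul_pow, mul_smul, mul_smul, h.signedForce_geo hu hr hp]
    · rw [indicator_of_notMem (show r ∉ {r | pol p (geo g x u r) ∈ Icc ε₁ ε₂} from hp),
        indicator_of_notMem fun hy => hp (mem_layer_iff.1 hy).2, mul_zero, zero_smul, smul_zero]
  · rw [indicator_of_notMem h1, indicator_of_notMem h1, zero_mul, zero_smul, smul_zero]

/-- In planar polar coordinates the integrand separates into a function of the radius and the sign
of the slope; the second factor integrates to zero. -/
theorem integral_plane (h : InDomain g d p ε₁ ε₂ x) (hu : ‖u‖ = 1) :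
    ∫ q : ℝ × ℝ, |q.1| ^ (n - 1) •
      coneExt g ((layer g p ε₁ ε₂).indicator (signedForce g p x)) (refl g x (cons q.2 (q.1 • u)))
        = 0 := by
  set Ψ := coneExt g ((layer g p ε₁ ε₂).indicator (signedForce g p x)) with hΨ
  set K : ℝ × ℝ → Ambient n := fun q => |q.2| ^ (n - 1) • Ψ (refl g x (cons q.1 (q.2 • u))) with hK
  have hswap : ∫ q : ℝ × ℝ, K q.swap = ∫ q, K q :=
    (Measure.measurePreserving_swap (μ := (volume : Measure ℝ)) (ν := (volume : Measure ℝ))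
      ).integral_comp' (f := MeasurableEquiv.prodComm) K
  refine hswap.trans ?_
  have hO : MeasurableSet (openRange g) := by
    cases g
    · exact measurableSet_Ioo
    · exact MeasurableSet.univ
  have hS : MeasurableSet {r | pol p (geo g x u r) ∈ Icc ε₁ ε₂} := by
    have h1 : Continuous fun r : ℝ => (u, r) := by fun_prop
    exact ((continuous_pol p).comp ((continuous_geo g x).comp h1)).measurable measurableSet_Icc
  rw [integral_planar g K]
  · have h1 : ∀ q ∈ Ioi (0 : ℝ) ×ˢ openRange g, q.1 • K (q.1 * cs g q.2, q.1 * sn g q.2) =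
        ((q.1 * (Iio (1 : ℝ)).indicator (fun t => t ^ (n - 1)) q.1) *
          {r | pol p (geo g x u r) ∈ Icc ε₁ ε₂}.indicator (fun r => Real.sign (slope g p x u r)) q.2)
          • refl g x (cons 0 u) := by
      rintro ⟨t, r⟩ ⟨ht, hr⟩
      have h2 : refl g x (cons (t * cs g r) ((t * sn g r) • u)) = t • geo g x u r := by
        rw [geo, ← map_smul, smul_cons, smul_smul]
      simp only [hK, h2]
      rw [hΨ, h.coneExt_smul_geo hu ht hr, smul_smul, mul_assoc]
    rw [setIntegral_congr_fun (measurableSet_Ioi.prod hO) h1, integral_smul_const,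
      Measure.volume_eq_prod, ← Measure.prod_restrict,
      integral_prod_mul (fun t : ℝ => t * (Iio (1 : ℝ)).indicator (fun t => t ^ (n - 1)) t),
      setIntegral_indicator hS]
    have h3 := h.integral_sign_slope hu
    rw [show openRange g ∩ {r | pol p (geo g x u r) ∈ Icc ε₁ ε₂} =
      {r | r ∈ openRange g ∧ pol p (geo g x u r) ∈ Icc ε₁ ε₂} from rfl, h3, mul_zero, zero_smul]
  · rintro rfl ⟨a, s⟩ has
    simp only [hK]
    rw [hΨ, coneExt_refl_eq_zero _ h.mem_space, smul_zero]
    rwa [norm_smul, hu, mul_one, Real.norm_eq_abs]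

/-- After the reflection taking the pole to `x`, the planes containing the axis are the planes of
the geodesics through `x`, and each of them contributes zero. -/
theorem integral_coneExt (h : InDomain g d p ε₁ ε₂ x) :
    ∫ z, coneExt g ((layer g p ε₁ ε₂).indicator (signedForce g p x)) z = 0 := by
  set Ψ := coneExt g ((layer g p ε₁ ε₂).indicator (signedForce g p x)) with hΨ
  have hmeas : StronglyMeasurable Ψ := stronglyMeasurable_coneExt
    ((measurable_signedForce g p x).stronglyMeasurable.indicator
      h.isCompact_layer.measurableSet)
  have hT := (measurePreserving_refl g x).comp (measurePreserving_cons n)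
  have hi := hT.integrable_comp_of_integrable h.integrable_coneExt
  have hint := integral_map hT.aemeasurable hmeas.aestronglyMeasurable
  rw [hT.map_eq] at hint
  have : Nontrivial (EuclideanSpace ℝ (Fin n)) := by
    obtain ⟨u, hu⟩ := exists_unit (n := n) (by have := h.two_le; omega)
    exact ⟨u, 0, fun h0 => by simp [h0] at hu⟩
  refine hint.trans (integral_eq_zero_of_planes volume (hmeas.comp_measurable hT.measurable) hi
    fun u hu => ?_)
  rw [finrank_euclideanSpace_fin]
  exact h.integral_plane hu

theorem integrableOn_signedForce (h : InDomain g d p ε₁ ε₂ x) :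
    IntegrableOn (signedForce g p x) (layer g p ε₁ ε₂) (vol g n) := by
  rw [← integrable_indicator_iff h.isCompact_layer.measurableSet]
  exact integrable_vol ((measurable_signedForce g p x).stronglyMeasurable.indicator
    h.isCompact_layer.measurableSet) h.integrable_coneExt

theorem integral_signedForce (h : InDomain g d p ε₁ ε₂ x) :
    ∫ y in layer g p ε₁ ε₂, signedForce g p x y ∂(vol g n) = 0 := by
  rw [← integral_indicator h.isCompact_layer.measurableSet,
    integral_vol ((measurable_signedForce g p x).stronglyMeasurable.indicator
      h.isCompact_layer.measurableSet), h.integral_coneExt, smul_zero]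

theorem exists_fieldIntegrand_eq (h₀ : InDomain g d p ε₁ ε₂ x₀) (h : InDomain g d p ε₁ ε₂ x)
    (ρ : ℝ) : ∃ c : ℝ, EqOn (fieldIntegrand g p ε₁ ε₂ ρ x₀ x) (c • signedForce g p x)
      (layer g p ε₁ ε₂) := by
  obtain ⟨c, hc⟩ := h₀.exists_sign h
  refine ⟨ρ * c, fun y hy => ?_⟩
  rw [fieldIntegrand, h₀.chargeSign_eq hy, hc y hy, Pi.smul_apply, signedForce, smul_smul, mul_assoc]

end InDomain

end Field

end ConstCurv

theorem theorem4p8 (g : ConstCurv.Geometry) (n d : ℕ) (hn : 2 ≤ n) (hd : 2 ≤ d)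
    (p : MvPolynomial (Fin (n + 1)) ℝ) (hp : p.IsHomogeneous d)
    (hM : (ConstCurv.hyperbolicityDomain g d p 0).Nonempty)
    (ε₁ ε₂ : ℝ) (hε : ε₁ < ε₂) (ρ : ℝ)
    (x₀ : ConstCurv.Ambient n) (hx₀ : x₀ ∈ ConstCurv.layerDomain g d p ε₁ ε₂) :
    ∀ x ∈ ConstCurv.layerDomain g d p ε₁ ε₂,
      MeasureTheory.IntegrableOn (ConstCurv.fieldIntegrand g p ε₁ ε₂ ρ x₀ x)
        (ConstCurv.layer g p ε₁ ε₂) (ConstCurv.vol g n) ∧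
      ConstCurv.layerField g p ε₁ ε₂ ρ x₀ x = 0 := by
  intro x hx
  -- The hyperbolicity of the level `0` enters here: for even `d` a constant occupies the middle
  -- degree in `exp(2r)`.
  have heven : g = .hyperbolic → Even d := by
    rintro rfl
    exact ConstCurv.even_of_hyperbolicityDomain_nonempty hn hd hp hM
  have h : ConstCurv.InDomain g d p ε₁ ε₂ x := ⟨hn, hd, hp, heven, hε, hx.1, hx.2⟩
  have h₀ : ConstCurv.InDomain g d p ε₁ ε₂ x₀ := ⟨hn, hd, hp, heven, hε, hx₀.1, hx₀.2⟩
  obtain ⟨c, hc⟩ := h₀.exists_fieldIntegrand_eq h ρ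
  have hL := h.isCompact_layer.measurableSet
  constructor
  · rw [integrableOn_congr_fun hc hL]
    exact h.integrableOn_signedForce.smul c
  · rw [ConstCurv.layerField, setIntegral_congr_fun hL hc]
    simp only [Pi.smul_apply]
    rw [integral_smul, h.integral_signedForce, smul_zero]
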